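/- **Setting.** Let $K$ be a field of characteristic $0$ and let $q\in K$ be nonzero and not a root of unity. Let $\theta(\alpha)\in\{0,1\}$; the value $0$ corresponds to $U_q(A_1^{(1)})$ and the value $1$ to $U_q(C(2)^{(2)})$. On the root lattice $\mathbb Z\alpha\oplus\mathbb Z\delta$ put $(\alpha,\alpha)=2$, $(\alpha,\delta)=(\delta,\delta)=0$, $(\mathrm d,\alpha)=0$, $(\mathrm d,\delta)=1$, and let the parity be $\theta(a\alpha+n\delta)=a\,\theta(\alpha)\bmod 2$. For vectors $x,y$ of weights $\beta,\beta'$ put $[x,y]=xy-(-1)^{\theta(\beta)\theta(\beta')}yx$ and $[x,y]_{t}=xy-(-1)^{\theta(\beta)\theta(\beta')}t^{(\beta,\beta')}yx$. The algebra is the associative unital $K$-algebra generated by $k_\gamma^{\pm1}$ ($\gamma=\mathrm d,\alpha,\delta-\alpha$), $e_{\pm\alpha}$, $e_{\pm(\delta-\alpha)}$ with relations $$k_\gamma k_\gamma^{-1}=k_\gamma^{-1}k_\gamma=1,\quad [k_\gamma^{\pm1},k_{\gamma'}^{\pm1}]=0,\quad k_\gamma e_{\pm\beta}k_\gamma^{-1}=q^{\pm(\gamma,\beta)}e_{\pm\beta}\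 (\beta=\alpha,\delta-\alpha),$$ $$[e_\alpha,e_{-\delta+\alpha}]=[e_{-\alpha},e_{\delta-\alpha}]=0,\qquad [e_\beta,e_{-\beta}]=\frac{k_\beta-k_\beta^{-1}}{q-q^{-1}}\ (\beta=\alpha,\delta-\alpha),$$ $$[e_{\pm\alpha},[e_{\pm\alpha},[e_{\pm\alpha},e_{\pm(\delta-\alpha)}]_q]_q]_q=0,\qquad [[[e_{\pm\alpha},e_{\pm(\delta-\alpha)}]_q,e_{\pm(\delta-\alpha)}]_q,e_{\pm(\delta-\alpha)}]_q=0 .$$ Put $k_{a\alpha+n\delta}=k_\alpha^{a+n}k_{\delta-\alpha}^{n}$, $a=\frac{q^{(\alpha,\alpha)}-q^{-(\alpha,\alpha)}}{q-q^{-1}}$, $q_\alpha=(-1)^{\theta(\alpha)}q^{(\alpha,\alpha)}$, and for $n=1,2,\dots$ $$e_\delta=[e_\alpha,e_{\delta-\alpha}]_q,\qquad e_{-\delta}=[e_{-\delta+\alpha},e_{-\alpha}]_{q^{-1}},$$ $$e_{n\delta+\alpha}=\tfrac1a[e_{(n-1)\delta+\alpha},e_\delta],\qquad e_{-n\delta-\alpha}=\tfrac1a[e_{-\delta},e_{-(n-1)\delta-\alpha}],$$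 $$e_{(n+1)\delta-\alpha}=\tfrac1a[e_\delta,e_{n\delta-\alpha}],\qquad e_{-(n+1)\delta+\alpha}=\tfrac1a[e_{-n\delta+\alpha},e_{-\delta}],$$ $$e'_{n\delta}=[e_\alpha,e_{n\delta-\alpha}]_q,\qquad e'_{-n\delta}=[e_{-n\delta+\alpha},e_{-\alpha}]_{q^{-1}}.$$ **Proposition.** In both algebras the following relations hold ($n,m$ are integers; empty sums are $0$). 1. For all $n\in\mathbb Z$ (with $n\ne0$ for $e'_{n\delta}$) and all $\gamma\in\{\alpha\}\cup\{j\delta\pm\alpha,\,j\delta : j\ge1\}$: $$k_{\mathrm d}e_{n\delta\pm\alpha}k_{\mathrm d}^{-1}=q^{n}e_{n\delta\pm\alpha},\quad k_{\mathrm d}e'_{n\delta}k_{\mathrm d}^{-1}=q^{n}e'_{n\delta},\quad k_\gamma e_{n\delta\pm\alpha}k_\gamma^{-1}=q^{\pm(\gamma,\alpha)}e_{n\delta\pm\alpha},\quad k_\gamma e'_{n\delta}k_\gamma^{-1}=e'_{n\delta}.$$ 2. $$[e_{n\delta+\alpha},e_{-n\delta-\alpha}]=(-1)^{n\theta(\alpha)}\frac{k_{n\delta+\alpha}-k_{n\delta+\alpha}^{-1}}{q-q^{-1}}\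 (n\ge0),\qquad [e_{n\delta-\alpha},e_{-n\delta+\alpha}]=(-1)^{(n-1)\theta(\alpha)}\frac{k_{n\delta-\alpha}-k_{n\delta-\alpha}^{-1}}{q-q^{-1}}\ (n>0).$$ 3. For $n\ge0$, $m>0$: $$[e_{n\delta+\alpha},e_{(n+2m-1)\delta+\alpha}]_q=(q_\alpha^2-1)\sum_{l=1}^{m-1}q_\alpha^{-l}e_{(n+l)\delta+\alpha}e_{(n+2m-1-l)\delta+\alpha},$$ $$[e_{n\delta+\alpha},e_{(n+2m)\delta+\alpha}]_q=(q_\alpha-1)q_\alpha^{-m+1}e_{(n+m)\delta+\alpha}^2+(q_\alpha^2-1)\sum_{l=1}^{m-1}q_\alpha^{-l}e_{(n+l)\delta+\alpha}e_{(n+2m-l)\delta+\alpha}.$$ 4. For $n,m>0$: $$[e_{(n+2m-1)\delta-\alpha},e_{n\delta-\alpha}]_q=(q_\alpha^2-1)\sum_{l=1}^{m-1}q_\alpha^{-l}e_{(n+2m-1-l)\delta-\alpha}e_{(n+l)\delta-\alpha},$$ $$[e_{(n+2m)\delta-\alpha},e_{n\delta-\alpha}]_q=(q_\alpha-1)q_\alpha^{-m+1}e_{(n+m)\delta-\alpha}^2+(q_\alpha^2-1)\sum_{l=1}^{m-1}q_\alpha^{-l}e_{(n+2m-l)\delta-\alpha}e_{(n+l)\delta-\alpha}.$$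 5. For $n,m>0$: $$[e_{-n\delta+\alpha},e_{(n+2m-1)\delta+\alpha}]=-(-1)^{(n-1)\theta(\alpha)}(q_\alpha^2-1)\sum_{l=n}^{n+m-1}q_\alpha^{-l}k_{n\delta-\alpha}e_{(l-n)\delta+\alpha}e_{(n+2m-1-l)\delta+\alpha}$$ $$\qquad+(q_\alpha^2-1)\sum_{l=1}^{n-1}(-1)^{l\theta(\alpha)}q_\alpha^{-l}k_\delta^le_{(-n+l)\delta+\alpha}e_{(n+2m-1-l)\delta+\alpha},$$ $$[e_{-n\delta+\alpha},e_{(n+2m)\delta+\alpha}]=-(-1)^{(n-1)\theta(\alpha)}(q_\alpha^2-1)\sum_{l=n}^{n+m-1}q_\alpha^{-l}k_{n\delta-\alpha}e_{(l-n)\delta+\alpha}e_{(n+2m-l)\delta+\alpha}$$ $$\qquad+(q_\alpha^2-1)\sum_{l=1}^{n-1}(-1)^{l\theta(\alpha)}q_\alpha^{-l}k_\delta^le_{(-n+l)\delta+\alpha}e_{(n+2m-l)\delta+\alpha}-(-1)^{(n-1)\theta(\alpha)}(q_\alpha-1)q_\alpha^{-m-n+1}k_{n\delta-\alpha}e_{m\delta+\alpha}^2.$$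 6. For $n\ge0$, $m>0$: $$[e_{(n+2m-1)\delta-\alpha},e_{-n\delta-\alpha}]=-(-1)^{(n+1)\theta(\alpha)}(q_\alpha^2-1)\sum_{l=n+1}^{n+m-1}q_\alpha^{-l}e_{(n+2m-1-l)\delta-\alpha}e_{(l-n)\delta-\alpha}k_{n\delta+\alpha}^{-1}$$ $$\qquad+(q_\alpha^2-1)\sum_{l=1}^{n}(-1)^{l\theta(\alpha)}q_\alpha^{-l}e_{(n+2m-1-l)\delta-\alpha}e_{(-n+l)\delta-\alpha}k_\delta^{-l},$$ $$[e_{(n+2m)\delta-\alpha},e_{-n\delta-\alpha}]=-(-1)^{(n+1)\theta(\alpha)}(q_\alpha^2-1)\sum_{l=n+1}^{n+m-1}q_\alpha^{-l}e_{(n+2m-l)\delta-\alpha}e_{(l-n)\delta-\alpha}k_{n\delta+\alpha}^{-1}$$ $$\qquad+(q_\alpha^2-1)\sum_{l=1}^{n}(-1)^{l\theta(\alpha)}q_\alpha^{-l}e_{(n+2m-l)\delta-\alpha}e_{(-n+l)\delta-\alpha}k_\delta^{-l}-(-1)^{(n+1)\theta(\alpha)}(q_\alpha-1)q_\alpha^{-m-n+1}e_{m\delta-\alpha}^2k_{n\delta+\alpha}^{-1}.$$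 7. $$[e_{n\delta+\alpha},e_{m\delta-\alpha}]_q=e'_{(n+m)\delta}\quad(n\ge0,\ m>0),$$ $$[e_{n\delta+\alpha},e_{-m\delta-\alpha}]=-(-1)^{(m+1)\theta(\alpha)}e'_{(n-m)\delta}k_{m\delta+\alpha}^{-1}\quad(n>m\ge0),$$ $$[e_{-m\delta+\alpha},e_{n\delta-\alpha}]=-(-1)^{(m-1)\theta(\alpha)}k_{m\delta-\alpha}e'_{(n-m)\delta}\quad(n>m>0).$$ 8. $[e'_{n\delta},e'_{m\delta}]=[e'_{-n\delta},e'_{-m\delta}]=0$ for $n,m>0$. 9. $$[e_{n\delta+\alpha},e'_{m\delta}]=q_\alpha^{-m+1}a\,e_{(n+m)\delta+\alpha}+(q_\alpha^2-1)\sum_{l=1}^{m-1}q_\alpha^{-l}e_{(n+l)\delta+\alpha}e'_{(m-l)\delta}\quad(n\ge0,\ m>0),$$ $$[e'_{m\delta},e_{n\delta-\alpha}]=q_\alpha^{-m+1}a\,e_{(n+m)\delta-\alpha}+(q_\alpha^2-1)\sum_{l=1}^{m-1}q_\alpha^{-l}e'_{(m-l)\delta}e_{(n+l)\delta-\alpha}\quad(n,m>0).$$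 10. For $m\ge n>0$: $$[e_{-n\delta+\alpha},e'_{m\delta}]=-(-1)^{(n-1)\theta(\alpha)}q_\alpha^{-m+1}a\,k_{n\delta-\alpha}e_{(m-n)\delta+\alpha}-(-1)^{(n-1)\theta(\alpha)}(q_\alpha^2-1)k_{n\delta-\alpha}\sum_{l=n}^{m-1}q_\alpha^{-l}e_{(l-n)\delta+\alpha}e'_{(m-l)\delta}$$ $$\qquad+(q_\alpha^2-1)\sum_{l=1}^{n-1}(-1)^{l\theta(\alpha)}q_\alpha^{-l}k_\delta^le_{(-n+l)\delta+\alpha}e'_{(m-l)\delta};$$ for $n>m>0$: $$[e_{-n\delta+\alpha},e'_{m\delta}]=(-1)^{m\theta(\alpha)}q_\alpha^{-m+1}a\,k_\delta^me_{(-n+m)\delta+\alpha}+(q_\alpha^2-1)\sum_{l=1}^{m-1}(-1)^{l\theta(\alpha)}q_\alpha^{-l}k_\delta^le_{(-n+l)\delta+\alpha}e'_{(m-l)\delta}.$$ 11. For $m>n\ge0$: $$[e'_{m\delta},e_{-n\delta-\alpha}]=-(-1)^{(n+1)\theta(\alpha)}q_\alpha^{-m+1}a\,e_{(m-n)\delta-\alpha}k_{n\delta+\alpha}^{-1}-(-1)^{(n+1)\theta(\alpha)}(q_\alpha^2-1)\sum_{l=n+1}^{m-1}q_\alpha^{-l}e'_{(m-l)\delta}e_{(l-n)\delta-\alpha}k_{n\delta+\alpha}^{-1}$$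 $$\qquad+(q_\alpha^2-1)\sum_{l=1}^{n}(-1)^{l\theta(\alpha)}q_\alpha^{-l}e'_{(m-l)\delta}e_{(-n+l)\delta-\alpha}k_\delta^{-l};$$ for $n\ge m>0$: $$[e'_{m\delta},e_{-n\delta-\alpha}]=(-1)^{m\theta(\alpha)}q_\alpha^{-m+1}a\,e_{(-n+m)\delta-\alpha}k_\delta^{-m}+(q_\alpha^2-1)\sum_{l=1}^{m-1}(-1)^{l\theta(\alpha)}q_\alpha^{-l}e'_{(m-l)\delta}e_{(-n+l)\delta-\alpha}k_\delta^{-l}.$$ -/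

import Mathlib

/-!
The quantum affine algebra `U_q(A_1^{(1)})` and the quantum affine superalgebra `U_q(C(2)^{(2)})`
by generators and relations, and their Cartan-Weyl root vectors for the "direct" normal ordering
`α, δ+α, 2δ+α, …, δ, 2δ, …, 2δ-α, δ-α`.
-/

namespace AffineCW

/-- The two types: `A_1^{(1)}` (simple roots even) and `C(2)^{(2)}` (simple roots odd). -/
inductive AffType
  | A11
  | C22

/-- `θ(α)`, which is also `θ(δ-α)`. -/
def AffType.theta : AffType → ℕ
  | .A11 => 0
  | .C22 => 1

/-- The root lattice `ℤα + ℤδ`; the pair `(a, n)` stands for `a α + n δ`. -/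
abbrev Wt : Type := ℤ × ℤ

/-- The simple roots `α` and `δ-α`. -/
inductive Node
  | al
  | de

/-- `α = (1, 0)` and `δ - α = (-1, 1)`. -/
def Node.wt : Node → Wt
  | .al => (1, 0)
  | .de => (-1, 1)

/-- The invariant form on the root lattice: `(α,α) = 2`, `(α,δ) = (δ,δ) = 0`. -/
def form (β γ : Wt) : ℤ := 2 * β.1 * γ.1

/-- The parity `θ(a α + n δ) = a θ(α) mod 2` (so `δ` is even). -/
def parity (c : AffType) (β : Wt) : ℕ := c.theta * (β.1.natAbs % 2)

/-- The reduced positive root system `{α, nδ ± α, nδ | n ≥ 1}`, the same for both types. -/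
def redPos : Set Wt :=
  {β | (β.1 = 1 ∧ 0 ≤ β.2) ∨ (β.1 = 0 ∧ 0 < β.2) ∨ (β.1 = -1 ∧ 0 < β.2)}

/-- Indices `d`, `α`, `δ-α` of the Cartan generators. -/
inductive CartanIdx
  | d
  | node (i : Node)

/-- The pairing of `d`, `α`, `δ-α` with the root lattice: `(d,α) = 0`, `(d,δ) = 1`. -/
def CartanIdx.pair : CartanIdx → Wt → ℤ
  | .d, β => β.2
  | .node i, β => form i.wt β

/-- The Chevalley generators `k_γ`, `k_γ⁻¹`, `e_β`, `e_{-β}`. -/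
inductive Gen
  | k (γ : CartanIdx)
  | kInv (γ : CartanIdx)
  | ePos (i : Node)
  | eNeg (i : Node)

section Brackets

variable {K : Type*} [Field K] {A : Type*} [Ring A] [Algebra K A]

/-- The supercommutator `[x, y] = xy - (-1)^{θ(β)θ(β')} yx` of vectors of weights `β`, `β'`. -/
def sComm (c : AffType) (β β' : Wt) (x y : A) : A :=
  x * y - (-1) ^ (parity c β * parity c β') * (y * x)

/-- The `t`-supercommutator `[x, y]_t = xy - (-1)^{θ(β)θ(β')} t^{(β,β')} yx` of vectors of weights
`β`, `β'`. -/
def qComm (c : AffType) (t : K) (β β' : Wt) (x y : A) : A :=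
  x * y - (-1) ^ (parity c β * parity c β') * (t ^ form β β' • (y * x))

end Brackets

section Algebra

variable {K : Type*} [Field K]

/-- The Chevalley generators `e_{±β}` in the free algebra; `true` is the sign `+`. -/
def chev (K : Type*) [Field K] (s : Bool) (i : Node) : FreeAlgebra K Gen :=
  FreeAlgebra.ι K (if s then Gen.ePos i else Gen.eNeg i)

/-- The weight `±β` of `e_{±β}`. -/
def sWt (s : Bool) (i : Node) : Wt := if s then i.wt else -i.wt

/-- The defining relations. The commutation of the `k_γ⁻¹` among themselves and with the `k_γ'`
follows from `k_mul_kInv`, `kInv_mul_k` and `k_comm`. -/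
inductive Rel (c : AffType) (q : K) : FreeAlgebra K Gen → FreeAlgebra K Gen → Prop
  | k_mul_kInv (γ : CartanIdx) :
      Rel c q (FreeAlgebra.ι K (.k γ) * FreeAlgebra.ι K (.kInv γ)) 1
  | kInv_mul_k (γ : CartanIdx) :
      Rel c q (FreeAlgebra.ι K (.kInv γ) * FreeAlgebra.ι K (.k γ)) 1
  | k_comm (γ γ' : CartanIdx) :
      Rel c q (FreeAlgebra.ι K (.k γ) * FreeAlgebra.ι K (.k γ'))
        (FreeAlgebra.ι K (.k γ') * FreeAlgebra.ι K (.k γ))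
  | k_e (γ : CartanIdx) (s : Bool) (i : Node) :
      Rel c q (FreeAlgebra.ι K (.k γ) * chev K s i * FreeAlgebra.ι K (.kInv γ))
        (q ^ γ.pair (sWt s i) • chev K s i)
  /-- `[e_α, e_{-δ+α}] = 0` -/
  | al_negde :
      Rel c q (sComm c (sWt true .al) (sWt false .de) (chev K true .al) (chev K false .de)) 0
  /-- `[e_{-α}, e_{δ-α}] = 0` -/
  | negal_de :
      Rel c q (sComm c (sWt false .al) (sWt true .de) (chev K false .al) (chev K true .de)) 0
  /-- `[e_β, e_{-β}] = (k_β - k_β⁻¹)/(q - q⁻¹)` for `β = α, δ-α` -/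
  | e_neg (i : Node) :
      Rel c q (sComm c (sWt true i) (sWt false i) (chev K true i) (chev K false i))
        ((q - q⁻¹)⁻¹ • (FreeAlgebra.ι K (.k (.node i)) - FreeAlgebra.ι K (.kInv (.node i))))
  /-- `[e_{±α}, [e_{±α}, [e_{±α}, e_{±(δ-α)}]_q]_q]_q = 0` -/
  | serre_al (s : Bool) :
      Rel c q
        (qComm c q (sWt s .al) (sWt s .al + (sWt s .al + sWt s .de)) (chev K s .al)
          (qComm c q (sWt s .al) (sWt s .al + sWt s .de) (chev K s .al)
            (qComm c q (sWt s .al) (sWt s .de) (chev K s .al) (chev K s .de)))) 0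
  /-- `[[[e_{±α}, e_{±(δ-α)}]_q, e_{±(δ-α)}]_q, e_{±(δ-α)}]_q = 0` -/
  | serre_de (s : Bool) :
      Rel c q
        (qComm c q ((sWt s .al + sWt s .de) + sWt s .de) (sWt s .de)
          (qComm c q (sWt s .al + sWt s .de) (sWt s .de)
            (qComm c q (sWt s .al) (sWt s .de) (chev K s .al) (chev K s .de))
            (chev K s .de))
          (chev K s .de)) 0

/-- `U_q(A_1^{(1)})` for `c = .A11` and `U_q(C(2)^{(2)})` for `c = .C22`. -/
abbrev Uq (c : AffType) (q : K) : Type _ := RingQuot (Rel c q)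

/-- The image in `Uq c q` of a Chevalley generator. -/
noncomputable def gen (c : AffType) (q : K) (g : Gen) : Uq c q :=
  RingQuot.mkAlgHom K (Rel c q) (FreeAlgebra.ι K g)

/-- The Cartan generators `k_d`, `k_α`, `k_{δ-α}`, as units. -/
noncomputable def kGen (c : AffType) (q : K) (γ : CartanIdx) : (Uq c q)ˣ where
  val := gen c q (.k γ)
  inv := gen c q (.kInv γ)
  val_inv := by
    have h := RingQuot.mkAlgHom_rel K (Rel.k_mul_kInv (c := c) (q := q) γ)
    rwa [map_mul, map_one] at h
  inv_val := by
    have h := RingQuot.mkAlgHom_rel K (Rel.kInv_mul_k (c := c) (q := q) γ)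
    rwa [map_mul, map_one] at h

/-- `k_β` for `β = a α + n δ = (a + n) α + n (δ - α)` in the root lattice. -/
noncomputable def kRoot (c : AffType) (q : K) (β : Wt) : (Uq c q)ˣ :=
  kGen c q (.node .al) ^ (β.1 + β.2) * kGen c q (.node .de) ^ β.2

/-- `a = [(α,α)]_q`. -/
def aCoef (q : K) : K :=
  (q ^ form Node.al.wt Node.al.wt - q ^ (-form Node.al.wt Node.al.wt)) / (q - q⁻¹)

/-- `q_α = (-1)^{θ(α)} q^{(α,α)}`. -/
def qAl (c : AffType) (q : K) : K := (-1) ^ c.theta * q ^ form Node.al.wt Node.al.wt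

/-- The sign `(-1)^{n θ(α)}`. -/
def sgn (K : Type*) [Field K] (c : AffType) (n : ℤ) : K := (-1) ^ (n * (c.theta : ℤ))

/-- `e_δ = [e_α, e_{δ-α}]_q`. -/
noncomputable def eDelta (c : AffType) (q : K) : Uq c q :=
  qComm c q (1, 0) (-1, 1) (gen c q (.ePos .al)) (gen c q (.ePos .de))

/-- `e_{-δ} = [e_{-δ+α}, e_{-α}]_{q⁻¹}`. -/
noncomputable def eNegDelta (c : AffType) (q : K) : Uq c q :=
  qComm c q⁻¹ (1, -1) (-1, 0) (gen c q (.eNeg .de)) (gen c q (.eNeg .al))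

/-- `e_{nδ+α}` for `n ≥ 0`: `e_{(n+1)δ+α} = a⁻¹ [e_{nδ+α}, e_δ]`. -/
noncomputable def posPlus (c : AffType) (q : K) : ℕ → Uq c q
  | 0 => gen c q (.ePos .al)
  | n + 1 => (aCoef q)⁻¹ • sComm c (1, (n : ℤ)) (0, 1) (posPlus c q n) (eDelta c q)

/-- `e_{(n+1)δ-α}` for `n ≥ 0`: `e_{(n+2)δ-α} = a⁻¹ [e_δ, e_{(n+1)δ-α}]`. -/
noncomputable def posMinus (c : AffType) (q : K) : ℕ → Uq c q
  | 0 => gen c q (.ePos .de)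
  | n + 1 => (aCoef q)⁻¹ • sComm c (0, 1) (-1, (n : ℤ) + 1) (eDelta c q) (posMinus c q n)

/-- `e_{-nδ-α}` for `n ≥ 0`: `e_{-(n+1)δ-α} = a⁻¹ [e_{-δ}, e_{-nδ-α}]`. -/
noncomputable def negMinus (c : AffType) (q : K) : ℕ → Uq c q
  | 0 => gen c q (.eNeg .al)
  | n + 1 => (aCoef q)⁻¹ • sComm c (0, -1) (-1, -(n : ℤ)) (eNegDelta c q) (negMinus c q n)

/-- `e_{-(n+1)δ+α}` for `n ≥ 0`: `e_{-(n+2)δ+α} = a⁻¹ [e_{-(n+1)δ+α}, e_{-δ}]`. -/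
noncomputable def negPlus (c : AffType) (q : K) : ℕ → Uq c q
  | 0 => gen c q (.eNeg .de)
  | n + 1 => (aCoef q)⁻¹ • sComm c (1, -((n : ℤ) + 1)) (0, -1) (negPlus c q n) (eNegDelta c q)

/-- Labels of the root vectors: `plus n` for `e_{nδ+α}`, `minus n` for `e_{nδ-α}` and, for
`n ≠ 0`, `imag n` for `e'_{nδ}`. -/
inductive RootLabel
  | plus (n : ℤ)
  | minus (n : ℤ)
  | imag (n : ℤ)

/-- The root belonging to a label. -/
def RootLabel.wt : RootLabel → Wt
  | .plus n => (1, n)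
  | .minus n => (-1, n)
  | .imag n => (0, n)

/-- The root vectors `e_{nδ±α}` (`n ∈ ℤ`) and
`e'_{nδ} = [e_α, e_{nδ-α}]_q`, `e'_{-nδ} = [e_{-nδ+α}, e_{-α}]_{q⁻¹}` (`n ≥ 1`).
There is no root vector `e'_0`; the label `imag 0` is given the value `0` and is never used. -/
noncomputable def e (c : AffType) (q : K) : RootLabel → Uq c q
  | .plus (.ofNat n) => posPlus c q n
  | .plus (.negSucc n) => negPlus c q n
  | .minus (.ofNat 0) => negMinus c q 0
  | .minus (.ofNat (n + 1)) => posMinus c q n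
  | .minus (.negSucc n) => negMinus c q (n + 1)
  | .imag (.ofNat 0) => 0
  | .imag (.ofNat (n + 1)) =>
      qComm c q (1, 0) (-1, (n : ℤ) + 1) (gen c q (.ePos .al)) (posMinus c q n)
  | .imag (.negSucc n) =>
      qComm c q⁻¹ (1, -((n : ℤ) + 1)) (-1, 0) (negPlus c q n) (gen c q (.eNeg .al))

/-- The supercommutator `[e_β, e_β']` of two root vectors. -/
noncomputable def br (c : AffType) (q : K) (r s : RootLabel) : Uq c q :=
  sComm c r.wt s.wt (e c q r) (e c q s)

/-- The `q`-supercommutator `[e_β, e_β']_q` of two root vectors. -/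
noncomputable def brq (c : AffType) (q : K) (r s : RootLabel) : Uq c q :=
  qComm c q r.wt s.wt (e c q r) (e c q s)

end Algebra

end AffineCW

set_option linter.unusedSimpArgs false

/-! Put `p = (-1)^θ` and `Q = q_α = p q²`. If `e_{nδ±α}` is multiplied by a suitable sign and Cartan
unit on the negative side (`curX`, `curY`), the two algebras become indistinguishable: the resulting
currents `X_n`, `Y_n`, with `n` over all integers, satisfy the same Drinfeld-type loop relations,
with the single parameter `Q`. The super signs reappear only when the units are removed again.

The main difficulty is that only `X_{-1}, X_0, Y_0, Y_1` are Chevalley generators up to units; the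
other currents are defined by bracketing with `e_δ` or `e_{-δ}`. The structure `Drin` lists the
relations in a window `X_{n-1}, X_n, Y_{-n}, Y_{1-n}`, including four Serre-type relations. It holds
at `n = 0` by the presentation (`RootVecs.drin_zero`), and it survives a shift of the window to the
right (`Drin.step`) and to the left (`Drin.back`, by an anti-symmetry). Apart from the Serre-type
relations, the shift is the Jacobi identity with `ψ = e_δ` and `ω`, a Cartan multiple of `e_{-δ}`.
That the cubic relation itself is inherited is the content of `serre_next`.

The windows together give a `Loop`: `ψ` raises indices, neighbours `Q`-commute, and `[X_n,
Y_{-n}]_q` commutes with `ψ`. The rest is formal. Bracketing `X_n X_{n+1} = Q X_{n+1} X_n`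
repeatedly with `ψ` gives the quadratic relations `quad`. An induction on the level `N`
(`level_and_comm`) shows together that `[X_r, Y_s]_q` depends only on `r + s = N` and that the
imaginary vectors commute; this is where `Q` not being a root of unity enters. Unrolling the
quadratic relation and the recursions `x_imag`, `imag_y` produces the finite sums of the statement.
A second `Loop`, with `Q⁻¹`, in the opposite algebra (`dual_loop_of_drin`) handles the vectors
`e'_{-nδ}`.

Finally the units are stripped off. In a bracket that involves a negative root vector, the sum
splits where the index `-n + l` changes sign; this yields the two kinds of sums with their powers of
`k_δ` and signs (`sum_X`, `sum_Y`). -/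

namespace AffineCW
-- Propagation of the cubic Serre relation
section Serre
variable {K : Type*} [Field K] {A : Type*} [Ring A] [Algebra K A]

/-- Think of `x_i = X_i`, `y_i = Y_i`, up to scalars: the Serre relation moves one index up. The
second imaginary vector `ψ₂` does the work. It commutes with `ψ`, so its bracket with `x₁` is known;
bracketing the given relation with `ψ₂`, and also twice with `ψ`, gives enough equations to isolate
the new one. -/
theorem serre_next {Q : K} (hQ : Q ≠ 0) (h3 : 1 + Q + Q⁻¹ ≠ 0) (h2 : Q + Q⁻¹ ≠ 0)
    {x₀ x₁ x₂ y₁ y₂ ψ : A} (hψ : x₀ * y₁ - Q⁻¹ • (y₁ * x₀) = ψ)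
    (hx₀ : x₀ * ψ - ψ * x₀ = x₁) (hx₁ : x₁ * ψ - ψ * x₁ = x₂) (hy₁ : ψ * y₁ - y₁ * ψ = y₂)
    (hx : x₀ * x₁ = Q • (x₁ * x₀)) (hy : y₂ * y₁ = Q • (y₁ * y₂)) :
    x₁ * x₂ = Q • (x₂ * x₁) := by
  obtain ⟨ψ₂, hψ₂⟩ : ∃ z, x₁ * y₁ - Q⁻¹ • (y₁ * x₁) = z := ⟨_, rfl⟩
  obtain ⟨x₃, hx₂⟩ : ∃ z, x₂ * ψ - ψ * x₂ = z := ⟨_, rfl⟩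
  obtain ⟨y₃, hy₂⟩ : ∃ z, ψ * y₂ - y₂ * ψ = z := ⟨_, rfl⟩
  have hψ₂' : x₀ * y₂ - Q⁻¹ • (y₂ * x₀) = ψ₂ := by
    rw [← hψ₂, ← hx₀, ← hy₁]
    linear_combination (norm := skip) ψ * hψ - hψ * ψ
    simp only [mul_add, add_mul, mul_sub, sub_mul, smul_mul_assoc, mul_smul_comm, smul_sub, mul_assoc]
    module
  have rx : x₀ * ψ₂ - ψ₂ * x₀ = Q • (x₁ * ψ) - Q⁻¹ • (ψ * x₁) := by
    rw [← hψ₂]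
    linear_combination (norm := skip) hx * y₁ + Q • (x₁ * hψ) - Q⁻¹ • (hψ * x₁) - (Q⁻¹ * Q⁻¹) • (y₁ * hx)
    simp only [mul_add, add_mul, mul_sub, sub_mul, smul_mul_assoc, mul_smul_comm, smul_sub, mul_assoc]
    match_scalars <;> field_simp <;> ring
  have ry : ψ₂ * y₁ - y₁ * ψ₂ = Q • (ψ * y₂) - Q⁻¹ • (y₂ * ψ) := by
    rw [← hψ₂']
    linear_combination (norm := skip) x₀ * hy + Q • (hψ * y₂) - Q⁻¹ • (y₂ * hψ) - (Q⁻¹ * Q⁻¹) • (hy * x₀)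
    simp only [mul_add, add_mul, mul_sub, sub_mul, smul_mul_assoc, mul_smul_comm, smul_sub, mul_assoc]
    match_scalars <;> field_simp <;> ring
  have rule : ∀ {u v : A}, u * ψ - ψ * u = v → ψ * u = u * ψ - v ∧
      ∀ z, ψ * (u * z) = u * (ψ * z) - v * z := by
    rintro u v rfl
    exact ⟨by abel, fun z ↦ by simp only [sub_mul, mul_assoc]; abel⟩
  have rule' : ∀ {u v : A}, ψ * u - u * ψ = v → ψ * u = u * ψ + v ∧
      ∀ z, ψ * (u * z) = u * (ψ * z) + v * z := by
    rintro u v rfl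
    exact ⟨by abel, fun z ↦ by simp only [sub_mul, mul_assoc]; abel⟩
  have g₂ : (x₂ * y₁ - Q⁻¹ • (y₁ * x₂)) - (x₁ * y₂ - Q⁻¹ • (y₂ * x₁)) = ψ₂ * ψ - ψ * ψ₂ := by
    rw [← hx₁, ← hy₁]
    linear_combination (norm := skip) hψ₂ * ψ - ψ * hψ₂
    simp only [mul_add, add_mul, mul_sub, sub_mul, smul_mul_assoc, mul_smul_comm, smul_sub, mul_assoc]
    module
  have g₁ : (x₁ * y₂ - Q⁻¹ • (y₂ * x₁)) - (x₀ * y₃ - Q⁻¹ • (y₃ * x₀)) = ψ₂ * ψ - ψ * ψ₂ := by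
    rw [← hx₀, ← hy₂]
    linear_combination (norm := skip) hψ₂' * ψ - ψ * hψ₂'
    simp only [mul_add, add_mul, mul_sub, sub_mul, smul_mul_assoc, mul_smul_comm, smul_sub, mul_assoc]
    module
  -- Here `ψ` is expanded as the `q`-bracket of `x₀` and `y₁`, whose brackets with `ψ₂` are `rx` and
  -- `ry`. In `g₁` and `g₂` it is `ψ₂` that is expanded.
  have key : ψ * ψ₂ - ψ₂ * ψ = (Q - Q⁻¹) • (x₁ * y₂ - Q⁻¹ • (y₂ * x₁))
      + Q⁻¹ • (x₂ * y₁ - Q⁻¹ • (y₁ * x₂)) - Q • (x₀ * y₃ - Q⁻¹ • (y₃ * x₀)) := by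
    have e : (x₀ * y₁ - Q⁻¹ • (y₁ * x₀)) * ψ₂ - ψ₂ * (x₀ * y₁ - Q⁻¹ • (y₁ * x₀)) =
        (Q - Q⁻¹) • (x₁ * y₂ - Q⁻¹ • (y₂ * x₁))
      + Q⁻¹ • (x₂ * y₁ - Q⁻¹ • (y₁ * x₂)) - Q • (x₀ * y₃ - Q⁻¹ • (y₃ * x₀)) := by
      linear_combination (norm := skip) rx * y₁ - x₀ * ry - Q⁻¹ • (y₁ * rx) + Q⁻¹ • (ry * x₀)
        + (Q - Q⁻¹) • (hψ₂ * ψ) - (Q - Q⁻¹) • (hψ₂' * ψ)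
      simp only [mul_add, add_mul, mul_sub, sub_mul, smul_mul_assoc, mul_smul_comm, smul_sub,
        mul_assoc, rule hx₀, rule hx₁, rule' hy₁, rule' hy₂]
      match_scalars <;> field_simp <;> ring
    rwa [hψ] at e
  -- By `g₁` and `g₂` the right side of `key` is `-(Q + Q⁻¹)` times the same commutator, so the
  -- commutator is killed by `1 + Q + Q⁻¹`.
  have comm : ψ * ψ₂ = ψ₂ * ψ := by
    have : (1 + Q + Q⁻¹) • (ψ * ψ₂ - ψ₂ * ψ) = 0 := by
      linear_combination (norm := module) key + Q⁻¹ • g₂ + Q • g₁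
    rwa [smul_eq_zero_iff_right h3, sub_eq_zero] at this
  have rx' : x₁ * ψ₂ - ψ₂ * x₁ = Q • (x₂ * ψ) - Q⁻¹ • (ψ * x₂) := by
    have e : (x₀ * ψ - ψ * x₀) * ψ₂ - ψ₂ * (x₀ * ψ - ψ * x₀) =
        Q • (x₂ * ψ) - Q⁻¹ • (ψ * x₂) := by
      rw [← hx₁]
      linear_combination (norm := skip) rx * ψ - ψ * rx + x₀ * comm - comm * x₀
      simp only [mul_add, add_mul, mul_sub, sub_mul, smul_mul_assoc, mul_smul_comm, smul_sub,
        mul_assoc]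
      module
    rwa [hx₀] at e
  -- `b₁` and `b₂` are the first and second brackets of `hx` with `ψ`; `b₂` brings in the unwanted
  -- `x₃`, which the bracket of `hx` with `ψ₂` then eliminates.
  have b₁ : (x₁ * x₁ - Q • (x₁ * x₁)) + (x₀ * x₂ - Q • (x₂ * x₀)) = 0 := by
    linear_combination (norm := skip) hx * ψ - ψ * hx
    simp only [mul_add, add_mul, mul_sub, sub_mul, smul_mul_assoc, mul_smul_comm, smul_sub,
      mul_assoc, rule hx₀, rule hx₁]
    module
  have b₂ : (x₂ * x₁ - Q • (x₁ * x₂)) + (2 : K) • (x₁ * x₂ - Q • (x₂ * x₁))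
      + (x₀ * x₃ - Q • (x₃ * x₀)) = 0 := by
    linear_combination (norm := skip) b₁ * ψ - ψ * b₁
    simp only [mul_add, add_mul, mul_sub, sub_mul, smul_mul_assoc, mul_smul_comm, smul_sub, smul_add,
        mul_assoc, rule hx₀, rule hx₁, rule hx₂, mul_zero, zero_mul]
    module
  have b₃ : (Q + Q⁻¹) • (x₁ * x₂ - Q • (x₂ * x₁)) = 0 := by
    have rule₂ : ∀ {u v : A}, u * ψ₂ - ψ₂ * u = v → ψ₂ * u = u * ψ₂ - v ∧
        ∀ z, ψ₂ * (u * z) = u * (ψ₂ * z) - v * z := by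
      rintro u v rfl
      exact ⟨by abel, fun z ↦ by simp only [sub_mul, mul_assoc]; abel⟩
    linear_combination (norm := skip) ψ₂ * hx - hx * ψ₂ + (Q - Q⁻¹) • (b₁ * ψ) + Q⁻¹ • b₂
    simp only [mul_add, add_mul, mul_sub, sub_mul, smul_mul_assoc, mul_smul_comm, smul_sub, smul_add,
        mul_assoc, rule hx₀, rule hx₁, rule hx₂, rule₂ rx, rule₂ rx', mul_zero, zero_mul]
    match_scalars <;> field_simp <;> ring
  rwa [smul_eq_zero_iff_right h2, sub_eq_zero] at b₃
end Serre
end AffineCW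

namespace AffineCW
-- Loop relations: quadratic relations and imaginary vectors
section Loop
variable {K : Type*} [Field K] {A : Type*} [Ring A] [Algebra K A]

/-- The bracket `[X_r, Y_s]_q`. -/
def mixed (Q : K) (X Y : ℤ → A) (r s : ℤ) : A := X r * Y s - Q⁻¹ • (Y s * X r)

/-- Drinfeld-type relations of the currents `X`, `Y` with the first imaginary vector `ψ`. -/
structure Loop (Q a : K) (X Y : ℤ → A) (ψ : A) : Prop where
  x_psi : ∀ n, X n * ψ - ψ * X n = a • X (n + 1)
  psi_y : ∀ n, ψ * Y n - Y n * ψ = a • Y (n + 1)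
  xx : ∀ n, X n * X (n + 1) = Q • (X (n + 1) * X n)
  yy : ∀ n, Y (n + 1) * Y n = Q • (Y n * Y (n + 1))
  comm_zero : ∀ n, mixed Q X Y n (-n) * ψ = ψ * mixed Q X Y n (-n)
  psi_eq : mixed Q X Y 0 1 = ψ

/-- The imaginary vectors, with the normalisation of index `0` that makes the recursions uniform. -/
def imagVec (Q a : K) (X Y : ℤ → A) (m : ℤ) : A :=
  if m = 0 then (a / (Q - Q⁻¹)) • 1 else mixed Q X Y 0 m

namespace Loop
variable {Q a : K} {X Y : ℤ → A} {ψ : A}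

/-- Bracketing with `ψ` is a derivation that raises the index of `X` and, with the opposite sign,
that of `Y`. So the commutator of `[X_r, Y_s]_q` with `ψ` is `a` times the difference of the two
sides. -/
theorem mixed_succ (h : Loop Q a X Y ψ) (ha : a ≠ 0) {r s : ℤ}
    (hc : mixed Q X Y r s * ψ = ψ * mixed Q X Y r s) :
    mixed Q X Y (r + 1) s = mixed Q X Y r (s + 1) := by
  have : a • (mixed Q X Y (r + 1) s - mixed Q X Y r (s + 1)) = 0 := by
    unfold mixed at *
    linear_combination (norm := skip) hc - h.x_psi r * Y s + X r * h.psi_y s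
      + Q⁻¹ • (Y s * h.x_psi r) - Q⁻¹ • (h.psi_y s * X r)
    simp only [mul_add, add_mul, mul_sub, sub_mul, smul_mul_assoc, mul_smul_comm, smul_sub,
      mul_assoc]
    module
  rwa [smul_eq_zero_iff_right ha, sub_eq_zero] at this

theorem mixed_const {P : A} {N : ℤ} (h : ∀ r, mixed Q X Y (r + 1) (N - (r + 1)) = mixed Q X Y r (N - r))
    (h0 : mixed Q X Y 0 N = P) (r : ℤ) : mixed Q X Y r (N - r) = P := by
  induction r using Int.induction_on with
  | zero => simpa using h0
  | succ i ih => rw [h, ih]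
  | pred i ih => rw [← ih, ← h]; simp

theorem level_one (h : Loop Q a X Y ψ) (ha : a ≠ 0) (r : ℤ) : mixed Q X Y r (1 - r) = ψ := by
  refine mixed_const (fun r ↦ ?_) h.psi_eq r
  rw [show (1 : ℤ) - (r + 1) = -r by ring, h.mixed_succ ha (h.comm_zero r)]
  congr 1; ring

/-- The opposite of a `Loop` datum. -/
theorem op (h : Loop Q a X Y ψ) (ha : a ≠ 0) :
    Loop Q a (fun n ↦ MulOpposite.op (Y n)) (fun n ↦ MulOpposite.op (X n)) (MulOpposite.op ψ) := by
  have hm : ∀ r s, mixed Q (fun n ↦ MulOpposite.op (Y n)) (fun n ↦ MulOpposite.op (X n)) r s =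
      MulOpposite.op (mixed Q X Y s r) := fun r s ↦ by simp [mixed]
  constructor
  · intro n
    apply MulOpposite.unop_injective
    simpa using h.psi_y n
  · intro n
    apply MulOpposite.unop_injective
    simpa using h.x_psi n
  · intro n
    apply MulOpposite.unop_injective
    simpa using h.yy n
  · intro n
    apply MulOpposite.unop_injective
    simpa using h.xx n
  · intro n
    rw [hm]
    apply MulOpposite.unop_injective
    simpa using (h.comm_zero (-n)).symm
  · rw [hm]
    simpa using h.level_one ha 1

section Quadratic
variable [CharZero K]

/-- The expression is symmetric in `n` and `m = n + d`. Bracketing it with `ψ` gives the sum of the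
expressions for `(n + 1, m)` and `(n, m + 1)`, whose gaps are `d - 1` and `d + 1`. Hence the
induction goes back two steps. -/
theorem quad_aux (h : Loop Q a X Y ψ) (ha : a ≠ 0) (d : ℕ) : ∀ n : ℤ,
    (X n * X (n + d + 1) - Q • (X (n + d + 1) * X n)) +
      (X (n + d) * X (n + 1) - Q • (X (n + 1) * X (n + d))) = 0 := by
  have step : ∀ n m : ℤ, (X n * X (m + 1) - Q • (X (m + 1) * X n)) +
      (X m * X (n + 1) - Q • (X (n + 1) * X m)) = 0 →
      ((X (n + 1) * X (m + 1) - Q • (X (m + 1) * X (n + 1))) +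
        (X m * X (n + 1 + 1) - Q • (X (n + 1 + 1) * X m))) +
      ((X n * X (m + 1 + 1) - Q • (X (m + 1 + 1) * X n)) +
        (X (m + 1) * X (n + 1) - Q • (X (n + 1) * X (m + 1)))) = 0 := by
    intro n m hnm
    rw [← smul_eq_zero_iff_right ha]
    have rule : ∀ n, ψ * X n = X n * ψ - a • X (n + 1) := fun n ↦ by rw [← h.x_psi]; abel
    have rule' : ∀ n z, ψ * (X n * z) = X n * (ψ * z) - a • (X (n + 1) * z) := fun n z ↦ by
      rw [← mul_assoc, rule]; simp only [sub_mul, smul_mul_assoc, mul_assoc]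
    linear_combination (norm := skip) hnm * ψ - ψ * hnm
    simp only [mul_add, add_mul, mul_sub, sub_mul, smul_mul_assoc, mul_smul_comm, smul_sub,
      smul_add, mul_assoc, rule, rule', zero_mul, mul_zero]
    module
  induction d using Nat.strong_induction_on with
  | _ d ih =>
    intro n
    match d with
    | 0 => simp [h.xx n]
    | 1 =>
      have h0 : ∀ n, X n * X (n + 1) - Q • (X (n + 1) * X n) = 0 := fun n ↦ sub_eq_zero.2 (h.xx n)
      have := step n n (by simp [h0])
      -- Starting from gap `0` the two new expressions coincide by symmetry, which costs a division
      -- by `2`.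
      have h2 : (2 : K) • ((X n * X (n + 1 + 1) - Q • (X (n + 1 + 1) * X n)) +
        (X (n + 1) * X (n + 1) - Q • (X (n + 1) * X (n + 1)))) = 0 := by
        linear_combination (norm := module) this
      rw [smul_eq_zero_iff_right two_ne_zero] at h2
      simpa using h2
    | d + 2 =>
      have h1 := step n (n + d + 1) (by simpa [add_assoc] using ih (d + 1) (by omega) n)
      have h2 := ih d (by omega) (n + 1)
      rw [show n + 1 + (d : ℤ) = n + d + 1 by ring] at h2
      push_cast
      rw [show n + ((d : ℤ) + 2) = n + d + 1 + 1 by ring]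
      linear_combination (norm := module) h1 - h2

theorem quad (h : Loop Q a X Y ψ) (ha : a ≠ 0) {n m : ℤ} (hnm : n ≤ m) :
    X n * X (m + 1) - Q • (X (m + 1) * X n) = Q • (X (n + 1) * X m) - X m * X (n + 1) := by
  obtain ⟨d, rfl⟩ := Int.le.dest hnm
  linear_combination (norm := module) h.quad_aux ha d n

end Quadratic

/-- The recursion for the brackets of the currents with the imaginary vectors. -/
theorem x_imag (h : Loop Q a X Y ψ) (hQ : Q ≠ 0) (hk : Q - Q⁻¹ ≠ 0) {m : ℤ} (hm : 0 ≤ m)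
    (h0 : 0 < m → ∀ r, mixed Q X Y r (m - r) = imagVec Q a X Y m)
    (h1 : ∀ r, mixed Q X Y r (m + 1 - r) = imagVec Q a X Y (m + 1)) (n : ℤ) :
    X n * imagVec Q a X Y (m + 1) - Q • (X (n + 1) * imagVec Q a X Y m) =
      imagVec Q a X Y (m + 1) * X n - Q⁻¹ • (imagVec Q a X Y m * X (n + 1)) := by
  rcases hm.eq_or_lt with rfl | hm
  · have e : imagVec Q a X Y (0 + 1) = ψ := by simp [imagVec, h.psi_eq]
    have e' : imagVec Q a X Y 0 = (a / (Q - Q⁻¹)) • 1 := by simp [imagVec]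
    rw [e, e']
    simp only [mul_smul_comm, smul_mul_assoc, mul_one, one_mul]
    linear_combination (norm := skip) h.x_psi n
    -- The value of `imagVec` at `0` is chosen so that the bracket with `ψ` becomes the case `m = 0`
    -- of the recursion.
    have : a = (Q - Q⁻¹) * (a / (Q - Q⁻¹)) := by
      rw [← mul_div_assoc, mul_div_cancel_left₀ _ hk]
    generalize a / (Q - Q⁻¹) = b at *
    subst this
    module
  -- The brackets of levels `m` and `m + 1` are represented with the same factor `Y (m - n)`, so
  -- that `xx` for `X n`, `X (n + 1)` links them.
  · have e0 := h0 hm n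
    have e1 := h1 (n + 1)
    rw [show m + 1 - (n + 1) = m - n by ring] at e1
    unfold mixed at e0 e1
    linear_combination (norm := skip) h.xx n * Y (m - n) - X n * e1 + Q • (X (n + 1) * e0)
      + e1 * X n - Q⁻¹ • (e0 * X (n + 1)) - (Q⁻¹ * Q⁻¹) • (Y (m - n) * h.xx n)
    simp only [mul_add, add_mul, mul_sub, sub_mul, smul_mul_assoc, mul_smul_comm, smul_sub,
      mul_assoc]
    match_scalars <;> field_simp <;> ring

theorem imag_y (h : Loop Q a X Y ψ) (hQ : Q ≠ 0) (hk : Q - Q⁻¹ ≠ 0) {m : ℤ} (hm : 0 ≤ m)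
    (h0 : 0 < m → ∀ r, mixed Q X Y r (m - r) = imagVec Q a X Y m)
    (h1 : ∀ r, mixed Q X Y r (m + 1 - r) = imagVec Q a X Y (m + 1)) (n : ℤ) :
    imagVec Q a X Y (m + 1) * Y n - Q • (imagVec Q a X Y m * Y (n + 1)) =
      Y n * imagVec Q a X Y (m + 1) - Q⁻¹ • (Y (n + 1) * imagVec Q a X Y m) := by
  rcases hm.eq_or_lt with rfl | hm
  · have e : imagVec Q a X Y (0 + 1) = ψ := by simp [imagVec, h.psi_eq]
    have e' : imagVec Q a X Y 0 = (a / (Q - Q⁻¹)) • 1 := by simp [imagVec]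
    rw [e, e']
    simp only [mul_smul_comm, smul_mul_assoc, mul_one, one_mul]
    linear_combination (norm := skip) h.psi_y n
    have : a = (Q - Q⁻¹) * (a / (Q - Q⁻¹)) := by
      rw [← mul_div_assoc, mul_div_cancel_left₀ _ hk]
    generalize a / (Q - Q⁻¹) = b at *
    subst this
    module
  · have e0 := h0 hm (m - n)
    have e1 := h1 (m - n)
    rw [show m - (m - n) = n by ring] at e0
    rw [show m + 1 - (m - n) = n + 1 by ring] at e1
    unfold mixed at e0 e1
    linear_combination (norm := skip) X (m - n) * h.yy n - e1 * Y n + Q • (e0 * Y (n + 1))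
      + Y n * e1 - Q⁻¹ • (Y (n + 1) * e0) - (Q⁻¹ * Q⁻¹) • (h.yy n * X (m - n))
    simp only [mul_add, add_mul, mul_sub, sub_mul, smul_mul_assoc, mul_smul_comm, smul_sub,
      mul_assoc]
    match_scalars <;> field_simp <;> ring


/-- An imaginary vector is carried across `X_r Y_s`, and across `Y_s X_r`, with `x_imag` and
`imag_y`. The recursions at `m` and `m - 1` are combined so that all terms with the imaginary vector
between the two currents cancel. -/
theorem three_term (h : Loop Q a X Y ψ) (hQ : Q ≠ 0) (hk : Q - Q⁻¹ ≠ 0) {m : ℤ} (hm : 2 ≤ m)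
    (H : ∀ k, 0 < k → k ≤ m → ∀ r, mixed Q X Y r (k - r) = imagVec Q a X Y k) (r s : ℤ) :
    let P := imagVec Q a X Y
    let G := mixed Q X Y
    G r s * P m - P m * G r s
      - Q • (G (r + 1) s * P (m - 1)) - Q⁻¹ • (G r (s + 1) * P (m - 1))
      + Q⁻¹ • (P (m - 1) * G (r + 1) s) + Q • (P (m - 1) * G r (s + 1))
      + G (r + 1) (s + 1) * P (m - 2) - P (m - 2) * G (r + 1) (s + 1) = 0 := by
  intro P G
  have hx : ∀ j, 1 ≤ j → j ≤ m → ∀ n, X n * P j - Q • (X (n + 1) * P (j - 1)) =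
      P j * X n - Q⁻¹ • (P (j - 1) * X (n + 1)) := fun j hj hjm n ↦ by
    have := h.x_imag hQ hk (m := j - 1) (by omega) (fun hj ↦ H _ hj (by omega))
      (by simpa using H j (by omega) hjm) n
    simpa using this
  have hy : ∀ j, 1 ≤ j → j ≤ m → ∀ n, P j * Y n - Q • (P (j - 1) * Y (n + 1)) =
      Y n * P j - Q⁻¹ • (Y (n + 1) * P (j - 1)) := fun j hj hjm n ↦ by
    have := h.imag_y hQ hk (m := j - 1) (by omega) (fun hj ↦ H _ hj (by omega))
      (by simpa using H j (by omega) hjm) n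
    simpa using this
  have x₁ := hx m (by omega) le_rfl r
  have x₂ := hx (m - 1) (by omega) (by omega) r
  have y₁ := hy m (by omega) le_rfl s
  have y₂ := hy (m - 1) (by omega) (by omega) s
  rw [show m - 1 - 1 = m - 2 by ring] at x₂ y₂
  have e₁ : X r * Y s * P m - Q • (X (r + 1) * Y s * P (m - 1))
      - Q⁻¹ • (X r * Y (s + 1) * P (m - 1)) + X (r + 1) * Y (s + 1) * P (m - 2) =
      P m * X r * Y s - Q⁻¹ • (P (m - 1) * X (r + 1) * Y s)
      - Q • (P (m - 1) * X r * Y (s + 1)) + P (m - 2) * X (r + 1) * Y (s + 1) := by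
    linear_combination (norm := skip) x₁ * Y s - X r * y₁ + Q • (X (r + 1) * y₂) - Q • (x₂ * Y (s + 1))
    simp only [mul_add, add_mul, mul_sub, sub_mul, smul_mul_assoc, mul_smul_comm, smul_sub,
      mul_assoc]
    match_scalars <;> field_simp <;> ring
  have e₂ : Y s * X r * P m - Q • (Y s * X (r + 1) * P (m - 1))
      - Q⁻¹ • (Y (s + 1) * X r * P (m - 1)) + Y (s + 1) * X (r + 1) * P (m - 2) =
      P m * Y s * X r - Q⁻¹ • (P (m - 1) * Y s * X (r + 1))
      - Q • (P (m - 1) * Y (s + 1) * X r) + P (m - 2) * Y (s + 1) * X (r + 1) := by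
    linear_combination (norm := skip) Y s * x₁ - Q⁻¹ • (Y (s + 1) * x₂)
      - y₁ * X r + Q⁻¹ • (y₂ * X (r + 1))
    simp only [mul_add, add_mul, mul_sub, sub_mul, smul_mul_assoc, mul_smul_comm, smul_sub,
      mul_assoc]
    match_scalars <;> field_simp <;> ring
  unfold G mixed
  linear_combination (norm := skip) e₁ - Q⁻¹ • e₂
  simp only [mul_add, add_mul, mul_sub, sub_mul, smul_mul_assoc, mul_smul_comm, smul_sub,
    mul_assoc]
  match_scalars <;> field_simp <;> ring

/-- The two claims need each other. Constancy on levels below `N` gives `three_term`, hence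
commutativity in total degree `N`. In particular the vector of degree `N - 1` commutes with `ψ`, and
then `mixed_succ` gives constancy on level `N`. -/
theorem level_and_comm (h : Loop Q a X Y ψ) (ha : a ≠ 0) (hQ : Q ≠ 0)
    (hr : ∀ n : ℕ, 0 < n → Q ^ n ≠ 1) (N : ℕ) : 0 < N →
    (∀ r, mixed Q X Y r (N - r) = imagVec Q a X Y N) ∧
    ∀ i j : ℤ, 0 < i → 0 < j → i + j = N →
      imagVec Q a X Y i * imagVec Q a X Y j = imagVec Q a X Y j * imagVec Q a X Y i := by
  have hk : Q - Q⁻¹ ≠ 0 := fun hk ↦ hr 2 two_pos (by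
    rw [sub_eq_zero] at hk
    rw [sq]; nth_rw 1 [hk]; exact inv_mul_cancel₀ hQ)
  have hP1 : imagVec Q a X Y 1 = ψ := by simp [imagVec, h.psi_eq]
  induction N using Nat.strong_induction_on with
  | _ N ih =>
    intro hN
    obtain rfl | hN2 := (Nat.succ_le_of_lt hN).eq_or_lt
    · refine ⟨fun r ↦ ?_, fun i j hi hj hij ↦ by push_cast at hij; omega⟩
      simpa [hP1] using h.level_one ha r
    have H : ∀ k : ℤ, 0 < k → k ≤ N - 1 → ∀ r, mixed Q X Y r (k - r) = imagVec Q a X Y k := by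
      intro k hk hkN
      lift k to ℕ using hk.le
      exact (ih k (by omega) (by omega)).1
    set P := imagVec Q a X Y with hP
    have hP0 : ∀ z, P 0 * z = z * P 0 := fun z ↦ by simp [hP, imagVec]
    obtain ⟨c, hc⟩ : ∃ c, P (N - 1) * P 1 - P 1 * P (N - 1) = c := ⟨_, rfl⟩
    -- By `three_term`, the commutators `[P (N - j), P j]` satisfy a linear recursion in `j` with
    -- characteristic roots `Q` and `Q⁻¹`. They vanish at `j = 0` and equal `c` at `j = 1`.
    have key : ∀ j : ℕ, j ≤ N - 1 → (Q - Q⁻¹) • (P (N - j) * P j - P j * P (N - j)) =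
        (Q ^ j - Q⁻¹ ^ j) • c := by
      intro j
      induction j using Nat.strong_induction_on with
      | _ j ihj =>
        intro hj
        match j with
        | 0 => simp [hP0]
        | 1 => simp [hc]
        | j + 2 =>
          have h0 := ihj j (by omega) (by omega)
          have h1 := ihj (j + 1) (by omega) (by omega)
          have t := h.three_term hQ hk (m := j + 2) (by omega)
            (fun k hk hkm ↦ H k hk (by omega)) 0 (N - (j + 2))
          simp only [← hP] at t
          have g0 : mixed Q X Y 0 (N - (j + 2)) = P (N - (j + 2)) := by
            simpa using H (N - (j + 2)) (by omega) (by omega) 0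
          have g1 : mixed Q X Y (0 + 1) (N - (j + 2)) = P (N - (j + 1)) := by
            rw [← H (N - (j + 1)) (by omega) (by omega) 1]; congr 1; ring
          have g2 : mixed Q X Y 0 (N - (j + 2) + 1) = P (N - (j + 1)) := by
            rw [← H (N - (j + 1)) (by omega) (by omega) 0]; congr 1; ring
          have g3 : mixed Q X Y (0 + 1) (N - (j + 2) + 1) * P j
              - P j * mixed Q X Y (0 + 1) (N - (j + 2) + 1) = P (N - j) * P j - P j * P (N - j) := by
            -- For `j = 0` the bracket on the left has level `N`, not yet known to be constant, but
            -- `P 0` is a scalar and commutes with it.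
            rcases Nat.eq_zero_or_pos j with rfl | hj0
            · simp [hP0]
            · rw [← H (N - j) (by omega) (by omega) 1]
              rw [show (N : ℤ) - (j + 2) + 1 = N - j - 1 by ring, zero_add]
          rw [show ((j : ℤ) + 2) - 1 = j + 1 by ring, show ((j : ℤ) + 2) - 2 = j by ring,
            g0, g1, g2] at t
          push_cast at h1 ⊢
          linear_combination (norm := skip) (Q - Q⁻¹) • t - (Q - Q⁻¹) • g3 + (Q + Q⁻¹) • h1 - h0
          simp only [inv_pow]
          match_scalars <;> field_simp <;> ring
    have hc0 : c = 0 := by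
      obtain ⟨M, rfl⟩ : ∃ M, N = M + 2 := ⟨N - 2, by omega⟩
      have := key (M + 1) (by omega)
      have e : (((M + 2 : ℕ) : ℤ)) - ((M + 1 : ℕ) : ℤ) = 1 := by push_cast; ring
      have e' : (((M + 2 : ℕ) : ℤ)) - 1 = ((M + 1 : ℕ) : ℤ) := by push_cast; ring
      rw [e'] at hc
      rw [e] at this
      -- At `j = N - 1` the commutator is `-c` by antisymmetry. Comparison with `key` leaves a
      -- coefficient that, up to a power of `Q`, factors as `(Q ^ M + 1) * (Q ^ (M + 2) - 1)`, with
      -- `M = N - 2`.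
      have z : (Q ^ (M + 1) - Q⁻¹ ^ (M + 1) + (Q - Q⁻¹)) • c = 0 := by
        linear_combination (norm := module) -this - (Q - Q⁻¹) • hc
      rcases Nat.eq_zero_or_pos M with rfl | hM
      · rw [← hc]; simp
      refine (smul_eq_zero_iff_right ?_).1 z
      intro h0
      have : (Q ^ M + 1) * (Q ^ (M + 2) - 1) = 0 := by
        have : (Q ^ M + 1) * (Q ^ (M + 2) - 1) =
          (Q ^ (M + 1) - Q⁻¹ ^ (M + 1) + (Q - Q⁻¹)) * Q ^ (M + 1) := by
          simp only [inv_pow]; field_simp; ring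
        rw [this, h0, zero_mul]
      rcases mul_eq_zero.1 this with h1 | h1
      · refine hr (2 * M) (by omega) ?_
        rw [pow_mul', eq_neg_of_add_eq_zero_left h1]; simp
      · exact hr (M + 2) (by omega) (sub_eq_zero.1 h1)
    constructor
    · refine mixed_const (fun r ↦ ?_) (by simp [hP, imagVec, hN.ne'])
      have e := H (N - 1) (by omega) le_rfl r
      rw [show (N : ℤ) - (r + 1) = N - 1 - r by ring, h.mixed_succ ha]
      · congr 1; ring
      · rw [e, ← hP1, ← sub_eq_zero, hc, hc0]
    · intro i j hi hj hij
      lift j to ℕ using hj.le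
      have := key j (by omega)
      rw [hc0, smul_zero, smul_eq_zero_iff_right hk, sub_eq_zero,
        show (N : ℤ) - j = i by omega] at this
      exact this
end Loop
end Loop
end AffineCW

namespace AffineCW
-- Closed formulas by unrolling the recursions
section LoopSums
open Finset

theorem sum_Icc_one_succ {B : Type*} [AddCommMonoid B] (f : ℤ → B) {m : ℤ} (hm : 1 ≤ m) :
    ∑ l ∈ Icc 1 m, f l = f 1 + ∑ l ∈ Icc 1 (m - 1), f (l + 1) := by
  have h : ∑ l ∈ Icc 1 (m - 1), f (l + 1) = ∑ l ∈ Icc 2 m, f l :=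
    sum_bij (fun l _ ↦ l + 1) (by intro l hl; simp at *; omega) (by simp)
      (fun l hl ↦ ⟨l - 1, by simp at *; omega, by simp⟩) (by simp)
  rw [h, show Icc 1 m = insert 1 (Icc 2 m) by ext; simp; omega, sum_insert (by simp)]

theorem sum_Icc_split {B : Type*} [AddCommMonoid B] (f : ℤ → B) {a n m : ℤ} (h1 : a ≤ n)
    (h2 : n ≤ m + 1) :
    ∑ l ∈ Icc a m, f l = ∑ l ∈ Icc a (n - 1), f l + ∑ l ∈ Icc n m, f l := by
  rw [← sum_union]
  · congr 1; ext; simp; omega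
  · rw [disjoint_left]; intro l; simp; omega

variable {K : Type*} [Field K] {A : Type*} [Ring A] [Algebra K A]

namespace Loop
variable {Q a : K} {X Y : ℤ → A} {ψ : A}

section Quadratic
variable [CharZero K]

/-- This form of `quad` can be iterated: the last term is again a `q`-commutator, with both indices
moved inwards. An odd gap ends at neighbours, which `Q`-commute; an even gap ends at a square. -/
theorem quad' (h : Loop Q a X Y ψ) (ha : a ≠ 0) (hQ : Q ≠ 0) {n m : ℤ} (hnm : n < m) :
    X n * X m - Q • (X m * X n) = (Q - Q⁻¹) • (X (n + 1) * X (m - 1)) +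
      Q⁻¹ • (X (n + 1) * X (m - 1) - Q • (X (m - 1) * X (n + 1))) := by
  have := h.quad ha (n := n) (m := m - 1) (by omega)
  rw [sub_add_cancel] at this
  rw [this]
  match_scalars <;> field_simp <;> ring

theorem xx_odd (h : Loop Q a X Y ψ) (ha : a ≠ 0) (hQ : Q ≠ 0) {m : ℤ} (hm : 1 ≤ m) : ∀ n : ℤ,
    X n * X (n + 2 * m - 1) - Q • (X (n + 2 * m - 1) * X n) =
      (Q ^ 2 - 1) • ∑ l ∈ Icc 1 (m - 1), Q ^ (-l) • (X (n + l) * X (n + 2 * m - 1 - l)) := by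
  induction m, hm using Int.leInduction with
  | base =>
    intro n
    rw [show n + 2 * 1 - 1 = n + 1 by ring, h.xx]
    simp
  | succ m hm ih =>
    intro n
    rw [h.quad' ha hQ (by omega), add_sub_cancel_right, sum_Icc_one_succ _ hm,
      show n + 2 * (m + 1) - 1 - 1 = n + 1 + 2 * m - 1 by ring, ih (n + 1), smul_add, smul_smul,
      mul_comm Q⁻¹, ← smul_smul, smul_sum (r := Q⁻¹)]
    congr 1
    · rw [smul_smul]; congr 1
      simp only [zpow_neg, zpow_one]; field_simp
    · congr 1
      refine sum_congr rfl fun l _ ↦ ?_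
      rw [smul_smul, neg_add, zpow_add₀ hQ, zpow_neg_one, mul_comm Q⁻¹,
        show n + 1 + l = n + (l + 1) by ring,
        show n + 1 + 2 * m - 1 - l = n + 2 * (m + 1) - 1 - (l + 1) by ring]

theorem xx_even (h : Loop Q a X Y ψ) (ha : a ≠ 0) (hQ : Q ≠ 0) {m : ℤ} (hm : 1 ≤ m) : ∀ n : ℤ,
    X n * X (n + 2 * m) - Q • (X (n + 2 * m) * X n) =
      ((Q - 1) * Q ^ (-m + 1)) • X (n + m) ^ 2 +
      (Q ^ 2 - 1) • ∑ l ∈ Icc 1 (m - 1), Q ^ (-l) • (X (n + l) * X (n + 2 * m - l)) := by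
  induction m, hm using Int.leInduction with
  | base =>
    intro n
    have := h.quad ha (n := n) (m := n + 1) (by omega)
    rw [show n + 2 * 1 = n + 1 + 1 by ring, this]
    simp [sq, sub_smul]
  | succ m hm ih =>
    intro n
    rw [h.quad' ha hQ (by omega), add_sub_cancel_right, sum_Icc_one_succ _ hm,
      show n + 2 * (m + 1) - 1 = n + 1 + 2 * m by ring, ih (n + 1), smul_add, smul_add, smul_smul,
      smul_smul, mul_comm Q⁻¹ (Q ^ 2 - 1), ← smul_smul (Q ^ 2 - 1) Q⁻¹, smul_sum (r := Q⁻¹)]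
    rw [add_left_comm]
    congr 1
    · rw [show n + 1 + m = n + (m + 1) by ring]
      congr 1
      rw [show -(m + 1) + 1 = -m + 1 + -1 by ring, zpow_add₀ hQ (-m + 1), zpow_neg_one]; ring
    congr 1
    · rw [smul_smul]; congr 1
      simp only [zpow_neg, zpow_one]; field_simp
    · congr 1
      refine sum_congr rfl fun l _ ↦ ?_
      rw [smul_smul, neg_add, zpow_add₀ hQ, zpow_neg_one, mul_comm Q⁻¹,
        show n + 1 + l = n + (l + 1) by ring,
        show n + 1 + 2 * m - l = n + 2 * (m + 1) - (l + 1) by ring]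

theorem yy_odd (h : Loop Q a X Y ψ) (ha : a ≠ 0) (hQ : Q ≠ 0) {m : ℤ} (hm : 1 ≤ m) (n : ℤ) :
    Y (n + 2 * m - 1) * Y n - Q • (Y n * Y (n + 2 * m - 1)) =
      (Q ^ 2 - 1) • ∑ l ∈ Icc 1 (m - 1), Q ^ (-l) • (Y (n + 2 * m - 1 - l) * Y (n + l)) := by
  apply MulOpposite.op_injective
  simpa using (h.op ha).xx_odd ha hQ hm n

theorem yy_even (h : Loop Q a X Y ψ) (ha : a ≠ 0) (hQ : Q ≠ 0) {m : ℤ} (hm : 1 ≤ m) (n : ℤ) :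
    Y (n + 2 * m) * Y n - Q • (Y n * Y (n + 2 * m)) =
      ((Q - 1) * Q ^ (-m + 1)) • Y (n + m) ^ 2 +
      (Q ^ 2 - 1) • ∑ l ∈ Icc 1 (m - 1), Q ^ (-l) • (Y (n + 2 * m - l) * Y (n + l)) := by
  apply MulOpposite.op_injective
  simpa using (h.op ha).xx_even ha hQ hm n

end Quadratic

section Imaginary

theorem mixed_eq (h : Loop Q a X Y ψ) (ha : a ≠ 0) (hQ : Q ≠ 0)
    (hr : ∀ n : ℕ, 0 < n → Q ^ n ≠ 1) {r s : ℤ} (hrs : 0 < r + s) :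
    mixed Q X Y r s = imagVec Q a X Y (r + s) := by
  obtain ⟨N, hN⟩ := Int.eq_ofNat_of_zero_le hrs.le
  have := (h.level_and_comm ha hQ hr N (by omega)).1 r
  rw [hN, ← this]; congr 1; omega

theorem imag_comm (h : Loop Q a X Y ψ) (ha : a ≠ 0) (hQ : Q ≠ 0)
    (hr : ∀ n : ℕ, 0 < n → Q ^ n ≠ 1) {i j : ℤ} (hi : 0 < i) (hj : 0 < j) :
    imagVec Q a X Y i * imagVec Q a X Y j = imagVec Q a X Y j * imagVec Q a X Y i := by
  obtain ⟨N, hN⟩ := Int.eq_ofNat_of_zero_le (add_pos hi hj).le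
  exact (h.level_and_comm ha hQ hr N (by omega)).2 i j hi hj hN

theorem sub_inv_ne_zero (hQ : Q ≠ 0) (hr : ∀ n : ℕ, 0 < n → Q ^ n ≠ 1) : Q - Q⁻¹ ≠ 0 :=
  fun hk ↦ hr 2 two_pos (by
    rw [sub_eq_zero] at hk
    rw [sq]; nth_rw 1 [hk]; exact inv_mul_cancel₀ hQ)

/-- Each use of `x_imag` moves one unit of degree from the imaginary vector to the current, at the
price of a factor `Q⁻¹`, and leaves one term of the sum. The bracket with `ψ` at the end gives the
isolated term. -/
theorem x_imag_sum (h : Loop Q a X Y ψ) (ha : a ≠ 0) (hQ : Q ≠ 0)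
    (hr : ∀ n : ℕ, 0 < n → Q ^ n ≠ 1) {m : ℤ} (hm : 1 ≤ m) : ∀ n : ℤ,
    X n * imagVec Q a X Y m - imagVec Q a X Y m * X n = (Q ^ (-m + 1) * a) • X (n + m) +
      (Q ^ 2 - 1) • ∑ l ∈ Icc 1 (m - 1), Q ^ (-l) • (X (n + l) * imagVec Q a X Y (m - l)) := by
  induction m, hm using Int.leInduction with
  | base =>
    intro n
    have : imagVec Q a X Y 1 = ψ := by simp [imagVec, h.psi_eq]
    simp [this, h.x_psi]
  | succ m hm ih =>
    intro n
    have e := h.x_imag hQ (sub_inv_ne_zero hQ hr) (m := m) (by omega)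
      (fun _ r ↦ by rw [h.mixed_eq ha hQ hr (by omega)]; congr 1; ring)
      (fun r ↦ by rw [h.mixed_eq ha hQ hr (by omega)]; congr 1; ring) n
    have e' : X n * imagVec Q a X Y (m + 1) - imagVec Q a X Y (m + 1) * X n =
        (Q - Q⁻¹) • (X (n + 1) * imagVec Q a X Y m) + Q⁻¹ • (X (n + 1) * imagVec Q a X Y m -
          imagVec Q a X Y m * X (n + 1)) := by
      linear_combination (norm := module) e
    rw [e', ih (n + 1), add_sub_cancel_right, sum_Icc_one_succ _ hm, smul_add, smul_add, smul_smul,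
      smul_smul, mul_comm Q⁻¹ (Q ^ 2 - 1), ← smul_smul (Q ^ 2 - 1) Q⁻¹, smul_sum (r := Q⁻¹)]
    rw [add_left_comm]
    congr 1
    · rw [show n + 1 + m = n + (m + 1) by ring]
      congr 1
      rw [show -(m + 1) + 1 = -m + 1 + -1 by ring, zpow_add₀ hQ (-m + 1), zpow_neg_one]; ring
    congr 1
    · rw [smul_smul, add_sub_cancel_right]; congr 1
      simp only [zpow_neg, zpow_one]; field_simp
    · congr 1
      refine sum_congr rfl fun l _ ↦ ?_
      rw [smul_smul, neg_add, zpow_add₀ hQ, zpow_neg_one, mul_comm Q⁻¹,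
        show n + 1 + l = n + (l + 1) by ring, show m - l = m + 1 - (l + 1) by ring]

theorem imag_y_sum (h : Loop Q a X Y ψ) (ha : a ≠ 0) (hQ : Q ≠ 0)
    (hr : ∀ n : ℕ, 0 < n → Q ^ n ≠ 1) {m : ℤ} (hm : 1 ≤ m) (n : ℤ) :
    imagVec Q a X Y m * Y n - Y n * imagVec Q a X Y m = (Q ^ (-m + 1) * a) • Y (n + m) +
      (Q ^ 2 - 1) • ∑ l ∈ Icc 1 (m - 1), Q ^ (-l) • (imagVec Q a X Y (m - l) * Y (n + l)) := by
  -- Passing to the opposite replaces the bracket of indices `(0, k)` by that of `(k, 0)`;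
  -- `mixed_eq` identifies them.
  have hv : ∀ k : ℤ, 0 < k → imagVec Q a (fun n ↦ MulOpposite.op (Y n))
      (fun n ↦ MulOpposite.op (X n)) k = MulOpposite.op (imagVec Q a X Y k) := by
    intro k hk
    have := h.mixed_eq ha hQ hr (r := k) (s := 0) (by omega)
    rw [add_zero] at this
    rw [← this]
    simp [imagVec, hk.ne', mixed]
  have e := (h.op ha).x_imag_sum ha hQ hr hm n
  rw [hv m (by omega)] at e
  apply MulOpposite.op_injective
  rw [sum_congr rfl fun l hl ↦ by rw [hv (m - l) (by simp at hl; omega)]] at e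
  simpa using e

end Imaginary
end Loop
end LoopSums
end AffineCW

namespace AffineCW
-- Relations inside a window of four consecutive currents
section Drin
variable {K : Type*} [Field K] {A : Type*} [Ring A] [Algebra K A]

/-- Relations between four consecutive currents `x' = X_{n-1}`, `x = X_n`, `y = Y_{-n}`,
`y' = Y_{1-n}`, the imaginary vectors `ψ`, `ω` and the Cartan elements `M = N⁻¹`, `C = D⁻¹`. -/
structure Drin (Q lam : K) (C D M N x' x y y' ψ ω : A) : Prop where
  CD : C * D = 1
  DC : D * C = 1
  MN : M * N = 1
  NM : N * M = 1
  CM : C * M = M * C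
  Cx : C * x = x * C
  Cx' : C * x' = x' * C
  Cy : C * y = y * C
  Cy' : C * y' = y' * C
  Mx : M * x = (Q * Q) • (x * M)
  Mx' : M * x' = (Q * Q) • (x' * M)
  My : y * M = (Q * Q) • (M * y)
  My' : y' * M = (Q * Q) • (M * y')
  xx : x' * x = Q • (x * x')
  yy : y' * y = Q • (y * y')
  c₀ : x * y - Q⁻¹ • (y * x) = lam • (M - 1)
  c₁ : x' * y' - Q⁻¹ • (y' * x') = lam • (M * D - 1)
  hψ : x * y' - Q⁻¹ • (y' * x) = ψ
  hω : x' * y - Q⁻¹ • (y * x') = M * ω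
  sx : x * (x * ψ - ψ * x) = Q • ((x * ψ - ψ * x) * x)
  sy : (ψ * y' - y' * ψ) * y' = Q • (y' * (ψ * y' - y' * ψ))
  nx : (x' * ω - ω * x') * x' = Q • (x' * (x' * ω - ω * x'))
  ny : y * (ω * y - y * ω) = Q • ((ω * y - y * ω) * y)

theorem mul_comm_of_inv {u v w : A} (huv : u * v = 1) (hvu : v * u = 1) (h : u * w = w * u) :
    v * w = w * v := by
  calc v * w = v * (w * u) * v := by rw [mul_assoc, mul_assoc, huv, mul_one]
    _ = w * v := by rw [← h, ← mul_assoc, hvu, one_mul]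

theorem qcomm_assoc {c : K} {u v : A} (h : u * v = c • (v * u)) (z : A) :
    u * (v * z) = c • (v * (u * z)) := by
  rw [← mul_assoc, h, smul_mul_assoc, mul_assoc]

theorem comm_assoc {u v : A} (h : u * v = v * u) (z : A) :
    u * (v * z) = v * (u * z) := by
  rw [← mul_assoc, h, mul_assoc]

theorem qcomm_swap {c : K} (hc : c ≠ 0) {u v : A} (h : u * v = c • (v * u)) :
    v * u = c⁻¹ • (u * v) := by
  rw [h, smul_smul, inv_mul_cancel₀ hc, one_smul]

namespace Drin
variable {Q lam : K} {C D M N x' x y y' ψ ω : A}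

theorem Dx (h : Drin Q lam C D M N x' x y y' ψ ω) : D * x = x * D :=
  mul_comm_of_inv h.CD h.DC h.Cx
theorem Dx' (h : Drin Q lam C D M N x' x y y' ψ ω) : D * x' = x' * D :=
  mul_comm_of_inv h.CD h.DC h.Cx'
theorem Dy (h : Drin Q lam C D M N x' x y y' ψ ω) : D * y = y * D :=
  mul_comm_of_inv h.CD h.DC h.Cy
theorem Dy' (h : Drin Q lam C D M N x' x y y' ψ ω) : D * y' = y' * D :=
  mul_comm_of_inv h.CD h.DC h.Cy'
theorem DM (h : Drin Q lam C D M N x' x y y' ψ ω) : D * M = M * D :=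
  mul_comm_of_inv h.CD h.DC h.CM
theorem xM (h : Drin Q lam C D M N x' x y y' ψ ω) (hQ : Q ≠ 0) : x * M = (Q * Q)⁻¹ • (M * x) :=
  qcomm_swap (mul_ne_zero hQ hQ) h.Mx
theorem xM' (h : Drin Q lam C D M N x' x y y' ψ ω) (hQ : Q ≠ 0) :
    x' * M = (Q * Q)⁻¹ • (M * x') :=
  qcomm_swap (mul_ne_zero hQ hQ) h.Mx'

theorem Mψ (h : Drin Q lam C D M N x' x y y' ψ ω) (hQ : Q ≠ 0) : ψ * M = M * ψ := by
  rw [← h.hψ]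
  simp only [sub_mul, mul_sub, smul_mul_assoc, mul_smul_comm, mul_assoc, h.xM hQ, h.My',
    qcomm_assoc (h.xM hQ), qcomm_assoc h.My']
  match_scalars <;> field_simp

theorem Mω (h : Drin Q lam C D M N x' x y y' ψ ω) (hQ : Q ≠ 0) : ω * M = M * ω := by
  have : (M * ω) * M = M * (M * ω) := by
    rw [← h.hω]
    simp only [sub_mul, mul_sub, smul_mul_assoc, mul_smul_comm, mul_assoc, h.xM' hQ, h.My,
      qcomm_assoc (h.xM' hQ), qcomm_assoc h.My]
    match_scalars <;> field_simp
  calc ω * M = N * (M * ω * M) := by simp only [← mul_assoc, h.NM, one_mul]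
    _ = M * ω := by rw [this]; simp only [← mul_assoc, h.NM, one_mul]

theorem Cψ (h : Drin Q lam C D M N x' x y y' ψ ω) : C * ψ = ψ * C := by
  rw [← h.hψ]
  simp only [sub_mul, mul_sub, smul_mul_assoc, mul_smul_comm, mul_assoc, h.Cx, h.Cy',
    comm_assoc h.Cx, comm_assoc h.Cy']

theorem ω_eq (h : Drin Q lam C D M N x' x y y' ψ ω) :
    ω = N * (x' * y - Q⁻¹ • (y * x')) := by rw [h.hω, ← mul_assoc, h.NM, one_mul]

theorem CN (h : Drin Q lam C D M N x' x y y' ψ ω) : C * N = N * C :=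
  (mul_comm_of_inv h.MN h.NM h.CM.symm).symm

theorem Cω (h : Drin Q lam C D M N x' x y y' ψ ω) : C * ω = ω * C := by
  rw [h.ω_eq]
  simp only [sub_mul, mul_sub, smul_mul_assoc, mul_smul_comm, mul_assoc, h.Cx', h.Cy, h.CN,
    comm_assoc h.Cx', comm_assoc h.Cy, comm_assoc h.CN]

theorem Dω (h : Drin Q lam C D M N x' x y y' ψ ω) : D * ω = ω * D :=
  mul_comm_of_inv h.CD h.DC h.Cω

/-- The bracket of `X_{n-1}` with `e_δ`; here `-lam (Q - Q⁻¹)` is the coefficient `a`. -/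
theorem x'_ψ (h : Drin Q lam C D M N x' x y y' ψ ω) (hQ : Q ≠ 0) :
    x' * ψ - ψ * x' = (-lam * (Q - Q⁻¹)) • x := by
  rw [← h.hψ]
  linear_combination (norm := skip) h.xx * y' + Q • (x * h.c₁) - Q⁻¹ • (h.c₁ * x)
    - (Q⁻¹ * Q⁻¹) • (y' * h.xx)
  simp only [sub_mul, mul_sub, smul_mul_assoc, mul_smul_comm, mul_assoc, smul_sub, mul_one, one_mul,
    h.Dx, qcomm_assoc h.Mx]
  match_scalars <;> field_simp <;> ring

theorem ψ_y (h : Drin Q lam C D M N x' x y y' ψ ω) (hQ : Q ≠ 0) :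
    ψ * y - y * ψ = (-lam * (Q - Q⁻¹)) • y' := by
  rw [← h.hψ]
  linear_combination (norm := skip) x * h.yy + Q • (h.c₀ * y') - Q⁻¹ • (y' * h.c₀)
    - (Q⁻¹ * Q⁻¹) • (h.yy * x)
  simp only [sub_mul, mul_sub, smul_mul_assoc, mul_smul_comm, mul_assoc, smul_sub, mul_one, one_mul,
    h.My']
  match_scalars <;> field_simp <;> ring

theorem mul_M_cancel (h : Drin Q lam C D M N x' x y y' ψ ω) {u v : A} (huv : M * u = M * v) :
    u = v := by
  rw [← one_mul u, ← h.NM, mul_assoc, huv, ← mul_assoc, h.NM, one_mul]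

theorem x_ω (h : Drin Q lam C D M N x' x y y' ψ ω) (hQ : Q ≠ 0) :
    x * ω - ω * x = (-lam * (Q - Q⁻¹)) • x' := by
  apply h.mul_M_cancel
  linear_combination (norm := skip) Q • (x' * h.c₀) - Q • (h.xx * y)
    - Q • (h.c₀ * x') - (Q * Q) • (x * h.hω) + h.hω * x + Q⁻¹ • (y * h.xx)
  simp only [sub_mul, mul_sub, smul_mul_assoc, mul_smul_comm, mul_assoc, smul_sub, mul_one, one_mul,
    qcomm_assoc h.Mx, h.Mx']
  match_scalars <;> field_simp <;> ring

theorem ω_y' (h : Drin Q lam C D M N x' x y y' ψ ω) (hQ : Q ≠ 0) :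
    ω * y' - y' * ω = (-lam * (Q - Q⁻¹)) • (D * y) := by
  apply h.mul_M_cancel
  linear_combination (norm := skip) Q⁻¹ • (h.c₁ * y) - Q⁻¹ • (x' * h.yy)
    - h.hω * y' - Q⁻¹ • (y * h.c₁) + (Q⁻¹ * Q⁻¹) • (y' * h.hω) + (Q⁻¹ * Q⁻¹ * Q⁻¹) • (h.yy * x')
  simp only [sub_mul, mul_sub, smul_mul_assoc, mul_smul_comm, mul_assoc, smul_sub, mul_one, one_mul,
    qcomm_assoc h.My', h.My, h.Dy, qcomm_assoc h.My]
  match_scalars <;> field_simp <;> ring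

/-- The Heisenberg relation. Expanding `ψ` as a bracket of `x` and `y'` and bracketing with `ω`
leaves `c₁` minus `D` times `c₀`, in which the terms with `M` cancel. -/
theorem ψ_ω (h : Drin Q lam C D M N x' x y y' ψ ω) (hQ : Q ≠ 0) :
    ψ * ω - ω * ψ = (-lam * (Q - Q⁻¹) * lam) • (D - 1) := by
  have e : (x * y' - Q⁻¹ • (y' * x)) * ω - ω * (x * y' - Q⁻¹ • (y' * x)) =
      (-lam * (Q - Q⁻¹) * lam) • (D - 1) := by
    linear_combination (norm := skip) h.x_ω hQ * y' - x * h.ω_y' hQ - Q⁻¹ • (y' * h.x_ω hQ)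
      + Q⁻¹ • (h.ω_y' hQ * x) + (-lam * (Q - Q⁻¹)) • h.c₁ - (-lam * (Q - Q⁻¹)) • (D * h.c₀)
    simp only [sub_mul, mul_sub, smul_mul_assoc, mul_smul_comm, mul_assoc, smul_sub, mul_one,
      one_mul, h.Dx, comm_assoc h.Dx, h.DM]
    match_scalars <;> field_simp <;> ring
  rwa [h.hψ] at e

/-- Jacobi identity for `x`, `ψ`, `ω`: by `ψ_ω` the commutator of `ψ` and `ω` commutes with `x`, so
only the path `x`, `x'`, `x` through `x_ω` and `x'_ψ` contributes. -/
theorem x₁_ω (h : Drin Q lam C D M N x' x y y' ψ ω) (hQ : Q ≠ 0) {x₁ : A}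
    (hx : x * ψ - ψ * x = (-lam * (Q - Q⁻¹)) • x₁) (ha : -lam * (Q - Q⁻¹) ≠ 0) :
    x₁ * ω - ω * x₁ = (-lam * (Q - Q⁻¹)) • x := by
  rw [← sub_eq_zero, ← smul_eq_zero_iff_right ha]
  linear_combination (norm := skip) ω * hx - hx * ω + x * h.ψ_ω hQ - h.ψ_ω hQ * x
    + h.x_ω hQ * ψ - ψ * h.x_ω hQ + (-lam * (Q - Q⁻¹)) • h.x'_ψ hQ
  simp only [sub_mul, mul_sub, smul_mul_assoc, mul_smul_comm, mul_assoc, smul_sub, mul_one,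
    one_mul, h.Dx]
  match_scalars <;> field_simp <;> ring

/-- The new bracket is obtained from `c₀` by bracketing with `ω`, which commutes with `M`. In the
same way `ψ_next` comes from `c₀` and `ψ`, and `c_next` from `ψ_next` and `ω`, with the Heisenberg
relation supplying the inhomogeneous term. -/
theorem Dφ (h : Drin Q lam C D M N x' x y y' ψ ω) (hQ : Q ≠ 0) {y₁ : A}
    (hy : ω * y - y * ω = (-lam * (Q - Q⁻¹)) • (D * y₁)) (ha : -lam * (Q - Q⁻¹) ≠ 0) :
    x * y₁ - Q⁻¹ • (y₁ * x) = C * (M * ω) := by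
  have e : D * (x * y₁ - Q⁻¹ • (y₁ * x)) = M * ω := by
    rw [← sub_eq_zero, ← smul_eq_zero_iff_right ha]
    linear_combination (norm := skip) lam • h.Mω hQ - h.c₀ * ω + ω * h.c₀ + h.x_ω hQ * y - x * hy
      - Q⁻¹ • (y * h.x_ω hQ) + Q⁻¹ • (hy * x) + (-lam * (Q - Q⁻¹)) • h.hω
    simp only [sub_mul, mul_sub, smul_mul_assoc, mul_smul_comm, mul_assoc, smul_sub, mul_one,
      one_mul, h.Dx, comm_assoc h.Dx]
    match_scalars <;> field_simp <;> ring
  rw [← e, ← mul_assoc, h.CD, one_mul]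

theorem ψ_next (h : Drin Q lam C D M N x' x y y' ψ ω) (hQ : Q ≠ 0) {x₁ : A}
    (hx : x * ψ - ψ * x = (-lam * (Q - Q⁻¹)) • x₁) (ha : -lam * (Q - Q⁻¹) ≠ 0) :
    x₁ * y - Q⁻¹ • (y * x₁) = ψ := by
  rw [← sub_eq_zero, ← smul_eq_zero_iff_right ha]
  linear_combination (norm := skip) h.c₀ * ψ - ψ * h.c₀ - lam • h.Mψ hQ - hx * y + x * h.ψ_y hQ
      + Q⁻¹ • (y * hx) - Q⁻¹ • (h.ψ_y hQ * x) + (-lam * (Q - Q⁻¹)) • h.hψ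
  simp only [sub_mul, mul_sub, smul_mul_assoc, mul_smul_comm, mul_assoc, smul_sub, mul_one,
      one_mul]
  match_scalars <;> field_simp <;> ring

theorem c_next (h : Drin Q lam C D M N x' x y y' ψ ω) (hQ : Q ≠ 0) {x₁ y₁ : A}
    (hx : x * ψ - ψ * x = (-lam * (Q - Q⁻¹)) • x₁)
    (hy : ω * y - y * ω = (-lam * (Q - Q⁻¹)) • (D * y₁)) (ha : -lam * (Q - Q⁻¹) ≠ 0)
    (hDx : D * x₁ = x₁ * D) :
    x₁ * y₁ - Q⁻¹ • (y₁ * x₁) = lam • (M * C - 1) := by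
  have e : D * (x₁ * y₁ - Q⁻¹ • (y₁ * x₁)) = lam • (M - D) := by
    rw [← sub_eq_zero, ← smul_eq_zero_iff_right ha]
    have r := h.x₁_ω hQ hx ha
    linear_combination (norm := skip) ω * h.ψ_next hQ hx ha - h.ψ_next hQ hx ha * ω - h.ψ_ω hQ
      + r * y - x₁ * hy - Q⁻¹ • (y * r) + Q⁻¹ • (hy * x₁) + (-lam * (Q - Q⁻¹)) • h.c₀
    simp only [sub_mul, mul_sub, smul_mul_assoc, mul_smul_comm, mul_assoc, smul_sub, mul_one,
      one_mul, hDx, comm_assoc hDx]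
    match_scalars <;> field_simp <;> ring
  have := congrArg (C * ·) e
  simp only [← mul_assoc, h.CD, one_mul] at this
  rw [this, mul_smul_comm, mul_sub, h.CD, h.CM]

end Drin
end Drin
end AffineCW

namespace AffineCW
-- Shifting the window to the right
section DrinStep
variable {K : Type*} [Field K] {A : Type*} [Ring A] [Algebra K A]

/-- This is `serre_next` in the opposite algebra, with `Q⁻¹`; it serves the currents `Y` moved
downwards by `ω`. -/
theorem serre_next_op {Q : K} (hQ : Q ≠ 0) (h3 : 1 + Q + Q⁻¹ ≠ 0) (h2 : Q + Q⁻¹ ≠ 0)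
    {y z ψ x₁ x₂ z₂ : A} (hψ : z * y - Q • (y * z) = ψ)
    (hx₀ : ψ * y - y * ψ = x₁) (hx₁ : ψ * x₁ - x₁ * ψ = x₂) (hz : z * ψ - ψ * z = z₂)
    (hx : y * x₁ = Q • (x₁ * y)) (hzz : z₂ * z = Q • (z * z₂)) :
    x₁ * x₂ = Q • (x₂ * x₁) := by
  have := serre_next (Q := Q⁻¹) (inv_ne_zero hQ) (by rwa [inv_inv, add_right_comm])
    (by rwa [inv_inv, add_comm]) (x₀ := MulOpposite.op y) (x₁ := MulOpposite.op x₁)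
    (x₂ := MulOpposite.op x₂) (y₁ := MulOpposite.op z) (y₂ := MulOpposite.op z₂)
    (ψ := MulOpposite.op ψ) (MulOpposite.unop_injective (by simpa using hψ))
    (MulOpposite.unop_injective (by simpa using hx₀))
    (MulOpposite.unop_injective (by simpa using hx₁))
    (MulOpposite.unop_injective (by simpa using hz))
    (MulOpposite.unop_injective (by simpa using qcomm_swap hQ hx))
    (MulOpposite.unop_injective (by simpa using qcomm_swap hQ hzz))
  have := congrArg MulOpposite.unop this
  simp only [MulOpposite.unop_mul, MulOpposite.unop_smul, MulOpposite.unop_op] at this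
  rw [this, smul_smul, mul_inv_cancel₀ hQ, one_smul]

theorem smul_cancel {c : K} (hc : c ≠ 0) {u v : A} (h : c • u = c • v) : u = v :=
  smul_right_injective A hc h

theorem qsmul_cancel {Q c d : K} (hc : c ≠ 0) {u v : A} (h : c • u = d • v) (hd : d = Q * c) :
    u = Q • v :=
  smul_cancel hc (by rw [h, hd, smul_smul, mul_comm])

namespace Drin
variable {Q lam : K} {C D M N x' x y y' ψ ω : A}

theorem xN' (h : Drin Q lam C D M N x' x y y' ψ ω) : x' * N = (Q * Q) • (N * x') := by
  calc x' * N = N * (M * x') * N := by rw [← mul_assoc N, h.NM, one_mul]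
    _ = _ := by
      rw [h.Mx', mul_smul_comm, smul_mul_assoc, mul_assoc, mul_assoc, h.MN, mul_one]

theorem xN (h : Drin Q lam C D M N x' x y y' ψ ω) : x * N = (Q * Q) • (N * x) := by
  calc x * N = N * (M * x) * N := by rw [← mul_assoc N, h.NM, one_mul]
    _ = _ := by
      rw [h.Mx, mul_smul_comm, smul_mul_assoc, mul_assoc, mul_assoc, h.MN, mul_one]

theorem yN (h : Drin Q lam C D M N x' x y y' ψ ω) : N * y = (Q * Q) • (y * N) := by
  calc N * y = N * (y * M) * N := by rw [mul_assoc, mul_assoc, h.MN, mul_one]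
    _ = _ := by
      rw [h.My, mul_smul_comm, smul_mul_assoc, ← mul_assoc, h.NM, one_mul]

theorem Nω (h : Drin Q lam C D M N x' x y y' ψ ω) (hQ : Q ≠ 0) : ω * N = N * ω :=
  (mul_comm_of_inv h.MN h.NM (h.Mω hQ).symm).symm

/-- The bracket of `x'` and `y` is `M * ω` rather than `ω`. Using `x' * N` in place of `x'` removes
`M` and turns the coefficient `Q⁻¹` into `Q`, as `serre_next_op` requires; the factors `Q * Q`
record the passage of `N` through the currents. -/
theorem ny_next (h : Drin Q lam C D M N x' x y y' ψ ω) (hQ : Q ≠ 0) (h3 : 1 + Q + Q⁻¹ ≠ 0)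
    (h2 : Q + Q⁻¹ ≠ 0) {y₁ y₂ : A} (hy : ω * y - y * ω = y₁) (hy₁ : ω * y₁ - y₁ * ω = y₂) :
    y₁ * y₂ = Q • (y₂ * y₁) := by
  have hQQ := mul_ne_zero hQ hQ
  have hω : x' * N * y - Q • (y * (x' * N)) = (Q * Q) • ω := by
    rw [mul_assoc, h.yN, ← mul_assoc y, h.ω_eq]
    have e : (x' * y - Q⁻¹ • (y * x')) * N = N * (x' * y - Q⁻¹ • (y * x')) := by
      rw [h.hω, mul_assoc, h.Nω hQ, ← mul_assoc, ← mul_assoc, h.NM, h.MN]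
    rw [← e, sub_mul, smul_mul_assoc, mul_smul_comm, mul_assoc, mul_assoc]
    match_scalars <;> field_simp
  have := serre_next_op hQ h3 h2 hω (x₁ := (Q * Q) • y₁) (x₂ := (Q * Q * (Q * Q)) • y₂)
    (z₂ := (Q * Q) • ((x' * ω - ω * x') * N))
    (by rw [← hy]; simp only [smul_mul_assoc, mul_smul_comm, smul_sub])
    (by rw [← hy₁]; simp only [smul_mul_assoc, mul_smul_comm, smul_sub, smul_smul])
    (by
      simp only [smul_mul_assoc, mul_smul_comm, ← smul_sub, sub_mul, mul_assoc, h.Nω hQ])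
    (by
      simp only [smul_mul_assoc, mul_smul_comm, ← hy, h.ny, smul_smul, mul_comm])
    (by
      have hN : (x' * ω - ω * x') * N = (Q * Q) • (N * (x' * ω - ω * x')) := by
        simp only [sub_mul, mul_sub, mul_assoc, h.xN', h.Nω hQ, comm_assoc (h.Nω hQ),
          qcomm_assoc h.xN', mul_smul_comm, smul_sub]
      rw [hN]
      have := congrArg (fun u ↦ (Q * Q * (Q * Q) * (Q * Q) * (Q * Q)) • (N * (N * u))) h.nx
      have hN' := h.xN'
      have r := qcomm_assoc hN
      simp only [smul_mul_assoc, mul_smul_comm, smul_smul, mul_assoc, hN', qcomm_assoc hN', hN, r]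
        at this ⊢
      rw [this])
  rw [smul_mul_smul_comm, smul_mul_smul_comm, smul_smul] at this
  exact qsmul_cancel (mul_ne_zero hQQ (mul_ne_zero hQQ hQQ)) this (by ring)

/-- The six commutation relations of Serre type feed each other. The new `xx`, `yy` are the old
`sx`, `ny`; the new `sy`, `nx` are the old `yy`, `xx`, since `ψ` and `ω` lead back to known
currents. Only the new `sx` and `ny` are genuinely new, and these are `serre_next` and `ny_next`. -/
theorem step (h : Drin Q lam C D M N x' x y y' ψ ω) (hQ : Q ≠ 0) (h3 : 1 + Q + Q⁻¹ ≠ 0)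
    (h2 : Q + Q⁻¹ ≠ 0) {a : K} (ha : a ≠ 0) (hlam : a = -lam * (Q - Q⁻¹)) {x₁ y₁ : A}
    (hx : x * ψ - ψ * x = a • x₁) (hy : ω * y - y * ω = a • (D * y₁)) :
    Drin Q lam C D (M * C) (N * D) x x₁ y₁ y ψ ω := by
  have hQQ := mul_ne_zero hQ hQ
  have hD : ∀ {u v : A}, D * u = D * v → u = v := fun {u v} huv ↦ by
    rw [← one_mul u, ← h.CD, mul_assoc, huv, ← mul_assoc, h.CD, one_mul]
  have hCx₁ : C * x₁ = x₁ * C := by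
    apply smul_cancel ha
    rw [← mul_smul_comm, ← smul_mul_assoc, ← hx]
    simp only [mul_sub, sub_mul, mul_assoc, ← h.Cx, ← h.Cψ, ← comm_assoc h.Cx, ← comm_assoc h.Cψ]
  have hCy₁ : C * y₁ = y₁ * C := by
    have e : C * (D * y₁) = D * y₁ * C := by
      generalize D * y₁ = w at hy
      apply smul_cancel ha
      rw [← mul_smul_comm, ← smul_mul_assoc, ← hy]
      simp only [mul_sub, sub_mul, mul_assoc, ← h.Cy, ← h.Cω, ← comm_assoc h.Cy, ← comm_assoc h.Cω]
    apply hD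
    rw [← mul_assoc, ← mul_assoc, ← e, h.DC, ← h.CD, mul_assoc]
  have hDx₁ : D * x₁ = x₁ * D := mul_comm_of_inv h.CD h.DC hCx₁
  have hDy₁ : D * y₁ = y₁ * D := mul_comm_of_inv h.CD h.DC hCy₁
  have hMx₁ : M * x₁ = (Q * Q) • (x₁ * M) := by
    apply smul_cancel ha
    rw [← mul_smul_comm, smul_comm, ← smul_mul_assoc, ← hx]
    simp only [mul_sub, sub_mul, mul_assoc, h.Mx, h.Mψ hQ, qcomm_assoc h.Mx,
      ← comm_assoc (h.Mψ hQ), smul_sub, mul_smul_comm]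
  have hMy₁ : y₁ * M = (Q * Q) • (M * y₁) := by
    have e : D * y₁ * M = (Q * Q) • (M * (D * y₁)) := by
      generalize D * y₁ = w at hy
      apply smul_cancel ha
      rw [smul_comm, ← smul_mul_assoc, ← mul_smul_comm, ← hy]
      simp only [mul_sub, sub_mul, mul_assoc, h.My, h.Mω hQ, qcomm_assoc h.My,
        comm_assoc (h.Mω hQ), smul_sub, mul_smul_comm]
    apply hD
    rw [← mul_assoc, e, ← mul_assoc, ← h.DM, mul_smul_comm, mul_assoc]
  constructor
  · exact h.CD
  · exact h.DC
  · rw [mul_assoc, ← mul_assoc C, h.CN, mul_assoc N, h.CD, mul_one, h.MN]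
  · rw [mul_assoc, ← mul_assoc D, h.DM, mul_assoc M, h.DC, mul_one, h.NM]
  · rw [← mul_assoc, h.CM]
  · exact hCx₁
  · exact h.Cx
  · exact hCy₁
  · exact h.Cy
  · rw [mul_assoc, hCx₁, ← mul_assoc, hMx₁, smul_mul_assoc, mul_assoc]
  · rw [mul_assoc, h.Cx, ← mul_assoc, h.Mx, smul_mul_assoc, mul_assoc]
  · rw [← mul_assoc, hMy₁, smul_mul_assoc, mul_assoc, ← hCy₁, mul_assoc]
  · rw [← mul_assoc, h.My, smul_mul_assoc, mul_assoc, ← h.Cy, mul_assoc]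
  · have := h.sx
    rw [hx, mul_smul_comm, smul_mul_assoc, smul_comm] at this
    exact smul_cancel ha this
  · have := h.ny
    rw [hy, mul_smul_comm, smul_mul_assoc, smul_comm, ← mul_assoc, ← h.Dy, mul_assoc, mul_assoc] at this
    have := smul_cancel ha this
    rw [← mul_smul_comm] at this
    exact hD this
  · subst hlam
    exact h.c_next hQ hx hy ha hDx₁
  · rw [mul_assoc, h.CD, mul_one]; exact h.c₀
  · subst hlam
    exact h.ψ_next hQ hx ha
  · subst hlam
    rw [h.Dφ hQ hy ha, ← mul_assoc, h.CM]
  · have := serre_next hQ h3 h2 h.hψ hx rfl rfl (by rw [← hx]; exact h.sx) h.sy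
    simp only [smul_mul_assoc, mul_smul_comm, ← smul_sub, smul_smul] at this
    exact qsmul_cancel (mul_ne_zero ha ha) this (by ring)
  · subst hlam
    rw [h.ψ_y hQ, smul_mul_assoc, h.yy, mul_smul_comm, smul_comm]
  · subst hlam
    rw [h.x_ω hQ, smul_mul_assoc, h.xx, mul_smul_comm, smul_comm]
  · have := h.ny_next hQ h3 h2 hy rfl
    have e : ω * (a • (D * y₁)) - a • (D * y₁) * ω = a • (D * (ω * y₁ - y₁ * ω)) := by
      simp only [mul_smul_comm, smul_mul_assoc, ← mul_assoc, ← h.Dω, ← smul_sub, mul_sub]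
    have hz : D * (ω * y₁ - y₁ * ω) = (ω * y₁ - y₁ * ω) * D := by
      simp only [mul_sub, sub_mul, mul_assoc, ← h.Dω, ← hDy₁, ← comm_assoc h.Dω, ← comm_assoc hDy₁]
    rw [e, smul_mul_smul_comm, smul_mul_smul_comm, smul_smul, mul_assoc, mul_assoc,
      ← comm_assoc hz, ← comm_assoc hDy₁] at this
    have := qsmul_cancel (mul_ne_zero ha ha) this (by ring)
    rw [← mul_smul_comm, ← mul_smul_comm] at this
    exact hD (hD this)
end Drin
end DrinStep
end AffineCW

namespace AffineCW
-- Shifting to the left, and all integer indices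
section DrinAll
variable {K : Type*} [Field K] {A : Type*} [Ring A] [Algebra K A]
namespace Drin
variable {Q lam : K} {C D M N x' x y y' ψ ω : A}

/-- The symmetry `X_n ↔ Y_{n+1}` along an anti-homomorphism. -/
theorem flip {B : Type*} [Ring B] [Algebra K B] (f : A →ₗ[K] B) (f1 : f 1 = 1)
    (fm : ∀ u v, f (u * v) = f v * f u) (h : Drin Q lam C D M N x' x y y' ψ ω) (hQ : Q ≠ 0) :
    Drin Q lam (f D) (f C) (f (M * D)) (f (N * C)) (f y) (f y') (f x') (f x) (f ψ) (f (C * ω)) := by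
  have key : ∀ {u v : A}, u = v → f u = f v := fun h ↦ congrArg f h
  constructor
  · rw [← fm, h.CD, f1]
  · rw [← fm, h.DC, f1]
  · rw [← fm, ← f1]; apply key
    rw [mul_assoc, ← mul_assoc C, h.CM, mul_assoc M, h.CD, mul_one, h.NM]
  · rw [← fm, ← f1]; apply key
    rw [mul_assoc, ← mul_assoc D, mul_comm_of_inv h.CD h.DC h.CN, mul_assoc N, h.DC, mul_one, h.MN]
  · rw [← fm, ← fm, ← mul_assoc, h.DM]
  · rw [← fm, ← fm, h.Dy']
  · rw [← fm, ← fm, h.Dy]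
  · rw [← fm, ← fm, h.Dx']
  · rw [← fm, ← fm, h.Dx]
  · rw [← fm, ← fm, ← map_smul]; apply key
    rw [← mul_assoc, h.My', smul_mul_assoc, mul_assoc, ← h.Dy', mul_assoc]
  · rw [← fm, ← fm, ← map_smul]; apply key
    rw [← mul_assoc, h.My, smul_mul_assoc, mul_assoc, ← h.Dy, mul_assoc]
  · rw [← fm, ← fm, ← map_smul]; apply key
    rw [mul_assoc, h.Dx', ← mul_assoc, h.Mx', smul_mul_assoc, mul_assoc]
  · rw [← fm, ← fm, ← map_smul]; apply key
    rw [mul_assoc, h.Dx, ← mul_assoc, h.Mx, smul_mul_assoc, mul_assoc]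
  · rw [← fm, ← fm, ← map_smul, h.yy]
  · rw [← fm, ← fm, ← map_smul, h.xx]
  · rw [← fm, ← fm, ← map_smul, ← f1, ← map_sub, ← map_sub, ← map_smul, h.c₁]
  · rw [← fm, ← fm, ← fm, ← map_smul, ← f1, ← map_sub, ← map_sub, ← map_smul, h.c₀]
    rw [← mul_assoc, h.CM, mul_assoc, h.CD, mul_one]
  · rw [← fm, ← fm, ← map_smul, ← map_sub, h.hψ]
  · rw [← fm, ← fm, ← fm, ← map_smul, ← map_sub, h.hω]; apply key
    rw [mul_assoc, ← mul_assoc ω, h.Mω hQ, mul_assoc, ← h.Dω, comm_assoc h.CM, ← mul_assoc C D,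
      h.CD, one_mul]
  · rw [← fm, ← fm, ← map_sub, ← fm, ← fm, ← map_smul]; apply key
    exact h.sy
  · rw [← fm, ← fm, ← map_sub, ← fm, ← fm, ← map_smul]; apply key
    exact h.sx
  · rw [← fm, ← fm, ← map_sub, ← fm, ← fm, ← map_smul]; apply key
    have e : C * ω * y - y * (C * ω) = C * (ω * y - y * ω) := by
      rw [mul_sub, mul_assoc, comm_assoc h.Cy]
    rw [e, ← comm_assoc h.Cy, h.ny, mul_smul_comm, mul_assoc]
  · rw [← fm, ← fm, ← map_sub, ← fm, ← fm, ← map_smul]; apply key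
    have e : x' * (C * ω) - C * ω * x' = C * (x' * ω - ω * x') := by
      rw [mul_sub, mul_assoc, comm_assoc h.Cx']
    rw [e, ← comm_assoc h.Cx', mul_assoc, h.nx, mul_smul_comm]

/-- Under `flip` a left shift becomes a right shift, so this is `step` conjugated by the map to the
opposite algebra and its inverse. -/
theorem back (h : Drin Q lam C D M N x' x y y' ψ ω) (hQ : Q ≠ 0) (h3 : 1 + Q + Q⁻¹ ≠ 0)
    (h2 : Q + Q⁻¹ ≠ 0) {a : K} (ha : a ≠ 0) (hlam : a = -lam * (Q - Q⁻¹)) {x₁ y₁ : A}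
    (hx : x' * ω - ω * x' = a • x₁) (hy : ψ * y' - y' * ψ = a • y₁) :
    Drin Q lam C D (M * D) (N * C) x₁ x' y' y₁ ψ ω := by
  have s := (h.flip (MulOpposite.opLinearEquiv K : A ≃ₗ[K] Aᵐᵒᵖ).toLinearMap (by simp) (by simp) hQ).step
    hQ h3 h2 ha hlam (x₁ := MulOpposite.op y₁) (y₁ := MulOpposite.op x₁)
    (by apply MulOpposite.unop_injective; simpa using hy)
    (by
      apply MulOpposite.unop_injective
      have e : x' * (C * ω) - C * ω * x' = C * (x' * ω - ω * x') := by
        rw [mul_sub, mul_assoc, comm_assoc h.Cx']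
      have hC : C * x₁ = x₁ * C := by
        apply smul_cancel ha
        rw [← mul_smul_comm, ← smul_mul_assoc, ← hx]
        simp only [mul_sub, sub_mul, mul_assoc, ← h.Cx', ← h.Cω, ← comm_assoc h.Cx',
          ← comm_assoc h.Cω]
      simp [e, hx, hC])
  have r := s.flip (MulOpposite.opLinearEquiv K : A ≃ₗ[K] Aᵐᵒᵖ).symm.toLinearMap (by simp) (by simp) hQ
  have e₁ : C * (D * (M * D)) = M * D := by rw [← mul_assoc, h.CD, one_mul]
  have e₂ : D * (C * (N * C)) = N * C := by rw [← mul_assoc, h.DC, one_mul]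
  have e₃ : C * ω * D = ω := by rw [mul_assoc, ← h.Dω, ← mul_assoc, h.CD, one_mul]
  simpa [e₁, e₂, e₃] using r
end Drin

/-- All the currents, from the relations between four of them and the recursions. -/
theorem drin_nat {Q lam a : K} {C M : Aˣ} {X Y : ℤ → A} {ψ ω : A} (hQ : Q ≠ 0)
    (h3 : 1 + Q + Q⁻¹ ≠ 0) (h2 : Q + Q⁻¹ ≠ 0) (ha : a ≠ 0) (hlam : a = -lam * (Q - Q⁻¹))
    (h : Drin Q lam (C : A) ↑C⁻¹ M ↑M⁻¹ (X (-1)) (X 0) (Y 0) (Y 1) ψ ω)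
    (hX : ∀ n : ℕ, X n * ψ - ψ * X n = a • X (n + 1))
    (hX' : ∀ n : ℕ, X (-(n + 1)) * ω - ω * X (-(n + 1)) = a • X (-(n + 1) - 1))
    (hY : ∀ n : ℕ, ψ * Y (n + 1) - Y (n + 1) * ψ = a • Y (n + 1 + 1))
    (hY' : ∀ n : ℕ, ω * Y (-n) - Y (-n) * ω = a • (↑C⁻¹ * Y (-n - 1))) (n : ℤ) :
    Drin Q lam (C : A) ↑C⁻¹ ↑(M * C ^ n) ↑(M * C ^ n)⁻¹ (X (n - 1)) (X n) (Y (-n)) (Y (1 - n)) ψ ω := by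
  have hC : Commute C M := Units.ext h.CM
  induction n using Int.induction_on with
  | zero => simpa using h
  | succ n ih =>
    have := ih.step hQ h3 h2 ha hlam (hX n) (hY' n)
    rw [add_sub_cancel_right, neg_add', sub_add_eq_sub_sub_swap, sub_self, zero_sub]
    convert this using 1
    · rw [zpow_add_one, ← mul_assoc]; rfl
    · rw [← Units.val_mul, zpow_add_one, ← mul_assoc, mul_inv_rev (M * C ^ (n : ℤ)),
        ← mul_inv_rev, ← mul_inv_rev]
      congr 2
      exact ((hC.mul_right ((Commute.refl C).zpow_right n))).eq.symm
  | pred n ih =>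
    have := ih.back hQ h3 h2 ha hlam (x₁ := X (-n - 1 - 1)) (y₁ := Y (n + 1 + 1))
      (by have := hX' n; rwa [neg_add'] at this)
      (by rw [sub_neg_eq_add, add_comm]; exact hY n)
    rw [sub_neg_eq_add, add_comm 1] at this
    rw [neg_sub, sub_neg_eq_add, show 1 - (-(n : ℤ) - 1) = n + 1 + 1 by ring, add_comm 1]
    convert this using 1
    · rw [zpow_sub_one, ← mul_assoc]; rfl
    · rw [← Units.val_mul, zpow_sub_one, ← mul_assoc, mul_inv_rev (M * C ^ (-n : ℤ)), inv_inv]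
      congr 1
      exact ((hC.mul_right ((Commute.refl C).zpow_right _)).inv_right).eq

end DrinAll
end AffineCW

namespace AffineCW
-- The loop relations and their dual
section DrinLoop
variable {K : Type*} [Field K] {A : Type*} [Ring A] [Algebra K A]

variable {Q lam a : K} {C M : Aˣ} {X Y : ℤ → A} {ψ ω : A}

theorem loop_of_drin (hQ : Q ≠ 0) (hlam : a = -lam * (Q - Q⁻¹))
    (h : ∀ n : ℤ, Drin Q lam (C : A) ↑C⁻¹ ↑(M * C ^ n) ↑(M * C ^ n)⁻¹ (X (n - 1)) (X n) (Y (-n))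
      (Y (1 - n)) ψ ω) : Loop Q a X Y ψ := by
  subst hlam
  constructor
  · intro n
    simpa using (h (n + 1)).x'_ψ hQ
  · intro n
    simpa [add_comm] using (h (-n)).ψ_y hQ
  · intro n
    simpa using (h (n + 1)).xx
  · intro n
    simpa [add_comm] using (h (-n)).yy
  · intro n
    -- The level-zero bracket is a Cartan element of weight zero on `ψ`, by `c₀`.
    rw [mixed, (h n).c₀, smul_mul_assoc, mul_smul_comm, sub_mul, mul_sub, (h n).Mψ hQ, one_mul,
      mul_one]
  · rw [mixed]; simpa using (h 0).hψ

/-- The Cartan-dual currents. -/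
theorem dual_loop_of_drin (hQ : Q ≠ 0) (hlam : a = -lam * (Q - Q⁻¹))
    (h : ∀ n : ℤ, Drin Q lam (C : A) ↑C⁻¹ ↑(M * C ^ n) ↑(M * C ^ n)⁻¹ (X (n - 1)) (X n) (Y (-n))
      (Y (1 - n)) ψ ω) :
    Loop Q⁻¹ (Q * Q * a) (fun n ↦ MulOpposite.op (Y (-n)))
      (fun n ↦ MulOpposite.op (X (-n) * ↑(M * C ^ (-n))⁻¹))
      (MulOpposite.op ((Q * Q) • ((C : A) * ω))) := by
  have hQQ := mul_ne_zero hQ hQ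
  have N₁ : ∀ n : ℤ, (((M * C ^ (n - 1))⁻¹ : Aˣ) : A) = ↑(M * C ^ n)⁻¹ * (C : A) := fun n ↦ by
    have hC : Commute C M := Units.ext (by simpa using (h 0).CM)
    rw [← Units.val_mul, zpow_sub_one, ← mul_assoc, mul_inv_rev (M * C ^ n), inv_inv]
    congr 1
    exact ((hC.mul_right ((Commute.refl C).zpow_right _)).inv_right).eq
  have Xω : ∀ n : ℤ, X n * ω - ω * X n = a • X (n - 1) := fun n ↦ hlam ▸ (h n).x_ω hQ
  have ωY : ∀ n : ℤ, ω * Y n - Y n * ω = a • (↑C⁻¹ * Y (n - 1)) := fun n ↦ by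
    rw [hlam]; simpa [← sub_eq_neg_add] using (h (1 - n)).ω_y' hQ
  have CX : ∀ n : ℤ, (C : A) * X n = X n * C := fun n ↦ (h n).Cx
  have CY : ∀ n : ℤ, (C : A) * Y n = Y n * C := fun n ↦ by simpa using (h (-n)).Cy
  have Cω := (h 0).Cω
  have ωN : ∀ n : ℤ, ω * (((M * C ^ n)⁻¹ : Aˣ) : A) = ↑(M * C ^ n)⁻¹ * ω := fun n ↦ (h n).Nω hQ
  have CN : ∀ n : ℤ, (C : A) * (((M * C ^ n)⁻¹ : Aˣ) : A) = ↑(M * C ^ n)⁻¹ * C := fun n ↦ (h n).CN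
  have XN' : ∀ n : ℤ, X (n - 1) * (((M * C ^ n)⁻¹ : Aˣ) : A) = (Q * Q) • (↑(M * C ^ n)⁻¹ * X (n - 1)) :=
    fun n ↦ (h n).xN'
  have XN : ∀ n : ℤ, X n * (((M * C ^ n)⁻¹ : Aˣ) : A) = (Q * Q) • (↑(M * C ^ n)⁻¹ * X n) :=
    fun n ↦ (h n).xN
  have NY : ∀ n : ℤ, (((M * C ^ n)⁻¹ : Aˣ) : A) * Y (-n) = (Q * Q) • (Y (-n) * ↑(M * C ^ n)⁻¹) :=
    fun n ↦ (h n).yN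
  have hL := loop_of_drin hQ hlam h
  -- Negating the indices lets `ω`, which lowers indices, play the part of `ψ`. The inverse Cartan
  -- unit attached to `X (-n)` cancels the `M` in `hω`, and moving it past `Y` accounts for the
  -- scalar `Q * Q`.
  constructor
  · intro n
    apply MulOpposite.unop_injective
    have e := ωY (-n)
    rw [← neg_add'] at e
    have := congrArg (fun u ↦ (Q * Q) • ((C : A) * u)) e
    simp only [mul_sub, smul_sub, mul_smul_comm, comm_assoc (CY _), Units.mul_inv_cancel_left,
      smul_smul] at this
    simpa only [MulOpposite.unop_sub, MulOpposite.unop_mul, MulOpposite.unop_op,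
      MulOpposite.unop_smul, smul_mul_assoc, mul_smul_comm, mul_assoc] using this
  · intro n
    apply MulOpposite.unop_injective
    simp only [MulOpposite.unop_sub, MulOpposite.unop_mul, MulOpposite.unop_op,
      MulOpposite.unop_smul]
    have e := congrArg (fun u ↦ (Q * Q) • (u * (↑(M * C ^ (-n))⁻¹ * (C : A)))) (Xω (-n))
    have e₁ : X (-n) * ↑(M * C ^ (-n))⁻¹ * (C * ω) = X (-n) * ω * (↑(M * C ^ (-n))⁻¹ * (C : A)) := by
      rw [Cω, mul_assoc, ← mul_assoc _ ω, ← ωN]; simp only [mul_assoc]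
    have e₂ : C * ω * (X (-n) * ↑(M * C ^ (-n))⁻¹) =
        ω * X (-n) * (↑(M * C ^ (-n))⁻¹ * (C : A)) := by
      rw [Cω, mul_assoc, comm_assoc (CX _), CN, mul_assoc]
    rw [neg_add', N₁, mul_smul_comm, e₁, smul_mul_assoc, e₂, ← smul_sub, ← sub_mul]
    simpa only [smul_mul_assoc, smul_smul] using e
  · intro n
    apply MulOpposite.unop_injective
    have := qcomm_swap hQ (hL.yy (-n - 1))
    rw [sub_add_cancel] at this
    simpa only [MulOpposite.unop_mul, MulOpposite.unop_op, MulOpposite.unop_smul, neg_add'] using this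
  · intro n
    apply MulOpposite.unop_injective
    have := qcomm_swap hQ (hL.xx (-n - 1))
    rw [sub_add_cancel] at this
    simp only [MulOpposite.unop_mul, MulOpposite.unop_op, MulOpposite.unop_smul, neg_add', N₁]
    have NX := fun k ↦ qcomm_swap hQQ (XN k)
    have NX' := fun k ↦ qcomm_swap hQQ (XN' k)
    simp only [mul_assoc, qcomm_assoc (NX' _), qcomm_assoc (NX _), mul_smul_comm,
      comm_assoc (CX _), CN]
    rw [← mul_assoc (X (-n)), this]
    simp only [mul_assoc, smul_mul_assoc]
    exact smul_comm _ _ _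
  · intro n
    apply MulOpposite.unop_injective
    have e : MulOpposite.unop (mixed Q⁻¹ (fun n ↦ MulOpposite.op (Y (-n)))
        (fun n ↦ MulOpposite.op (X (-n) * ↑(M * C ^ (-n))⁻¹)) n (-n)) =
        (Q * Q * lam) • (1 - ↑(M * C ^ n)⁻¹) := by
      simp only [mixed, MulOpposite.unop_sub, MulOpposite.unop_mul, MulOpposite.unop_op,
        MulOpposite.unop_smul, neg_neg, inv_inv, mul_assoc, NY]
      have := congrArg (fun u ↦ (Q * Q) • (u * (((M * C ^ n)⁻¹ : Aˣ) : A))) (h n).c₀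
      simp only [sub_mul, smul_mul_assoc, mul_assoc, Units.mul_inv, one_mul, smul_smul,
        smul_sub] at this
      rw [mul_smul_comm, smul_sub, ← this]
      match_scalars <;> field_simp
    rw [MulOpposite.unop_mul, MulOpposite.unop_mul, e, MulOpposite.unop_op]
    simp only [mul_sub, sub_mul, smul_mul_assoc, mul_smul_comm, mul_one, one_mul, mul_assoc, ωN,
      comm_assoc (CN _)]
    module
  · apply MulOpposite.unop_injective
    have e := (h 0).hω
    have n₁ := N₁ 0
    simp only [zero_sub, neg_zero, zpow_zero, mul_one] at e n₁
    simp only [mixed, MulOpposite.unop_sub, MulOpposite.unop_mul, MulOpposite.unop_op,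
        MulOpposite.unop_smul, neg_zero, inv_inv, n₁]
    have ny := NY 0
    have cn := CN 0
    have ωn := ωN 0
    simp only [neg_zero, zpow_zero, mul_one] at ny cn ωn
    have cy := CY 0
    have := congrArg (fun u ↦ (Q * Q) • (u * (↑M⁻¹ * (C : A)))) e
    simp only [sub_mul, mul_assoc, smul_mul_assoc] at this ⊢
    rw [cy, ← mul_assoc (↑M⁻¹ : A), ny, smul_mul_assoc, mul_smul_comm, mul_assoc, Cω,
      ← Units.mul_inv_cancel_left M (ω * (C : A)), ← mul_assoc (↑M⁻¹ : A) ω, ← ωn, mul_assoc ω,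
      ← this]
    match_scalars <;> field_simp
end DrinLoop
end AffineCW

namespace AffineCW
-- From Chevalley generators to currents
section Chevalley
variable {K : Type*} [Field K] {A : Type*} [Ring A] [Algebra K A]

/-- Chevalley generators and the root vectors `E n = e_{nδ+α}`, `F n = e_{nδ-α}`, `I n = e'_{nδ}`
built from them, where `k = k_α`, `d = k_δ`, `p = (-1)^θ`, `g = q ^ 2`, `s = (q - q⁻¹)⁻¹`. -/
structure RootVecs (p g s a : K) (k d : Aˣ) (E F I : ℤ → A) (eδ eε : A) : Prop where
  dk : (d : A) * k = k * d
  dE : (d : A) * E 0 = E 0 * d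
  dE' : (d : A) * E (-1) = E (-1) * d
  dF : (d : A) * F 0 = F 0 * d
  dF' : (d : A) * F 1 = F 1 * d
  kE : (k : A) * E 0 = g • (E 0 * k)
  kE' : (k : A) * E (-1) = g • (E (-1) * k)
  kF : F 0 * (k : A) = g • (k * F 0)
  kF' : F 1 * (k : A) = g • (k * F 1)
  EE : E 0 * E (-1) = p • (E (-1) * E 0)
  FF : F 0 * F 1 = p • (F 1 * F 0)
  EF : E 0 * F 0 - p • (F 0 * E 0) = s • ((k : A) - ↑k⁻¹)
  FE : F 1 * E (-1) - p • (E (-1) * F 1) = s • ((↑k⁻¹ : A) * d - k * (↑d⁻¹ : A))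
  heδ : E 0 * F 1 - (p * g)⁻¹ • (F 1 * E 0) = eδ
  heε : E (-1) * F 0 - (p * g) • (F 0 * E (-1)) = eε
  serreE : E 0 * (E 0 * eδ - eδ * E 0) = (p * g) • ((E 0 * eδ - eδ * E 0) * E 0)
  serreF : (eδ * F 1 - F 1 * eδ) * F 1 = (p * g) • (F 1 * (eδ * F 1 - F 1 * eδ))
  serreE' : (E (-1) * eε - eε * E (-1)) * E (-1) =
    (p * g) • (E (-1) * (E (-1) * eε - eε * E (-1)))
  serreF' : F 0 * (eε * F 0 - F 0 * eε) = (p * g) • ((eε * F 0 - F 0 * eε) * F 0)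
  recE : ∀ n : ℕ, E n * eδ - eδ * E n = a • E (n + 1)
  recF : ∀ n : ℕ, eδ * F (n + 1) - F (n + 1) * eδ = a • F (n + 1 + 1)
  recE' : ∀ n : ℕ, E (-(n + 1)) * eε - eε * E (-(n + 1)) = a • E (-(n + 1) - 1)
  recF' : ∀ n : ℕ, eε * F (-n) - F (-n) * eε = a • F (-n - 1)
  imagPos : ∀ n : ℤ, 0 < n → E 0 * F n - (p * g)⁻¹ • (F n * E 0) = I n
  imagNeg : ∀ n : ℤ, 0 < n → E (-n) * F 0 - (p * g) • (F 0 * E (-n)) = I (-n)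

/-- The current `X_n` proportional to `e_{nδ+α}`. -/
def curX (p : K) (k d : Aˣ) (E : ℤ → A) (n : ℤ) : A :=
  if 0 ≤ n then E n else (-p ^ (n + 1)) • (((k * d ^ n : Aˣ) : A) * E n)

/-- The current `Y_n` proportional to `e_{nδ-α}`. -/
def curY (p : K) (k d : Aˣ) (F : ℤ → A) (n : ℤ) : A :=
  if 0 < n then F n else (-p ^ (n + 1)) • (F n * ((k * d ^ (-n) : Aˣ) : A))

namespace RootVecs
variable {p g s a : K} {k d : Aˣ} {E F I : ℤ → A} {eδ eε : A}

theorem inv_comm {u : Aˣ} {z : A} (h : (u : A) * z = z * u) : (↑u⁻¹ : A) * z = z * ↑u⁻¹ :=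
  mul_comm_of_inv (by simp) (by simp) h

theorem d_eδ (h : RootVecs p g s a k d E F I eδ eε) : (d : A) * eδ = eδ * d := by
  rw [← h.heδ]
  simp only [mul_sub, sub_mul, mul_smul_comm, smul_mul_assoc, mul_assoc, ← h.dE, ← h.dF',
    ← comm_assoc h.dE, ← comm_assoc h.dF']

theorem d_eε (h : RootVecs p g s a k d E F I eδ eε) : (d : A) * eε = eε * d := by
  rw [← h.heε]
  simp only [mul_sub, sub_mul, mul_smul_comm, smul_mul_assoc, mul_assoc, ← h.dE', ← h.dF,
    ← comm_assoc h.dE', ← comm_assoc h.dF]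

theorem k_eδ (h : RootVecs p g s a k d E F I eδ eε) (hg : g ≠ 0) : (k : A) * eδ = eδ * k := by
  rw [← h.heδ]
  simp only [mul_sub, sub_mul, mul_smul_comm, smul_mul_assoc, mul_assoc, qcomm_swap hg h.kE, h.kF',
    qcomm_assoc (qcomm_swap hg h.kE), qcomm_assoc h.kF']
  match_scalars <;> field_simp

theorem k_eε (h : RootVecs p g s a k d E F I eδ eε) (hg : g ≠ 0) : (k : A) * eε = eε * k := by
  rw [← h.heε]
  simp only [mul_sub, sub_mul, mul_smul_comm, smul_mul_assoc, mul_assoc, qcomm_swap hg h.kE', h.kF,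
    qcomm_assoc (qcomm_swap hg h.kE'), qcomm_assoc h.kF]
  match_scalars <;> field_simp

/-- Each entry is a defining relation multiplied by Cartan elements. Moving `k` past a root vector
costs a factor `g` or `g⁻¹`, and this converts the super sign `p` into `p * g` or its inverse. -/
theorem drin_zero (h : RootVecs p g s a k d E F I eδ eε) (hp : p = 1 ∨ p = -1) (hg : g ≠ 0) :
    Drin (p * g) (-p * s) ((d * d : Aˣ) : A) ↑(d * d)⁻¹ ((k * k : Aˣ) : A) ↑(k * k)⁻¹
      (curX p k d E (-1)) (curX p k d E 0) (curY p k d F 0) (curY p k d F 1) eδ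
      (p • ((↑d⁻¹ : A) * eε)) := by
  have X0 : curX p k d E 0 = E 0 := by simp [curX]
  have Y1 : curY p k d F 1 = F 1 := by simp [curY]
  have X' : curX p k d E (-1) = - ((k : A) * (↑d⁻¹ * E (-1))) := by simp [curX, mul_assoc]
  have Y0 : curY p k d F 0 = - p • (F 0 * (k : A)) := by simp [curY]
  rw [X0, Y1, X', Y0]
  have hpp : p * p = 1 := by rcases hp with rfl | rfl <;> simp
  have hpi : p⁻¹ = p := inv_eq_of_mul_eq_one_left hpp
  have hp0 : p ≠ 0 := by rintro rfl; simp at hpp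
  have ek := qcomm_swap hg h.kE
  have ek' := qcomm_swap hg h.kE'
  have Dk := inv_comm h.dk
  have DE := inv_comm h.dE
  have DE' := inv_comm h.dE'
  have DF := inv_comm h.dF
  have DF' := inv_comm h.dF'
  have Deε := inv_comm h.d_eε
  have Deδ := inv_comm h.d_eδ
  constructor
  · exact Units.mul_inv _
  · exact Units.inv_mul _
  · exact Units.mul_inv _
  · exact Units.inv_mul _
  all_goals try simp only [Units.val_mul]
  · simp only [mul_assoc, h.dk, comm_assoc h.dk]
  · simp only [mul_assoc, h.dE, comm_assoc h.dE]
  · simp only [mul_assoc, mul_neg, neg_mul, ← h.dE', ← comm_assoc h.dE', h.dk, comm_assoc h.dk,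
      Units.mul_inv_cancel_left, Units.inv_mul_cancel_left]
  · simp only [mul_assoc, mul_neg, neg_mul, h.dF, comm_assoc h.dF, h.dk, comm_assoc h.dk,
      smul_mul_assoc, mul_smul_comm]
  · simp only [mul_assoc, h.dF', comm_assoc h.dF']
  · simp only [mul_assoc, h.kE, qcomm_assoc h.kE, smul_smul, mul_smul_comm]
    congr 1; rcases hp with rfl | rfl <;> ring
  · simp only [mul_assoc, h.kE', qcomm_assoc h.kE', smul_smul, mul_smul_comm, smul_mul_assoc, mul_neg, neg_mul,
      smul_neg, Dk, ← comm_assoc Dk]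
    match_scalars; rcases hp with rfl | rfl <;> ring
  · simp only [mul_assoc, h.kF, qcomm_assoc h.kF, smul_smul, mul_smul_comm, smul_mul_assoc]
    congr 1; rcases hp with rfl | rfl <;> ring
  · simp only [mul_assoc, h.kF', qcomm_assoc h.kF', smul_smul, mul_smul_comm]
    congr 1; rcases hp with rfl | rfl <;> ring
  · simp only [mul_assoc, mul_neg, neg_mul, smul_neg, mul_smul_comm, qcomm_assoc ek, ← comm_assoc DE,
      h.EE, smul_smul]
    rw [neg_inj]
    match_scalars
    field_simp
    rcases hp with rfl | rfl <;> ring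
  · simp only [mul_assoc, mul_neg, neg_mul, smul_neg, mul_smul_comm, smul_mul_assoc, smul_smul,
      qcomm_assoc h.kF', h.kF', h.kF, qcomm_assoc h.kF]
    rw [h.FF, mul_smul_comm, smul_smul]
    match_scalars
    rcases hp with rfl | rfl <;> ring
  · simp only [mul_assoc, mul_neg, neg_mul, smul_neg, mul_smul_comm, smul_mul_assoc, smul_smul,
      ek, qcomm_assoc h.kF]
    have e := congrArg (fun u ↦ (-p) • (u * (k : A))) h.EF
    simp only [sub_mul, smul_mul_assoc, mul_assoc, qcomm_assoc h.kF, ek, Units.inv_mul, mul_smul_comm, smul_smul,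
      smul_sub] at e
    linear_combination (norm := skip) e
    match_scalars <;> field_simp <;> rcases hp with rfl | rfl <;> ring
  · have e := congrArg (fun u ↦ p • ((k : A) * ((↑d⁻¹ : A) * u))) h.FE
    have mi : ((d * d : Aˣ)⁻¹ : Aˣ).val = (↑d⁻¹ : A) * ↑d⁻¹ := by simp
    rw [mi]
    simp only [mul_assoc, mul_neg, neg_mul, smul_neg, mul_smul_comm, smul_mul_assoc, smul_smul,
      ← Dk, ← comm_assoc Dk, mul_sub, qcomm_assoc h.kF', ← comm_assoc DF', smul_sub,
      Units.mul_inv, Units.mul_inv_cancel_left, Units.inv_mul, mul_one] at e ⊢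
    linear_combination (norm := skip) e
    match_scalars <;> field_simp <;> rcases hp with rfl | rfl <;> ring
  · exact h.heδ
  · simp only [← h.heε]
    simp only [mul_assoc, mul_neg, neg_mul, smul_neg, mul_smul_comm, smul_mul_assoc, smul_smul,
      ← Dk, ← comm_assoc Dk, mul_sub, qcomm_assoc h.kF, ← comm_assoc DF, smul_sub, ek', h.kF,
      qcomm_assoc ek']
    match_scalars <;> field_simp <;> rcases hp with rfl | rfl <;> ring
  · exact h.serreE
  · exact h.serreF
  · have e₁ : -(↑k * (↑d⁻¹ * E (-1))) * p • (↑d⁻¹ * eε) - p • (↑d⁻¹ * eε) * -(↑k * (↑d⁻¹ * E (-1))) =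
        (-p) • (↑k * (↑d⁻¹ * (↑d⁻¹ * (E (-1) * eε - eε * E (-1))))) := by
      simp only [mul_neg, neg_mul, mul_smul_comm, smul_mul_assoc, mul_assoc, mul_sub,
        ← comm_assoc DE', ← comm_assoc Deε, ← comm_assoc Dk, ← comm_assoc (h.k_eε hg)]
      module
    have e₂ : (E (-1) * eε - eε * E (-1)) * k = g⁻¹ • (k * (E (-1) * eε - eε * E (-1))) := by
      simp only [sub_mul, mul_sub, mul_assoc, ← h.k_eε hg, ek', qcomm_assoc ek', mul_smul_comm,
        smul_sub, ← comm_assoc (h.k_eε hg)]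
    have e₃ : ↑d⁻¹ * (E (-1) * eε - eε * E (-1)) = (E (-1) * eε - eε * E (-1)) * ↑d⁻¹ := by
      simp only [sub_mul, mul_sub, mul_assoc, ← DE', ← comm_assoc DE', ← Deε, ← comm_assoc Deε]
    rw [e₁]
    have e₄ := h.serreE'
    generalize E (-1) * eε - eε * E (-1) = Z at *
    simp only [mul_assoc, mul_neg, neg_mul, smul_neg, mul_smul_comm, smul_mul_assoc, smul_smul,
      ← Dk, ← comm_assoc Dk, ← comm_assoc e₃, ← comm_assoc DE', qcomm_assoc e₂, qcomm_assoc ek',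
      e₄]
    match_scalars
    ring
  · have e₁ : p • (↑d⁻¹ * eε) * -p • (F 0 * ↑k) - -p • (F 0 * ↑k) * p • (↑d⁻¹ * eε) =
        (-p * p) • (↑d⁻¹ * ((eε * F 0 - F 0 * eε) * k)) := by
      simp only [mul_neg, neg_mul, mul_smul_comm, smul_mul_assoc, mul_assoc, mul_sub, sub_mul,
        ← comm_assoc DF, h.k_eε hg, ← comm_assoc Dk]
      module
    have e₂ : (eε * F 0 - F 0 * eε) * k = g • (k * (eε * F 0 - F 0 * eε)) := by
      simp only [sub_mul, mul_sub, mul_assoc, ← h.k_eε hg, h.kF, qcomm_assoc h.kF, mul_smul_comm,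
        smul_sub, ← comm_assoc (h.k_eε hg)]
    have e₃ : ↑d⁻¹ * (eε * F 0 - F 0 * eε) = (eε * F 0 - F 0 * eε) * ↑d⁻¹ := by
      simp only [sub_mul, mul_sub, mul_assoc, ← DF, ← comm_assoc DF, ← Deε, ← comm_assoc Deε]
    rw [e₁]
    have e₄ := h.serreF'
    generalize eε * F 0 - F 0 * eε = Z at *
    simp only [mul_assoc, mul_neg, neg_mul, smul_neg, mul_smul_comm, smul_mul_assoc, smul_smul,
      ← Dk, ← comm_assoc Dk, ← comm_assoc e₃, ← comm_assoc DF, e₂, qcomm_assoc e₂, h.kF,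
      qcomm_assoc h.kF, e₄]
    match_scalars
    ring

theorem weight_step {a c : K} (ha : a ≠ 0) {u w w' z : A} (hu : u * w = c • (w * u))
    (hz : u * z = z * u) (h : w * z - z * w = a • w') : u * w' = c • (w' * u) := by
  apply smul_cancel ha
  rw [smul_comm, ← mul_smul_comm, ← smul_mul_assoc a, ← h]
  simp only [mul_sub, sub_mul, mul_assoc, hu, qcomm_assoc hu, hz, comm_assoc hz, mul_smul_comm,
    smul_sub]

theorem weight_step' {a c : K} (ha : a ≠ 0) {u w w' z : A} (hu : u * w = c • (w * u))
    (hz : u * z = z * u) (h : z * w - w * z = a • w') : u * w' = c • (w' * u) :=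
  weight_step (neg_ne_zero.2 ha) hu hz (by rw [neg_smul, ← h, neg_sub])

/-- Weights of the vectors `e_{nδ+α}` under an element commuting with `e_δ` and `e_{-δ}` up to
scalars. -/
theorem weight_E (h : RootVecs p g s a k d E F I eδ eε) (ha : a ≠ 0) {u : A} {c : K}
    (hE : u * E 0 = c • (E 0 * u)) (hE' : u * E (-1) = c • (E (-1) * u))
    (hδ : u * eδ = eδ * u) (hε : u * eε = eε * u) (n : ℤ) : u * E n = c • (E n * u) := by
  obtain ⟨n, rfl | rfl⟩ : ∃ m : ℕ, n = m ∨ n = -(m + 1) := by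
    rcases le_or_gt 0 n with hn | hn
    · exact ⟨n.toNat, by omega⟩
    · exact ⟨(-n - 1).toNat, by omega⟩
  · induction n with
    | zero => simpa using hE
    | succ n ih => push_cast; exact weight_step ha ih hδ (h.recE n)
  · induction n with
    | zero => simpa using hE'
    | succ n ih =>
      have := weight_step ha ih hε (h.recE' n)
      rwa [← neg_add'] at this

theorem weight_F (h : RootVecs p g s a k d E F I eδ eε) (ha : a ≠ 0) {u : A} {c : K}
    (hF : u * F 0 = c • (F 0 * u)) (hF' : u * F 1 = c • (F 1 * u))
    (hδ : u * eδ = eδ * u) (hε : u * eε = eε * u) (n : ℤ) : u * F n = c • (F n * u) := by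
  obtain ⟨n, rfl | rfl⟩ : ∃ m : ℕ, n = m + 1 ∨ n = -m := by
    rcases le_or_gt n 0 with hn | hn
    · exact ⟨(-n).toNat, by omega⟩
    · exact ⟨(n - 1).toNat, by omega⟩
  · induction n with
    | zero => simpa using hF'
    | succ n ih => push_cast; exact weight_step' ha ih hδ (h.recF n)
  · induction n with
    | zero => simpa using hF
    | succ n ih =>
      have := weight_step' ha ih hε (h.recF' n)
      rw [← neg_add'] at this
      exact_mod_cast this

theorem d_E (h : RootVecs p g s a k d E F I eδ eε) (ha : a ≠ 0) (n : ℤ) :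
    (d : A) * E n = E n * d := by
  simpa using h.weight_E ha (c := 1) (by simpa using h.dE) (by simpa using h.dE') h.d_eδ h.d_eε n

theorem d_F (h : RootVecs p g s a k d E F I eδ eε) (ha : a ≠ 0) (n : ℤ) :
    (d : A) * F n = F n * d := by
  simpa using h.weight_F ha (c := 1) (by simpa using h.dF) (by simpa using h.dF') h.d_eδ h.d_eε n

theorem k_E (h : RootVecs p g s a k d E F I eδ eε) (ha : a ≠ 0) (hg : g ≠ 0) (n : ℤ) :
    (k : A) * E n = g • (E n * k) :=
  h.weight_E ha h.kE h.kE' (h.k_eδ hg) (h.k_eε hg) n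

theorem k_F (h : RootVecs p g s a k d E F I eδ eε) (ha : a ≠ 0) (hg : g ≠ 0) (n : ℤ) :
    F n * (k : A) = g • (k * F n) := by
  have := h.weight_F ha (qcomm_swap hg h.kF) (qcomm_swap hg h.kF') (h.k_eδ hg) (h.k_eε hg) n
  simpa using qcomm_swap (inv_ne_zero hg) this

theorem zpow_comm {u : Aˣ} {z : A} (h : (u : A) * z = z * u) (n : ℤ) :
    ((u ^ n : Aˣ) : A) * z = z * ((u ^ n : Aˣ) : A) := by
  induction n using Int.induction_on with
  | zero => simp
  | succ n ih => rw [zpow_add_one, Units.val_mul, mul_assoc, h, ← mul_assoc, ih, mul_assoc]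
  | pred n ih =>
    rw [zpow_sub_one, Units.val_mul, mul_assoc, inv_comm h, ← mul_assoc, ih, mul_assoc]

theorem d_zpow_E (h : RootVecs p g s a k d E F I eδ eε) (ha : a ≠ 0) (m n : ℤ) :
    ((d ^ m : Aˣ) : A) * E n = E n * ((d ^ m : Aˣ) : A) := zpow_comm (h.d_E ha n) m

theorem d_zpow_F (h : RootVecs p g s a k d E F I eδ eε) (ha : a ≠ 0) (m n : ℤ) :
    ((d ^ m : Aˣ) : A) * F n = F n * ((d ^ m : Aˣ) : A) := zpow_comm (h.d_F ha n) m

/-- Lowering a nonpositive index changes the prefactor of the current by a sign and a power of `d`;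
the factor `p` and the `d⁻¹` in `ω`, together with `C⁻¹ = d⁻²` on the side of `Y`, are exactly what
compensates this. -/
theorem drin (h : RootVecs p g s a k d E F I eδ eε) (hp : p = 1 ∨ p = -1) (hg : g ≠ 0)
    (h3 : 1 + p * g + (p * g)⁻¹ ≠ 0) (h2 : p * g + (p * g)⁻¹ ≠ 0) (ha : a ≠ 0)
    (has : a = p * s * (p * g - (p * g)⁻¹)) (n : ℤ) :
    Drin (p * g) (-p * s) ((d * d : Aˣ) : A) ↑(d * d)⁻¹ ((k * k * (d * d) ^ n : Aˣ) : A)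
      ↑(k * k * (d * d) ^ n)⁻¹
      (curX p k d E (n - 1)) (curX p k d E n) (curY p k d F (-n)) (curY p k d F (1 - n)) eδ
      (p • ((↑d⁻¹ : A) * eε)) := by
  have hpp : p * p = 1 := by rcases hp with rfl | rfl <;> simp
  have hp0 : p ≠ 0 := by rintro rfl; simp at hpp
  have z := h.drin_zero hp hg
  have dD : Commute d k := Units.ext h.dk
  refine drin_nat (mul_ne_zero hp0 hg) h3 h2 ha (by rw [has]; ring) z ?_ ?_ ?_ ?_ n
  · intro n
    have : (0 : ℤ) ≤ n + 1 := by omega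
    simp [curX, this, h.recE n]
  · intro n
    have e₁ : ¬ (0 : ℤ) ≤ -(n + 1) := by omega
    have e₂ : ¬ (0 : ℤ) ≤ -(n + 1) - 1 := by omega
    simp only [curX, e₁, e₂, if_false]
    have e := h.recE' n
    generalize -((n : ℤ) + 1) = m at e ⊢
    have u₁ : ((k * d ^ m : Aˣ) : A) * eε = eε * ((k * d ^ m : Aˣ) : A) := by
      rw [Units.val_mul, mul_assoc, zpow_comm h.d_eε, ← mul_assoc, h.k_eε hg, mul_assoc]
    have u₂ : ((k * d ^ (m - 1) : Aˣ) : A) = ↑d⁻¹ * ((k * d ^ m : Aˣ) : A) := by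
      rw [zpow_sub_one, ← mul_assoc, Units.val_mul]
      exact (inv_comm (by
        rw [Units.val_mul, ← mul_assoc, h.dk, mul_assoc, mul_assoc, zpow_comm rfl])).symm
    have u₃ := inv_comm (h.d_E ha m)
    have u₄ := inv_comm h.d_eε
    have e' := congrArg (fun u ↦ (-p ^ (m + 1) * p) • (↑d⁻¹ * (((k * d ^ m : Aˣ) : A) * u))) e
    have u₅ : (↑d⁻¹ : A) * ((k * d ^ m : Aˣ) : A) = ((k * d ^ m : Aˣ) : A) * ↑d⁻¹ := by
      rw [← u₂, zpow_sub_one, ← mul_assoc, Units.val_mul]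
    have hpz : p ^ (m - 1 + 1) = p ^ (m + 1) * p := by
      rw [sub_add_cancel, zpow_add_one₀ hp0, mul_assoc, hpp, mul_one]
    rw [u₂, hpz]
    simp only [mul_sub, smul_sub, mul_smul_comm, smul_mul_assoc, smul_smul, mul_assoc,
      ← comm_assoc u₃, ← comm_assoc u₁, comm_assoc u₅] at e' ⊢
    linear_combination (norm := module) e'
  · intro n
    have e₁ : (0 : ℤ) < n + 1 := by omega
    have e₂ : (0 : ℤ) < n + 1 + 1 := by omega
    simp [curY, e₁, e₂, h.recF n]
  · intro n
    have e₁ : ¬ (0 : ℤ) < -n := by omega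
    have e₂ : ¬ (0 : ℤ) < -n - 1 := by omega
    simp only [curY, e₁, e₂, if_false]
    have e := h.recF' n
    generalize -(n : ℤ) = m at e ⊢
    have u₁ : ((k * d ^ (-m) : Aˣ) : A) * eε = eε * ((k * d ^ (-m) : Aˣ) : A) := by
      rw [Units.val_mul, mul_assoc, zpow_comm h.d_eε, ← mul_assoc, h.k_eε hg, mul_assoc]
    have u₂ : ((k * d ^ (-(m - 1)) : Aˣ) : A) = ↑d * ((k * d ^ (-m) : Aˣ) : A) := by
      rw [neg_sub, sub_eq_neg_add, zpow_add_one, ← mul_assoc, Units.val_mul, Units.val_mul,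
        mul_assoc, zpow_comm rfl, ← mul_assoc, ← h.dk, mul_assoc]
    have u₃ := inv_comm (h.d_F ha (m - 1))
    have u₆ := inv_comm (h.d_F ha m)
    have e' := congrArg (fun u ↦ (-p ^ (m + 1) * p) • (↑d⁻¹ * (u * ((k * d ^ (-m) : Aˣ) : A)))) e
    have hpz : p ^ (m - 1 + 1) = p ^ (m + 1) * p := by
      rw [sub_add_cancel, zpow_add_one₀ hp0, mul_assoc, hpp, mul_one]
    have hdd : ((d * d : Aˣ)⁻¹ : Aˣ).val = (↑d⁻¹ : A) * ↑d⁻¹ := by simp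
    have u₇ : (↑d⁻¹ : A) * ((k * d ^ (-m) : Aˣ) : A) = ((k * d ^ (-m) : Aˣ) : A) * ↑d⁻¹ :=
      inv_comm (by rw [Units.val_mul, ← mul_assoc, h.dk, mul_assoc, mul_assoc, zpow_comm rfl])
    rw [u₂, hpz, hdd]
    simp only [sub_mul, mul_sub, smul_sub, mul_smul_comm, smul_mul_assoc, smul_smul, mul_assoc,
      comm_assoc u₃, u₁, Units.inv_mul_cancel_left, ← comm_assoc u₆, ← comm_assoc u₇] at e' ⊢
    linear_combination (norm := module) e'
end RootVecs
end Chevalley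
end AffineCW

namespace AffineCW
-- Removing the Cartan prefactors
section Relations
variable {K : Type*} [Field K] {A : Type*} [Ring A] [Algebra K A]
open Finset

/-- Root vectors together with the genericity of the parameters. -/
structure GenericRootVecs (p g s a : K) (k d : Aˣ) (E F I : ℤ → A) (eδ eε : A) : Prop where
  root : RootVecs p g s a k d E F I eδ eε
  hp : p = 1 ∨ p = -1
  hg : g ≠ 0
  hr : ∀ n : ℕ, 0 < n → (p * g) ^ n ≠ 1
  ha : a ≠ 0
  has : a = p * s * (p * g - (p * g)⁻¹)

namespace GenericRootVecs
variable {p g s a : K} {k d : Aˣ} {E F I : ℤ → A} {eδ eε : A}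

theorem hpp (h : GenericRootVecs p g s a k d E F I eδ eε) : p * p = 1 := by
  rcases h.hp with rfl | rfl <;> simp

theorem hp0 (h : GenericRootVecs p g s a k d E F I eδ eε) : p ≠ 0 := by
  have := h.hpp
  rintro rfl; simp at this

theorem hpi (h : GenericRootVecs p g s a k d E F I eδ eε) : p⁻¹ = p :=
  inv_eq_of_mul_eq_one_left h.hpp

theorem hQ (h : GenericRootVecs p g s a k d E F I eδ eε) : p * g ≠ 0 := mul_ne_zero h.hp0 h.hg

theorem zpow_mul_self (h : GenericRootVecs p g s a k d E F I eδ eε) (n : ℤ) : p ^ n * p ^ n = 1 := by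
  rw [← mul_zpow, h.hpp, one_zpow]

theorem zpow_inv (h : GenericRootVecs p g s a k d E F I eδ eε) (n : ℤ) : p ^ (-n) = p ^ n := by
  rw [zpow_neg]; exact inv_eq_of_mul_eq_one_left (h.zpow_mul_self n)

theorem zpow_sub_add (h : GenericRootVecs p g s a k d E F I eδ eε) (n : ℤ) :
    p ^ (n - 1) = p ^ (n + 1) := by
  rw [zpow_sub_one₀ h.hp0, zpow_add_one₀ h.hp0, h.hpi]

theorem drin (h : GenericRootVecs p g s a k d E F I eδ eε) (n : ℤ) :
    Drin (p * g) (-p * s) ((d * d : Aˣ) : A) ↑(d * d)⁻¹ ((k * k * (d * d) ^ n : Aˣ) : A)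
      ↑(k * k * (d * d) ^ n)⁻¹
      (curX p k d E (n - 1)) (curX p k d E n) (curY p k d F (-n)) (curY p k d F (1 - n)) eδ
      (p • ((↑d⁻¹ : A) * eε)) := by
  have hQ := h.hQ
  -- With `Q = p * g`, the equation `1 + Q + Q⁻¹ = 0` would give `Q ^ 3 = 1`, and `Q + Q⁻¹ = 0`
  -- would give `Q ^ 4 = 1`.
  refine h.root.drin h.hp h.hg (fun h3 ↦ h.hr 3 (by norm_num) ?_) (fun h2 ↦ h.hr 4 (by norm_num) ?_)
    h.ha h.has n
  · generalize p * g = Q at *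
    field_simp at h3
    linear_combination (Q - 1) * h3
  · generalize p * g = Q at *
    field_simp at h2
    linear_combination (Q ^ 2 - 1) * h2

theorem loop (h : GenericRootVecs p g s a k d E F I eδ eε) :
    Loop (p * g) a (curX p k d E) (curY p k d F) eδ :=
  loop_of_drin h.hQ (by rw [h.has]; ring) h.drin

theorem X_pos (n : ℤ) (hn : 0 ≤ n) : curX p k d E n = E n := by simp [curX, hn]

theorem Y_pos (n : ℤ) (hn : 0 < n) : curY p k d F n = F n := by simp [curY, hn]

theorem commute_dk (h : GenericRootVecs p g s a k d E F I eδ eε) : Commute d k :=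
  Units.ext h.root.dk

theorem unit_eq (h : GenericRootVecs p g s a k d E F I eδ eε) (n : ℤ) :
    (k⁻¹ * d ^ n)⁻¹ = k * d ^ (-n) := by
  rw [mul_inv_rev, inv_inv, zpow_neg, (h.commute_dk.zpow_left n).inv_left.eq]

theorem E_neg (h : GenericRootVecs p g s a k d E F I eδ eε) {n : ℤ} (hn : 0 < n) :
    E (-n) = (-p ^ (n - 1)) • (((k⁻¹ * d ^ n : Aˣ) : A) * curX p k d E (-n)) := by
  have : ¬ (0 : ℤ) ≤ -n := by omega
  simp only [curX, this, if_false, ← h.unit_eq]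
  rw [mul_smul_comm, Units.mul_inv_cancel_left, smul_smul, neg_mul_neg,
    show -n + 1 = -(n - 1) by ring, h.zpow_inv, h.zpow_mul_self, one_smul]

theorem F_neg (h : GenericRootVecs p g s a k d E F I eδ eε) {n : ℤ} (hn : 0 ≤ n) :
    F (-n) = (-p ^ (n + 1)) • (curY p k d F (-n) * ↑(k * d ^ n)⁻¹) := by
  have : ¬ (0 : ℤ) < -n := by omega
  simp only [curY, this, if_false, neg_neg]
  rw [smul_mul_assoc, Units.mul_inv_cancel_right, smul_smul, neg_mul_neg,
    show -n + 1 = -(n - 1) by ring, h.zpow_inv, h.zpow_sub_add, h.zpow_mul_self, one_smul]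

theorem weight_X (h : GenericRootVecs p g s a k d E F I eδ eε) (n : ℤ) :
    (k : A) * curX p k d E n = g • (curX p k d E n * k) := by
  unfold curX
  split_ifs
  · exact h.root.k_E h.ha h.hg n
  · have e : (k : A) * ((d ^ n : Aˣ) : A) = ((d ^ n : Aˣ) : A) * k :=
      (RootVecs.zpow_comm h.root.dk n).symm
    simp only [mul_smul_comm, Units.val_mul, mul_assoc, smul_mul_assoc]
    rw [comm_assoc e, h.root.k_E h.ha h.hg n, smul_comm, mul_smul_comm, mul_smul_comm]

theorem weight_Y (h : GenericRootVecs p g s a k d E F I eδ eε) (n : ℤ) :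
    curY p k d F n * (k : A) = g • (k * curY p k d F n) := by
  unfold curY
  split_ifs
  · exact h.root.k_F h.ha h.hg n
  · have e : ((d ^ (-n) : Aˣ) : A) * k = (k : A) * ((d ^ (-n) : Aˣ) : A) :=
      RootVecs.zpow_comm h.root.dk (-n)
    simp only [mul_smul_comm, Units.val_mul, mul_assoc, smul_mul_assoc]
    simp only [e, h.root.k_F h.ha h.hg n, qcomm_assoc (h.root.k_F h.ha h.hg n), smul_smul,
      mul_smul_comm]
    match_scalars; ring

theorem d_X (h : GenericRootVecs p g s a k d E F I eδ eε) (m n : ℤ) :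
    ((d ^ m : Aˣ) : A) * curX p k d E n = curX p k d E n * ((d ^ m : Aˣ) : A) := by
  refine RootVecs.zpow_comm ?_ m
  unfold curX
  split_ifs
  · exact h.root.d_E h.ha n
  · have e : (d : A) * ((d ^ n : Aˣ) : A) = ((d ^ n : Aˣ) : A) * d :=
      (RootVecs.zpow_comm rfl n).symm
    simp only [mul_smul_comm, Units.val_mul, mul_assoc, smul_mul_assoc, comm_assoc h.root.dk,
      comm_assoc e, h.root.d_E h.ha n]

theorem d_Y (h : GenericRootVecs p g s a k d E F I eδ eε) (m n : ℤ) :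
    ((d ^ m : Aˣ) : A) * curY p k d F n = curY p k d F n * ((d ^ m : Aˣ) : A) := by
  refine RootVecs.zpow_comm ?_ m
  unfold curY
  split_ifs
  · exact h.root.d_F h.ha n
  · have e : (d : A) * ((d ^ (-n) : Aˣ) : A) = ((d ^ (-n) : Aˣ) : A) * d :=
      (RootVecs.zpow_comm rfl (-n)).symm
    simp only [mul_smul_comm, Units.val_mul, mul_assoc, smul_mul_assoc, comm_assoc h.root.dk,
      e, comm_assoc (h.root.d_F h.ha n)]

theorem u_X (h : GenericRootVecs p g s a k d E F I eδ eε) (m n : ℤ) :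
    curX p k d E n * ((k⁻¹ * d ^ m : Aˣ) : A) = g • (((k⁻¹ * d ^ m : Aˣ) : A) * curX p k d E n) := by
  have e : curX p k d E n * (↑k⁻¹ : A) = g • ((↑k⁻¹ : A) * curX p k d E n) := by
    rw [Units.mul_inv_eq_iff_eq_mul, smul_mul_assoc, mul_assoc, ← mul_smul_comm, ← h.weight_X,
      Units.inv_mul_cancel_left]
  rw [Units.val_mul, ← mul_assoc, e, smul_mul_assoc, mul_assoc, ← h.d_X, mul_assoc]

theorem u_Y (h : GenericRootVecs p g s a k d E F I eδ eε) (m n : ℤ) :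
    ((k⁻¹ * d ^ m : Aˣ) : A) * curY p k d F n = g • (curY p k d F n * ((k⁻¹ * d ^ m : Aˣ) : A)) := by
  have e : (↑k⁻¹ : A) * curY p k d F n = g • (curY p k d F n * (↑k⁻¹ : A)) := by
    rw [Units.inv_mul_eq_iff_eq_mul, mul_smul_comm, ← mul_assoc, ← smul_mul_assoc, ← h.weight_Y,
      Units.mul_inv_cancel_right]
  rw [Units.val_mul, mul_assoc, h.d_Y, ← mul_assoc, e, smul_mul_assoc, mul_assoc]

theorem v_eq (h : GenericRootVecs p g s a k d E F I eδ eε) (n : ℤ) :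
    (k * d ^ n)⁻¹ = k⁻¹ * d ^ (-n) := by
  rw [← neg_neg n, ← h.unit_eq, inv_inv, neg_neg]

/-- Brackets of `e_{rδ+α}` and `e_{-nδ-α}`. -/
theorem EF_neg (h : GenericRootVecs p g s a k d E F I eδ eε) {n r : ℤ} (hn : 0 ≤ n) (hr : 0 ≤ r) :
    E r * F (-n) - p • (F (-n) * E r) =
      (-p ^ (n + 1)) • (mixed (p * g) (curX p k d E) (curY p k d F) r (-n) *
        ↑(k * d ^ n)⁻¹) := by
  have e := qcomm_swap h.hg (h.u_X (-n) r)
  have hg := h.hg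
  have hp0 := h.hp0
  rw [h.F_neg hn, ← X_pos (p := p) (k := k) (d := d) (E := E) r hr, mixed, h.v_eq]
  simp only [mul_smul_comm, smul_mul_assoc, mul_assoc, e, sub_mul, smul_smul, mul_inv, h.hpi]
  module

/-- Brackets of `e_{-nδ+α}` and `e_{rδ-α}`. -/
theorem E_neg_F (h : GenericRootVecs p g s a k d E F I eδ eε) {n r : ℤ} (hn : 0 < n) (hr : 0 < r) :
    E (-n) * F r - p • (F r * E (-n)) =
      (-p ^ (n - 1)) • (((k⁻¹ * d ^ n : Aˣ) : A) *
        mixed (p * g) (curX p k d E) (curY p k d F) (-n) r) := by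
  have e := qcomm_assoc (qcomm_swap h.hg (h.u_Y n r))
  rw [h.E_neg hn, ← Y_pos (p := p) (k := k) (d := d) (F := F) r hr, mixed]
  simp only [mul_smul_comm, smul_mul_assoc, mul_assoc, e, mul_sub, smul_smul, mul_inv, h.hpi]
  module

/-- Pulling the unit of `E (-n)` to the front past `E r` produces a factor `g`, so a supercommutator
of root vectors is a `q`-commutator of currents. `FF_neg` is the same on the other side. -/
theorem E_neg_E (h : GenericRootVecs p g s a k d E F I eδ eε) {n r : ℤ} (hn : 0 < n) (hr : 0 ≤ r) :
    E (-n) * E r - p • (E r * E (-n)) =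
      (-p ^ (n - 1)) • (((k⁻¹ * d ^ n : Aˣ) : A) * (curX p k d E (-n) * curX p k d E r -
        (p * g) • (curX p k d E r * curX p k d E (-n)))) := by
  have e := qcomm_assoc (h.u_X n r)
  rw [h.E_neg hn, ← X_pos (p := p) (k := k) (d := d) (E := E) r hr]
  simp only [mul_smul_comm, smul_mul_assoc, mul_assoc, e, mul_sub, smul_smul]
  module

theorem FF_neg (h : GenericRootVecs p g s a k d E F I eδ eε) {n r : ℤ} (hn : 0 ≤ n) (hr : 0 < r) :
    F r * F (-n) - p • (F (-n) * F r) =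
      (-p ^ (n + 1)) • ((curY p k d F r * curY p k d F (-n) -
        (p * g) • (curY p k d F (-n) * curY p k d F r)) * ↑(k * d ^ n)⁻¹) := by
  have e := h.u_Y (-n) r
  rw [h.F_neg hn, ← Y_pos (p := p) (k := k) (d := d) (F := F) r hr, h.v_eq]
  simp only [mul_smul_comm, smul_mul_assoc, mul_assoc, e, sub_mul, smul_smul]
  module

theorem imagVec_eq (h : GenericRootVecs p g s a k d E F I eδ eε) {m : ℤ} (hm : 0 < m) :
    imagVec (p * g) a (curX p k d E) (curY p k d F) m = I m := by
  rw [imagVec, if_neg hm.ne', mixed, X_pos 0 le_rfl, Y_pos m hm, h.root.imagPos m hm]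

theorem u_I (h : GenericRootVecs p g s a k d E F I eδ eε) {m : ℤ} (hm : 0 < m) (n : ℤ) :
    ((k⁻¹ * d ^ n : Aˣ) : A) * I m = I m * ((k⁻¹ * d ^ n : Aˣ) : A) := by
  have hg := h.hg
  rw [← h.imagVec_eq hm, imagVec, if_neg hm.ne', mixed]
  simp only [mul_sub, sub_mul, mul_smul_comm, smul_mul_assoc, mul_assoc, h.u_Y,
    qcomm_assoc (h.u_Y _ _), qcomm_swap h.hg (h.u_X _ _),
    qcomm_assoc (qcomm_swap h.hg (h.u_X _ _)), smul_smul]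
  match_scalars <;> field_simp

theorem E_neg_I (h : GenericRootVecs p g s a k d E F I eδ eε) {n m : ℤ} (hn : 0 < n) (hm : 0 < m) :
    E (-n) * I m - I m * E (-n) =
      (-p ^ (n - 1)) • (((k⁻¹ * d ^ n : Aˣ) : A) *
        (curX p k d E (-n) * I m - I m * curX p k d E (-n))) := by
  rw [h.E_neg hn, mul_smul_comm, smul_mul_assoc, ← smul_sub, mul_sub, mul_assoc,
    comm_assoc (h.u_I hm n)]

theorem I_F_neg (h : GenericRootVecs p g s a k d E F I eδ eε) {n m : ℤ} (hn : 0 ≤ n) (hm : 0 < m) :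
    I m * F (-n) - F (-n) * I m =
      (-p ^ (n + 1)) • ((I m * curY p k d F (-n) - curY p k d F (-n) * I m) *
        ↑(k * d ^ n)⁻¹) := by
  rw [h.F_neg hn, mul_smul_comm, smul_mul_assoc, ← smul_sub, sub_mul, mul_assoc, mul_assoc,
    mul_assoc, h.v_eq, h.u_I hm]

/-- The prefactors belonging to the indices `-n` and `-n + l` differ by `p ^ l` and `d ^ l`. This is
the origin of the sign and of the power of `k_δ` in the final sums. -/
theorem shift_X (h : GenericRootVecs p g s a k d E F I eδ eε) {n l : ℤ} (hl : l < n) :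
    (-p ^ (n - 1)) • (((k⁻¹ * d ^ n : Aˣ) : A) * curX p k d E (-n + l)) =
      p ^ l • (((d ^ l : Aˣ) : A) * E (-n + l)) := by
  have e := h.E_neg (n := n - l) (by omega)
  rw [neg_sub, sub_eq_neg_add l n] at e
  rw [e, mul_smul_comm, smul_smul, ← mul_assoc, ← Units.val_mul, mul_neg, ← zpow_add₀ h.hp0]
  congr 2
  · congr 2; ring
  · rw [← mul_assoc, ((h.commute_dk.zpow_left l).inv_right).eq, mul_assoc, ← zpow_add]
    congr 4; omega

theorem shift_Y (h : GenericRootVecs p g s a k d E F I eδ eε) {n l : ℤ} (hl : l ≤ n) :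
    (-p ^ (n + 1)) • (curY p k d F (-n + l) * (↑(k * d ^ n)⁻¹ : A)) =
      p ^ l • (F (-n + l) * ((d ^ (-l) : Aˣ) : A)) := by
  have e := h.F_neg (n := n - l) (by omega)
  rw [neg_sub, sub_eq_neg_add l n] at e
  rw [e, smul_mul_assoc, smul_smul, mul_assoc, ← Units.val_mul, mul_neg, ← zpow_add₀ h.hp0]
  congr 2
  · rw [show l + (n - l + 1) = n + 1 by ring]
  · rw [h.v_eq, h.v_eq, mul_assoc, ← zpow_add]
    congr 4; omega

end GenericRootVecs
end Relations
end AffineCW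

namespace AffineCW
-- Relations between root vectors
section Relations
variable {K : Type*} [Field K] {A : Type*} [Ring A] [Algebra K A]
open Finset
namespace GenericRootVecs
variable {p g s a : K} {k d : Aˣ} {E F I : ℤ → A} {eδ eε : A}

theorem mixed_level (h : GenericRootVecs p g s a k d E F I eδ eε) {r t : ℤ} (hrt : 0 < r + t) :
    mixed (p * g) (curX p k d E) (curY p k d F) r t = I (r + t) := by
  rw [h.loop.mixed_eq h.ha h.hQ h.hr hrt, h.imagVec_eq hrt]

theorem square_eq (h : GenericRootVecs p g s a k d E F I eδ eε) (n : ℤ) :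
    k * k * (d * d) ^ n = (k * d ^ n) * (k * d ^ n) := by
  rw [(h.commute_dk.zpow_left n).mul_mul_mul_comm, (Commute.refl d).mul_zpow]

theorem mixed_zero (h : GenericRootVecs p g s a k d E F I eδ eε) (n : ℤ) :
    mixed (p * g) (curX p k d E) (curY p k d F) n (-n) =
      (-p * s) • (((k * d ^ n : Aˣ) : A) * ((k * d ^ n : Aˣ) : A) - 1) := by
  rw [mixed, (h.drin n).c₀, ← Units.val_mul, h.square_eq]

theorem E_F_opp (h : GenericRootVecs p g s a k d E F I eδ eε) {n : ℤ} (hn : 0 ≤ n) :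
    E n * F (-n) - p • (F (-n) * E n) =
      (p ^ n * s) • (((k * d ^ n : Aˣ) : A) - ↑(k * d ^ n)⁻¹) := by
  rw [h.EF_neg hn hn, h.mixed_zero, smul_mul_assoc, sub_mul, one_mul, Units.mul_inv_cancel_right,
    smul_smul, zpow_add_one₀ h.hp0]
  congr 1
  linear_combination p ^ n * s * h.hpp

theorem F_E_opp (h : GenericRootVecs p g s a k d E F I eδ eε) {n : ℤ} (hn : 0 < n) :
    F n * E (-n) - p • (E (-n) * F n) =
      (p ^ (n - 1) * s) • (((k⁻¹ * d ^ n : Aˣ) : A) - ↑(k⁻¹ * d ^ n)⁻¹) := by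
  -- Since `p * p = 1`, exchanging the two arguments of the supercommutator multiplies it by `-p`.
  have e := congrArg (fun z ↦ (-p) • z) (h.E_neg_F hn hn)
  have e₂ := h.mixed_zero (-n)
  rw [neg_neg, ← h.unit_eq] at e₂
  rw [e₂, mul_smul_comm, mul_sub, Units.mul_inv_cancel_left, mul_one, smul_sub, smul_smul,
    smul_smul, smul_smul, neg_mul, h.hpp, neg_one_smul, neg_smul, sub_neg_eq_add,
    neg_add_eq_sub] at e
  have c : -p * -p ^ (n - 1) * (-p * s) = -(p ^ (n - 1) * s) := by
    linear_combination -(p ^ (n - 1) * s) * h.hpp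
  rw [e, c, neg_smul, ← smul_neg, neg_sub]

theorem E_E_odd [CharZero K] (h : GenericRootVecs p g s a k d E F I eδ eε) {n m : ℤ} (hn : 0 ≤ n)
    (hm : 0 < m) :
    E n * E (n + 2 * m - 1) - (p * g) • (E (n + 2 * m - 1) * E n) =
      ((p * g) ^ 2 - 1) • ∑ l ∈ Icc 1 (m - 1), (p * g) ^ (-l) •
        (E (n + l) * E (n + 2 * m - 1 - l)) := by
  have e := h.loop.xx_odd h.ha h.hQ hm n
  rw [X_pos _ hn, X_pos _ (by omega)] at e
  rw [e]
  congr 1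
  refine sum_congr rfl fun l hl ↦ ?_
  rw [mem_Icc] at hl
  rw [X_pos _ (by omega), X_pos _ (by omega)]

theorem E_E_even [CharZero K] (h : GenericRootVecs p g s a k d E F I eδ eε) {n m : ℤ} (hn : 0 ≤ n)
    (hm : 0 < m) :
    E n * E (n + 2 * m) - (p * g) • (E (n + 2 * m) * E n) =
      ((p * g - 1) * (p * g) ^ (-m + 1)) • E (n + m) ^ 2 +
      ((p * g) ^ 2 - 1) • ∑ l ∈ Icc 1 (m - 1), (p * g) ^ (-l) •
        (E (n + l) * E (n + 2 * m - l)) := by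
  have e := h.loop.xx_even h.ha h.hQ hm n
  rw [X_pos _ hn, X_pos _ (by omega), X_pos _ (by omega)] at e
  rw [e]
  congr 2
  refine sum_congr rfl fun l hl ↦ ?_
  rw [mem_Icc] at hl
  rw [X_pos _ (by omega), X_pos _ (by omega)]

theorem F_F_odd [CharZero K] (h : GenericRootVecs p g s a k d E F I eδ eε) {n m : ℤ} (hn : 0 < n)
    (hm : 0 < m) :
    F (n + 2 * m - 1) * F n - (p * g) • (F n * F (n + 2 * m - 1)) =
      ((p * g) ^ 2 - 1) • ∑ l ∈ Icc 1 (m - 1), (p * g) ^ (-l) •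
        (F (n + 2 * m - 1 - l) * F (n + l)) := by
  have e := h.loop.yy_odd h.ha h.hQ hm n
  rw [Y_pos _ hn, Y_pos _ (by omega)] at e
  rw [e]
  congr 1
  refine sum_congr rfl fun l hl ↦ ?_
  rw [mem_Icc] at hl
  rw [Y_pos _ (by omega), Y_pos _ (by omega)]

theorem F_F_even [CharZero K] (h : GenericRootVecs p g s a k d E F I eδ eε) {n m : ℤ} (hn : 0 < n)
    (hm : 0 < m) :
    F (n + 2 * m) * F n - (p * g) • (F n * F (n + 2 * m)) =
      ((p * g - 1) * (p * g) ^ (-m + 1)) • F (n + m) ^ 2 +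
      ((p * g) ^ 2 - 1) • ∑ l ∈ Icc 1 (m - 1), (p * g) ^ (-l) •
        (F (n + 2 * m - l) * F (n + l)) := by
  have e := h.loop.yy_even h.ha h.hQ hm n
  rw [Y_pos _ hn, Y_pos _ (by omega), Y_pos _ (by omega)] at e
  rw [e]
  congr 2
  refine sum_congr rfl fun l hl ↦ ?_
  rw [mem_Icc] at hl
  rw [Y_pos _ (by omega), Y_pos _ (by omega)]

theorem sum_X_low (h : GenericRootVecs p g s a k d E F I eδ eε) (c : ℤ → K) (w : ℤ → A) {n N : ℤ}
    (hN : N < n) :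
    (-p ^ (n - 1)) • (((k⁻¹ * d ^ n : Aˣ) : A) *
      ∑ l ∈ Icc 1 N, c l • (curX p k d E (-n + l) * w l)) =
    ∑ l ∈ Icc 1 N, (p ^ l * c l) • (((d ^ l : Aˣ) : A) * E (-n + l) * w l) := by
  rw [mul_sum, smul_sum]
  refine sum_congr rfl fun l hl ↦ ?_
  rw [mem_Icc] at hl
  rw [mul_smul_comm, smul_comm, ← mul_assoc, ← smul_mul_assoc, h.shift_X (by omega),
    smul_mul_assoc, smul_smul, mul_comm (c l)]

/-- For `l ≥ n` the current is itself a root vector and the whole prefactor stays outside; for `l <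
n` it carries a unit of its own, and only `d ^ l` is left. -/
theorem sum_X (h : GenericRootVecs p g s a k d E F I eδ eε) (c : ℤ → K) (w : ℤ → A) {n N : ℤ}
    (hn : 0 < n) (hN : n ≤ N + 1) :
    (-p ^ (n - 1)) • (((k⁻¹ * d ^ n : Aˣ) : A) *
      ∑ l ∈ Icc 1 N, c l • (curX p k d E (-n + l) * w l)) =
    (-p ^ (n - 1)) • ∑ l ∈ Icc n N, c l • (((k⁻¹ * d ^ n : Aˣ) : A) * E (l - n) * w l) +
    ∑ l ∈ Icc 1 (n - 1), (p ^ l * c l) • (((d ^ l : Aˣ) : A) * E (-n + l) * w l) := by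
  rw [sum_Icc_split _ (by omega) hN, mul_add, smul_add, h.sum_X_low c w (sub_one_lt n), add_comm]
  congr 2
  rw [mul_sum]
  refine sum_congr rfl fun l hl ↦ ?_
  rw [mem_Icc] at hl
  rw [mul_smul_comm, X_pos _ (by omega), mul_assoc, neg_add_eq_sub]

theorem sum_Y_low (h : GenericRootVecs p g s a k d E F I eδ eε) (c : ℤ → K) (w : ℤ → A) {n N : ℤ}
    (hN : N ≤ n) :
    (-p ^ (n + 1)) • ((∑ l ∈ Icc 1 N, c l • (w l * curY p k d F (-n + l))) *
      (↑(k * d ^ n)⁻¹ : A)) =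
    ∑ l ∈ Icc 1 N, (p ^ l * c l) • (w l * F (-n + l) * ((d ^ (-l) : Aˣ) : A)) := by
  rw [sum_mul, smul_sum]
  refine sum_congr rfl fun l hl ↦ ?_
  rw [mem_Icc] at hl
  rw [smul_mul_assoc, smul_comm, mul_assoc, ← mul_smul_comm, h.shift_Y (by omega),
    mul_smul_comm, smul_smul, mul_comm (c l), mul_assoc]

/-- The cut is at `n + 1`, not at `n` as in `sum_X`: `Y_0` comes from `e_{-α}` and still carries a
Cartan unit, while `X_0 = e_α` does not. -/
theorem sum_Y (h : GenericRootVecs p g s a k d E F I eδ eε) (c : ℤ → K) (w : ℤ → A) {n N : ℤ}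
    (hn : 0 ≤ n) (hN : n ≤ N) :
    (-p ^ (n + 1)) • ((∑ l ∈ Icc 1 N, c l • (w l * curY p k d F (-n + l))) *
      (↑(k * d ^ n)⁻¹ : A)) =
    (-p ^ (n + 1)) • ∑ l ∈ Icc (n + 1) N, c l • (w l * F (l - n) * (↑(k * d ^ n)⁻¹ : A)) +
    ∑ l ∈ Icc 1 n, (p ^ l * c l) • (w l * F (-n + l) * ((d ^ (-l) : Aˣ) : A)) := by
  rw [sum_Icc_split _ (show 1 ≤ n + 1 by omega) (by omega), add_mul, smul_add, add_sub_cancel_right,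
    h.sum_Y_low c w le_rfl, add_comm]
  congr 2
  rw [sum_mul]
  refine sum_congr rfl fun l hl ↦ ?_
  rw [mem_Icc] at hl
  rw [smul_mul_assoc, Y_pos _ (by omega), neg_add_eq_sub]

theorem E_neg_E_odd [CharZero K] (h : GenericRootVecs p g s a k d E F I eδ eε) {n m : ℤ}
    (hn : 0 < n) (hm : 0 < m) :
    E (-n) * E (n + 2 * m - 1) - p • (E (n + 2 * m - 1) * E (-n)) =
      -(p ^ (n - 1) * ((p * g) ^ 2 - 1)) • ∑ l ∈ Icc n (n + m - 1), (p * g) ^ (-l) •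
        (((k⁻¹ * d ^ n : Aˣ) : A) * E (l - n) * E (n + 2 * m - 1 - l)) +
      ((p * g) ^ 2 - 1) • ∑ l ∈ Icc 1 (n - 1), (p ^ l * (p * g) ^ (-l)) •
        (((d ^ l : Aˣ) : A) * E (-n + l) * E (n + 2 * m - 1 - l)) := by
  -- Between `-n` and `n + 2m - 1` the gap is `2(n + m) - 1`, so `n + m` replaces `m`; the second
  -- factor in every term still has a nonnegative index.
  have e := h.loop.xx_odd h.ha h.hQ (m := n + m) (by omega) (-n)
  rw [show -n + 2 * (n + m) - 1 = n + 2 * m - 1 by ring] at e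
  have e₁ : ∀ l ∈ Icc 1 (n + m - 1), (p * g) ^ (-l) •
      (curX p k d E (-n + l) * curX p k d E (n + 2 * m - 1 - l)) =
      (p * g) ^ (-l) • (curX p k d E (-n + l) * E (n + 2 * m - 1 - l)) := fun l hl ↦ by
    rw [mem_Icc] at hl
    rw [X_pos (n + 2 * m - 1 - l) (by omega)]
  rw [h.E_neg_E hn (by omega), e, sum_congr rfl e₁, mul_smul_comm, smul_comm,
    h.sum_X _ (fun l ↦ E (n + 2 * m - 1 - l)) hn (by omega)]
  module

theorem E_neg_E_even [CharZero K] (h : GenericRootVecs p g s a k d E F I eδ eε) {n m : ℤ}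
    (hn : 0 < n) (hm : 0 < m) :
    E (-n) * E (n + 2 * m) - p • (E (n + 2 * m) * E (-n)) =
      -(p ^ (n - 1) * ((p * g) ^ 2 - 1)) • ∑ l ∈ Icc n (n + m - 1), (p * g) ^ (-l) •
        (((k⁻¹ * d ^ n : Aˣ) : A) * E (l - n) * E (n + 2 * m - l)) +
      ((p * g) ^ 2 - 1) • ∑ l ∈ Icc 1 (n - 1), (p ^ l * (p * g) ^ (-l)) •
        (((d ^ l : Aˣ) : A) * E (-n + l) * E (n + 2 * m - l)) -
      (p ^ (n - 1) * (p * g - 1) * (p * g) ^ (-m - n + 1)) •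
        (((k⁻¹ * d ^ n : Aˣ) : A) * E m ^ 2) := by
  have e := h.loop.xx_even h.ha h.hQ (m := n + m) (by omega) (-n)
  rw [show -n + 2 * (n + m) = n + 2 * m by ring, neg_add_cancel_left, X_pos m (by omega),
    show -(n + m) + 1 = -m - n + 1 by ring] at e
  have e₁ : ∀ l ∈ Icc 1 (n + m - 1), (p * g) ^ (-l) •
      (curX p k d E (-n + l) * curX p k d E (n + 2 * m - l)) =
      (p * g) ^ (-l) • (curX p k d E (-n + l) * E (n + 2 * m - l)) := fun l hl ↦ by
    rw [mem_Icc] at hl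
    rw [X_pos (n + 2 * m - l) (by omega)]
  rw [h.E_neg_E hn (by omega), e, sum_congr rfl e₁, mul_add, smul_add, mul_smul_comm,
    mul_smul_comm, smul_comm _ ((p * g) ^ 2 - 1),
    h.sum_X _ (fun l ↦ E (n + 2 * m - l)) hn (by omega)]
  module

theorem F_F_neg_odd [CharZero K] (h : GenericRootVecs p g s a k d E F I eδ eε) {n m : ℤ}
    (hn : 0 ≤ n) (hm : 0 < m) :
    F (n + 2 * m - 1) * F (-n) - p • (F (-n) * F (n + 2 * m - 1)) =
      -(p ^ (n + 1) * ((p * g) ^ 2 - 1)) • ∑ l ∈ Icc (n + 1) (n + m - 1), (p * g) ^ (-l) •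
        (F (n + 2 * m - 1 - l) * F (l - n) * (↑(k * d ^ n)⁻¹ : A)) +
      ((p * g) ^ 2 - 1) • ∑ l ∈ Icc 1 n, (p ^ l * (p * g) ^ (-l)) •
        (F (n + 2 * m - 1 - l) * F (-n + l) * ((d ^ (-l) : Aˣ) : A)) := by
  have e := h.loop.yy_odd h.ha h.hQ (m := n + m) (by omega) (-n)
  rw [show -n + 2 * (n + m) - 1 = n + 2 * m - 1 by ring] at e
  have e₁ : ∀ l ∈ Icc 1 (n + m - 1), (p * g) ^ (-l) •
      (curY p k d F (n + 2 * m - 1 - l) * curY p k d F (-n + l)) =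
      (p * g) ^ (-l) • (F (n + 2 * m - 1 - l) * curY p k d F (-n + l)) := fun l hl ↦ by
    rw [mem_Icc] at hl
    rw [Y_pos _ (by omega)]
  rw [h.FF_neg hn (by omega), e, sum_congr rfl e₁, smul_mul_assoc, smul_comm,
    h.sum_Y _ (fun l ↦ F (n + 2 * m - 1 - l)) hn (by omega)]
  module

theorem F_F_neg_even [CharZero K] (h : GenericRootVecs p g s a k d E F I eδ eε) {n m : ℤ}
    (hn : 0 ≤ n) (hm : 0 < m) :
    F (n + 2 * m) * F (-n) - p • (F (-n) * F (n + 2 * m)) =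
      -(p ^ (n + 1) * ((p * g) ^ 2 - 1)) • ∑ l ∈ Icc (n + 1) (n + m - 1), (p * g) ^ (-l) •
        (F (n + 2 * m - l) * F (l - n) * (↑(k * d ^ n)⁻¹ : A)) +
      ((p * g) ^ 2 - 1) • ∑ l ∈ Icc 1 n, (p ^ l * (p * g) ^ (-l)) •
        (F (n + 2 * m - l) * F (-n + l) * ((d ^ (-l) : Aˣ) : A)) -
      (p ^ (n + 1) * (p * g - 1) * (p * g) ^ (-m - n + 1)) •
        (F m ^ 2 * (↑(k * d ^ n)⁻¹ : A)) := by
  have e := h.loop.yy_even h.ha h.hQ (m := n + m) (by omega) (-n)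
  rw [show -n + 2 * (n + m) = n + 2 * m by ring, neg_add_cancel_left, Y_pos m (by omega),
    show -(n + m) + 1 = -m - n + 1 by ring] at e
  have e₁ : ∀ l ∈ Icc 1 (n + m - 1), (p * g) ^ (-l) •
      (curY p k d F (n + 2 * m - l) * curY p k d F (-n + l)) =
      (p * g) ^ (-l) • (F (n + 2 * m - l) * curY p k d F (-n + l)) := fun l hl ↦ by
    rw [mem_Icc] at hl
    rw [Y_pos _ (by omega)]
  rw [h.FF_neg hn (by omega), e, sum_congr rfl e₁, add_mul, smul_add, smul_mul_assoc,
    smul_mul_assoc, smul_comm _ ((p * g) ^ 2 - 1),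
    h.sum_Y _ (fun l ↦ F (n + 2 * m - l)) hn (by omega)]
  module

theorem E_F_pos (h : GenericRootVecs p g s a k d E F I eδ eε) {n m : ℤ} (hn : 0 ≤ n) (hm : 0 < m) :
    E n * F m - (p * g)⁻¹ • (F m * E n) = I (n + m) := by
  rw [← h.mixed_level (by omega), mixed, X_pos n hn, Y_pos m hm]

theorem E_F_imag (h : GenericRootVecs p g s a k d E F I eδ eε) {n m : ℤ} (hm : 0 ≤ m)
    (hmn : m < n) :
    E n * F (-m) - p • (F (-m) * E n) = (-p ^ (m + 1)) • (I (n - m) * ↑(k * d ^ m)⁻¹) := by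
  rw [h.EF_neg hm (by omega), h.mixed_level (by omega), ← sub_eq_add_neg]

theorem E_neg_F_imag (h : GenericRootVecs p g s a k d E F I eδ eε) {n m : ℤ} (hm : 0 < m)
    (hmn : m < n) :
    E (-m) * F n - p • (F n * E (-m)) =
      (-p ^ (m - 1)) • (((k⁻¹ * d ^ m : Aˣ) : A) * I (n - m)) := by
  rw [h.E_neg_F hm (by omega), h.mixed_level (by omega), neg_add_eq_sub]

theorem I_comm (h : GenericRootVecs p g s a k d E F I eδ eε) {n m : ℤ} (hn : 0 < n) (hm : 0 < m) :
    I n * I m = I m * I n := by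
  rw [← h.imagVec_eq hn, ← h.imagVec_eq hm, h.loop.imag_comm h.ha h.hQ h.hr hn hm]

theorem E_I (h : GenericRootVecs p g s a k d E F I eδ eε) {n m : ℤ} (hn : 0 ≤ n) (hm : 0 < m) :
    E n * I m - I m * E n = ((p * g) ^ (-m + 1) * a) • E (n + m) +
      ((p * g) ^ 2 - 1) • ∑ l ∈ Icc 1 (m - 1), (p * g) ^ (-l) • (E (n + l) * I (m - l)) := by
  have e := h.loop.x_imag_sum h.ha h.hQ h.hr hm n
  rw [X_pos _ hn, X_pos _ (by omega), h.imagVec_eq hm] at e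
  rw [e]
  congr 2
  refine sum_congr rfl fun l hl ↦ ?_
  rw [mem_Icc] at hl
  rw [X_pos _ (by omega), h.imagVec_eq (by omega)]

theorem I_F (h : GenericRootVecs p g s a k d E F I eδ eε) {n m : ℤ} (hn : 0 < n) (hm : 0 < m) :
    I m * F n - F n * I m = ((p * g) ^ (-m + 1) * a) • F (n + m) +
      ((p * g) ^ 2 - 1) • ∑ l ∈ Icc 1 (m - 1), (p * g) ^ (-l) • (I (m - l) * F (n + l)) := by
  have e := h.loop.imag_y_sum h.ha h.hQ h.hr hm n
  rw [Y_pos _ hn, Y_pos _ (by omega), h.imagVec_eq hm] at e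
  rw [e]
  congr 2
  refine sum_congr rfl fun l hl ↦ ?_
  rw [mem_Icc] at hl
  rw [Y_pos _ (by omega), h.imagVec_eq (by omega)]

theorem X_imag_sum (h : GenericRootVecs p g s a k d E F I eδ eε) {m : ℤ} (hm : 0 < m) (n : ℤ) :
    curX p k d E n * I m - I m * curX p k d E n =
      ((p * g) ^ (-m + 1) * a) • curX p k d E (n + m) +
      ((p * g) ^ 2 - 1) • ∑ l ∈ Icc 1 (m - 1), (p * g) ^ (-l) •
        (curX p k d E (n + l) * I (m - l)) := by
  have e := h.loop.x_imag_sum h.ha h.hQ h.hr hm n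
  rw [h.imagVec_eq hm] at e
  rw [e]
  congr 2
  refine sum_congr rfl fun l hl ↦ ?_
  rw [mem_Icc] at hl
  rw [h.imagVec_eq (by omega)]

theorem imag_Y_sum (h : GenericRootVecs p g s a k d E F I eδ eε) {m : ℤ} (hm : 0 < m) (n : ℤ) :
    I m * curY p k d F n - curY p k d F n * I m =
      ((p * g) ^ (-m + 1) * a) • curY p k d F (n + m) +
      ((p * g) ^ 2 - 1) • ∑ l ∈ Icc 1 (m - 1), (p * g) ^ (-l) •
        (I (m - l) * curY p k d F (n + l)) := by
  have e := h.loop.imag_y_sum h.ha h.hQ h.hr hm n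
  rw [h.imagVec_eq hm] at e
  rw [e]
  congr 2
  refine sum_congr rfl fun l hl ↦ ?_
  rw [mem_Icc] at hl
  rw [h.imagVec_eq (by omega)]

theorem E_neg_I_high (h : GenericRootVecs p g s a k d E F I eδ eε) {n m : ℤ} (hn : 0 < n)
    (hnm : n ≤ m) :
    E (-n) * I m - I m * E (-n) =
      -(p ^ (n - 1) * (p * g) ^ (-m + 1) * a) • (((k⁻¹ * d ^ n : Aˣ) : A) * E (m - n)) -
      (p ^ (n - 1) * ((p * g) ^ 2 - 1)) • (((k⁻¹ * d ^ n : Aˣ) : A) *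
        ∑ l ∈ Icc n (m - 1), (p * g) ^ (-l) • (E (l - n) * I (m - l))) +
      ((p * g) ^ 2 - 1) • ∑ l ∈ Icc 1 (n - 1), (p ^ l * (p * g) ^ (-l)) •
        (((d ^ l : Aˣ) : A) * E (-n + l) * I (m - l)) := by
  rw [h.E_neg_I hn (by omega), h.X_imag_sum (by omega), mul_add, smul_add, mul_smul_comm,
    mul_smul_comm, smul_comm _ ((p * g) ^ 2 - 1), h.sum_X _ (fun l ↦ I (m - l)) hn (by omega),
    X_pos _ (by omega), mul_sum, neg_add_eq_sub n m]
  simp only [mul_smul_comm, mul_assoc]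
  module

theorem E_neg_I_low (h : GenericRootVecs p g s a k d E F I eδ eε) {n m : ℤ} (hm : 0 < m)
    (hmn : m < n) :
    E (-n) * I m - I m * E (-n) =
      (p ^ m * (p * g) ^ (-m + 1) * a) • (((d ^ m : Aˣ) : A) * E (-n + m)) +
      ((p * g) ^ 2 - 1) • ∑ l ∈ Icc 1 (m - 1), (p ^ l * (p * g) ^ (-l)) •
        (((d ^ l : Aˣ) : A) * E (-n + l) * I (m - l)) := by
  rw [h.E_neg_I (by omega) hm, h.X_imag_sum hm, mul_add, smul_add, mul_smul_comm,
    mul_smul_comm, smul_comm _ ((p * g) ^ 2 - 1), h.sum_X_low _ (fun l ↦ I (m - l)) (by omega),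
    smul_comm, h.shift_X hmn]
  module

theorem I_F_neg_high (h : GenericRootVecs p g s a k d E F I eδ eε) {n m : ℤ} (hn : 0 ≤ n)
    (hnm : n < m) :
    I m * F (-n) - F (-n) * I m =
      -(p ^ (n + 1) * (p * g) ^ (-m + 1) * a) • (F (m - n) * (↑(k * d ^ n)⁻¹ : A)) -
      (p ^ (n + 1) * ((p * g) ^ 2 - 1)) • ∑ l ∈ Icc (n + 1) (m - 1), (p * g) ^ (-l) •
        (I (m - l) * F (l - n) * (↑(k * d ^ n)⁻¹ : A)) +
      ((p * g) ^ 2 - 1) • ∑ l ∈ Icc 1 n, (p ^ l * (p * g) ^ (-l)) •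
        (I (m - l) * F (-n + l) * ((d ^ (-l) : Aˣ) : A)) := by
  rw [h.I_F_neg hn (by omega), h.imag_Y_sum (by omega), add_mul, smul_add, smul_mul_assoc,
    smul_mul_assoc, smul_comm _ ((p * g) ^ 2 - 1), h.sum_Y _ (fun l ↦ I (m - l)) hn (by omega),
    Y_pos _ (by omega), neg_add_eq_sub n m]
  module

theorem I_F_neg_low (h : GenericRootVecs p g s a k d E F I eδ eε) {n m : ℤ} (hm : 0 < m)
    (hmn : m ≤ n) :
    I m * F (-n) - F (-n) * I m =
      (p ^ m * (p * g) ^ (-m + 1) * a) • (F (-n + m) * ((d ^ (-m) : Aˣ) : A)) +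
      ((p * g) ^ 2 - 1) • ∑ l ∈ Icc 1 (m - 1), (p ^ l * (p * g) ^ (-l)) •
        (I (m - l) * F (-n + l) * ((d ^ (-l) : Aˣ) : A)) := by
  rw [h.I_F_neg (by omega) hm, h.imag_Y_sum hm, add_mul, smul_add, smul_mul_assoc,
    smul_mul_assoc, smul_comm _ ((p * g) ^ 2 - 1), h.sum_Y_low _ (fun l ↦ I (m - l)) (by omega),
    smul_comm, h.shift_Y hmn]
  module

end GenericRootVecs
end Relations
end AffineCW

namespace AffineCW
-- Commutativity of the negative imaginary vectors
section Relations
variable {K : Type*} [Field K] {A : Type*} [Ring A] [Algebra K A]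
open Finset

theorem weight_bracket {u x y : A} {c c' : K} (t : K) (hx : u * x = c • (x * u))
    (hy : u * y = c' • (y * u)) :
    u * (x * y - t • (y * x)) = (c * c') • ((x * y - t • (y * x)) * u) := by
  simp only [mul_sub, sub_mul, mul_smul_comm, smul_mul_assoc, mul_assoc, hx, hy, qcomm_assoc hx,
    qcomm_assoc hy, smul_smul, smul_sub]
  match_scalars <;> ring

namespace GenericRootVecs
variable {p g s a : K} {k d : Aˣ} {E F I : ℤ → A} {eδ eε : A}

/-- The imaginary vectors of the dual `Loop` are nonzero scalars times `d ^ n * I (-n)`, so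
commutativity there transfers to `I (-n)`. -/
theorem dual_imag (h : GenericRootVecs p g s a k d E F I eδ eε) {n : ℤ} (hn : 0 < n) :
    curX p k d E (-n) * (↑(k * k * (d * d) ^ (-n))⁻¹ : A) * curY p k d F 0 -
      (p * g) • (curY p k d F 0 * (curX p k d E (-n) * (↑(k * k * (d * d) ^ (-n))⁻¹ : A))) =
    (p ^ n * g ^ 2) • (((d ^ n : Aˣ) : A) * I (-n)) := by
  have eF := h.F_neg (n := 0) le_rfl
  have hk : (k * d ^ (0 : ℤ))⁻¹ = (k⁻¹ * d ^ n) * d ^ (-n) := by simp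
  rw [hk, neg_zero, zero_add, zpow_one] at eF
  rw [h.square_eq, mul_inv_rev, ← h.unit_eq, inv_inv, ← h.root.imagNeg n hn, h.E_neg hn, eF]
  have e₁ := h.u_X n (-n)
  have e₂ := qcomm_swap h.hg (h.u_Y n 0)
  have e₃ : ((k⁻¹ * d ^ n : Aˣ) : A) * ((d ^ (-n) : Aˣ) : A) =
      ((d ^ (-n) : Aˣ) : A) * ((k⁻¹ * d ^ n : Aˣ) : A) := by
    rw [← Units.val_mul, ← Units.val_mul]
    exact congrArg _ (((h.commute_dk.zpow_left _).inv_right).mul_right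
      ((Commute.refl d).zpow_zpow _ _)).symm.eq
  have e₄ := (h.d_X (-n) (-n)).symm
  have e₅ := (h.d_Y (-n) 0).symm
  have e₆ : ∀ z : A, ((d ^ n : Aˣ) : A) * (((d ^ (-n) : Aˣ) : A) * z) = z := fun z ↦ by
    rw [← mul_assoc, ← Units.val_mul, ← zpow_add, add_neg_cancel]; simp
  have hg := h.hg
  rw [Units.val_mul (k⁻¹ * d ^ n) (d ^ (-n)), Units.val_mul (k⁻¹ * d ^ n) (k⁻¹ * d ^ n),
    zpow_sub_one₀ h.hp0, h.hpi]
  have hpn := h.zpow_mul_self n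
  have hpp := h.hpp
  generalize ((k⁻¹ * d ^ n : Aˣ) : A) = w at *
  generalize ((d ^ (-n) : Aˣ) : A) = D at *
  generalize curX p k d E (-n) = x at *
  generalize curY p k d F 0 = y at *
  generalize p ^ n = r at *
  simp only [mul_assoc, mul_smul_comm, smul_mul_assoc, e₁, e₂, e₃, e₄, e₅, e₆, qcomm_assoc e₁,
    qcomm_assoc e₂, comm_assoc e₃, comm_assoc e₄, comm_assoc e₅, mul_sub, smul_sub, smul_smul]
  have hp0 := h.hp0
  match_scalars
  · field_simp
    linear_combination -hpn - r * r * hpp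
  · field_simp
    linear_combination hpp + p * p * hpn

theorem I_neg_comm (h : GenericRootVecs p g s a k d E F I eδ eε) {n m : ℤ} (hn : 0 < n)
    (hm : 0 < m) : I (-n) * I (-m) = I (-m) * I (-n) := by
  have hQ := h.hQ
  have L := dual_loop_of_drin (a := a) hQ (by rw [h.has]; ring) h.drin
  have e := L.imag_comm (mul_ne_zero (mul_ne_zero hQ hQ) h.ha) (inv_ne_zero hQ)
    (fun n hn ↦ by rw [inv_pow, ne_eq, inv_eq_one]; exact h.hr n hn) hn hm
  have ev : ∀ j : ℤ, 0 < j → imagVec (p * g)⁻¹ (p * g * (p * g) * a)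
      (fun n ↦ MulOpposite.op (curY p k d F (-n)))
      (fun n ↦ MulOpposite.op (curX p k d E (-n) * (↑(k * k * (d * d) ^ (-n))⁻¹ : A))) j =
      MulOpposite.op ((p ^ j * g ^ 2) • (((d ^ j : Aˣ) : A) * I (-j))) := fun j hj ↦ by
    rw [imagVec, if_neg hj.ne', mixed, inv_inv, neg_zero, ← h.dual_imag hj]
    rfl
  rw [ev n hn, ev m hm, ← MulOpposite.op_mul, ← MulOpposite.op_mul] at e
  have e := MulOpposite.op_injective e
  have hd : ∀ i j : ℤ, 0 < j → ((d ^ i : Aˣ) : A) * I (-j) = I (-j) * ((d ^ i : Aˣ) : A) := by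
    intro i j hj
    rw [← h.root.imagNeg j hj]
    have := weight_bracket (c := 1) (c' := 1) (p * g)
      ((h.root.d_zpow_E h.ha i (-j)).trans (one_smul K _).symm)
      ((h.root.d_zpow_F h.ha i 0).trans (one_smul K _).symm)
    rwa [mul_one, one_smul] at this
  have hc := mul_ne_zero (mul_ne_zero (zpow_ne_zero n h.hp0) (pow_ne_zero 2 h.hg))
    (mul_ne_zero (zpow_ne_zero m h.hp0) (pow_ne_zero 2 h.hg))
  simp only [smul_mul_assoc, mul_smul_comm, smul_smul, mul_assoc] at e
  rw [show p ^ m * (g ^ 2 * (p ^ n * g ^ 2)) = p ^ n * (g ^ 2 * (p ^ m * g ^ 2)) by ring] at e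
  have e := smul_cancel (by rwa [← mul_assoc]) e
  have hdd : ((d ^ m : Aˣ) : A) * ((d ^ n : Aˣ) : A) = ((d ^ n : Aˣ) : A) * ((d ^ m : Aˣ) : A) := by
    rw [← Units.val_mul, ← Units.val_mul, ((Commute.refl d).zpow_zpow m n).eq]
  -- The powers of `d` commute with everything here; collected on the left, they cancel as units.
  rw [← comm_assoc (hd n m hm), ← comm_assoc (hd m n hn), comm_assoc hdd] at e
  exact ((Units.mul_right_inj _).1 ((Units.mul_right_inj _).1 e)).symm

end GenericRootVecs
end Relations
end AffineCW

namespace AffineCW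
-- Weights under the Cartan elements
section Weights
variable {K : Type*} [Field K] {A : Type*} [Ring A] [Algebra K A]
variable {p g s a : K} {k d : Aˣ} {E F I : ℤ → A} {eδ eε : A}

theorem weight_of_bracket {u x y z : A} {c c' a : K} (t : K) (ha : a ≠ 0)
    (hx : u * x = c • (x * u)) (hy : u * y = c' • (y * u)) (h : x * y - t • (y * x) = a • z) :
    u * z = (c * c') • (z * u) := by
  apply smul_cancel ha
  rw [smul_comm, ← mul_smul_comm, ← smul_mul_assoc a, ← h, weight_bracket t hx hy]

theorem zpow_weight {u : Aˣ} {z : A} {c : K} (hc : c ≠ 0) (h : (u : A) * z = c • (z * u)) (n : ℤ) :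
    ((u ^ n : Aˣ) : A) * z = c ^ n • (z * ((u ^ n : Aˣ) : A)) := by
  have hi : (↑u⁻¹ : A) * z = c⁻¹ • (z * ↑u⁻¹) := by
    rw [Units.inv_mul_eq_iff_eq_mul, mul_smul_comm, ← mul_assoc, h, smul_mul_assoc,
      Units.mul_inv_cancel_right, smul_smul, inv_mul_cancel₀ hc, one_smul]
  induction n using Int.induction_on with
  | zero => simp
  | succ n ih =>
    rw [zpow_add_one, Units.val_mul, mul_assoc, h, mul_smul_comm, ← mul_assoc, ih, smul_mul_assoc,
      mul_assoc, smul_smul, zpow_add_one₀ hc, mul_comm c]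
  | pred n ih =>
    rw [zpow_sub_one, Units.val_mul, mul_assoc, hi, mul_smul_comm, ← mul_assoc, ih, smul_mul_assoc,
      mul_assoc, smul_smul, zpow_sub_one₀ hc, mul_comm c⁻¹]

theorem conj_of_weight {u : Aˣ} {z : A} {c : K} (h : (u : A) * z = c • (z * u)) :
    (u : A) * z * ↑u⁻¹ = c • z := by
  rw [h, smul_mul_assoc, Units.mul_inv_cancel_right]

namespace RootVecs

/-- Unlike in `weight_E`, here `eδ` and `eε` have weights `t` and `t⁻¹`, so every step of the
recursion changes the exponent by one. The intended `u` is `k_d`. -/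
theorem degree_E (h : RootVecs p g s a k d E F I eδ eε) (ha : a ≠ 0) {u : A} {t : K} (ht : t ≠ 0)
    (hE : u * E 0 = E 0 * u) (hE' : u * E (-1) = t⁻¹ • (E (-1) * u))
    (hδ : u * eδ = t • (eδ * u)) (hε : u * eε = t⁻¹ • (eε * u)) (n : ℤ) :
    u * E n = t ^ n • (E n * u) := by
  obtain ⟨n, rfl | rfl⟩ : ∃ m : ℕ, n = m ∨ n = -(m + 1) := by
    rcases le_or_gt 0 n with hn | hn
    · exact ⟨n.toNat, by omega⟩
    · exact ⟨(-n - 1).toNat, by omega⟩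
  · induction n with
    | zero => simpa using hE
    | succ n ih =>
      push_cast
      rw [zpow_add_one₀ ht]
      exact weight_of_bracket 1 ha ih hδ (by rw [one_smul]; exact h.recE n)
  · induction n with
    | zero => simpa using hE'
    | succ n ih =>
      have := weight_of_bracket 1 ha ih hε (by rw [one_smul]; exact h.recE' n)
      rw [← zpow_sub_one₀ ht, ← neg_add'] at this
      exact_mod_cast this

theorem degree_F (h : RootVecs p g s a k d E F I eδ eε) (ha : a ≠ 0) {u : A} {t : K} (ht : t ≠ 0)
    (hF : u * F 0 = F 0 * u) (hF' : u * F 1 = t • (F 1 * u))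
    (hδ : u * eδ = t • (eδ * u)) (hε : u * eε = t⁻¹ • (eε * u)) (n : ℤ) :
    u * F n = t ^ n • (F n * u) := by
  obtain ⟨n, rfl | rfl⟩ : ∃ m : ℕ, n = m + 1 ∨ n = -m := by
    rcases le_or_gt n 0 with hn | hn
    · exact ⟨(-n).toNat, by omega⟩
    · exact ⟨(n - 1).toNat, by omega⟩
  · induction n with
    | zero => simpa using hF'
    | succ n ih =>
      push_cast
      rw [zpow_add_one₀ ht, mul_comm]
      exact weight_of_bracket 1 ha hδ ih (by rw [one_smul]; exact h.recF n)
  · induction n with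
    | zero => simpa using hF
    | succ n ih =>
      have := weight_of_bracket 1 ha hε ih (by rw [one_smul]; exact h.recF' n)
      rw [mul_comm, ← zpow_sub_one₀ ht, ← neg_add'] at this
      exact_mod_cast this

/-- Weights of the vectors `e'_{nδ}` from those of the vectors `e_{nδ±α}`. -/
theorem weight_I (h : RootVecs p g s a k d E F I eδ eε) {u : A} {c t : K} (hc : c ≠ 0)
    (hE : ∀ n, u * E n = (c * t ^ n) • (E n * u)) (hF : ∀ n, u * F n = (c⁻¹ * t ^ n) • (F n * u))
    {n : ℤ} (hn : n ≠ 0) : u * I n = t ^ n • (I n * u) := by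
  rcases lt_or_gt_of_ne hn with hn | hn
  · obtain ⟨m, rfl⟩ : ∃ m, n = -m := ⟨-n, by ring⟩
    rw [← h.imagNeg m (by omega), weight_bracket _ (hE _) (hF _)]
    congr 1
    rw [zpow_zero]; field_simp
  · rw [← h.imagPos n hn, weight_bracket _ (hE _) (hF _)]
    congr 1
    rw [zpow_zero]; field_simp

theorem weight_root_E (h : RootVecs p g s a k d E F I eδ eε) (ha : a ≠ 0) (hg : g ≠ 0)
    (i j n : ℤ) :
    ((k ^ i * d ^ j : Aˣ) : A) * E n = g ^ i • (E n * ((k ^ i * d ^ j : Aˣ) : A)) := by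
  rw [Units.val_mul, mul_assoc, h.d_zpow_E ha, ← mul_assoc, zpow_weight hg (h.k_E ha hg n),
    smul_mul_assoc, mul_assoc]

theorem weight_root_F (h : RootVecs p g s a k d E F I eδ eε) (ha : a ≠ 0) (hg : g ≠ 0)
    (i j n : ℤ) :
    ((k ^ i * d ^ j : Aˣ) : A) * F n = (g ^ i)⁻¹ • (F n * ((k ^ i * d ^ j : Aˣ) : A)) := by
  rw [Units.val_mul, mul_assoc, h.d_zpow_F ha, ← mul_assoc,
    zpow_weight (inv_ne_zero hg) (qcomm_swap hg (h.k_F ha hg n)), smul_mul_assoc, mul_assoc,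
    inv_zpow]

theorem weight_root_I (h : RootVecs p g s a k d E F I eδ eε) (ha : a ≠ 0) (hg : g ≠ 0)
    (i j : ℤ) {n : ℤ} (hn : n ≠ 0) :
    ((k ^ i * d ^ j : Aˣ) : A) * I n = I n * ((k ^ i * d ^ j : Aˣ) : A) := by
  have := h.weight_I (t := 1) (zpow_ne_zero i hg)
    (fun n ↦ by rw [one_zpow, mul_one]; exact h.weight_root_E ha hg i j n)
    (fun n ↦ by rw [one_zpow, mul_one]; exact h.weight_root_F ha hg i j n) hn
  rwa [one_zpow, one_smul] at this

end RootVecs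
end Weights

/-! ### Supercommutators with the parity sign evaluated -/

section Brackets
variable {K : Type*} [Field K] {A : Type*} [Ring A] [Algebra K A]

/-- The sign exponent is `θ(α)²`, which equals `θ(α)` because `θ(α)` is `0` or `1`. -/
theorem sComm_odd (K : Type*) [Field K] {A : Type*} [Ring A] [Algebra K A] (c : AffType) {β β' : Wt}
    (hβ : β.1.natAbs % 2 = 1) (hβ' : β'.1.natAbs % 2 = 1) (x y : A) :
    sComm c β β' x y = x * y - ((-1 : K) ^ c.theta) • (y * x) := by
  cases c <;> simp [sComm, parity, AffType.theta, hβ, hβ']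

theorem sComm_even_left (c : AffType) {β β' : Wt} (hβ : β.1.natAbs % 2 = 0) (x y : A) :
    sComm c β β' x y = x * y - y * x := by
  simp [sComm, parity, hβ]

theorem sComm_even_right (c : AffType) {β β' : Wt} (hβ' : β'.1.natAbs % 2 = 0) (x y : A) :
    sComm c β β' x y = x * y - y * x := by
  simp [sComm, parity, hβ']

theorem qComm_odd (c : AffType) {t : K} {β β' : Wt} {f : ℤ}
    (hβ : β.1.natAbs % 2 = 1) (hβ' : β'.1.natAbs % 2 = 1) (hf : form β β' = f) (x y : A) :
    qComm c t β β' x y = x * y - ((-1 : K) ^ c.theta * t ^ f) • (y * x) := by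
  subst hf
  cases c <;> simp [qComm, parity, AffType.theta, hβ, hβ']

theorem qComm_zero_left (c : AffType) {t : K} {β β' : Wt} (hβ : β.1 = 0) (x y : A) :
    qComm c t β β' x y = x * y - y * x := by
  simp [qComm, parity, form, hβ]

theorem qComm_zero_right (c : AffType) {t : K} {β β' : Wt} (hβ' : β'.1 = 0) (x y : A) :
    qComm c t β β' x y = x * y - y * x := by
  simp [qComm, parity, form, hβ']

theorem map_sComm {B : Type*} [Ring B] [Algebra K B] (f : A →ₐ[K] B) (c : AffType) (β β' : Wt)
    (x y : A) : f (sComm c β β' x y) = sComm c β β' (f x) (f y) := by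
  simp [sComm]

theorem map_qComm {B : Type*} [Ring B] [Algebra K B] (f : A →ₐ[K] B) (c : AffType) (t : K)
    (β β' : Wt) (x y : A) : f (qComm c t β β' x y) = qComm c t β β' (f x) (f y) := by
  simp [qComm]

end Brackets

/-! ### Consequences of the defining relations -/

section Presentation
variable {K : Type*} [Field K] (c : AffType) (q : K)

theorem kGen_commute (γ γ' : CartanIdx) : Commute (kGen c q γ) (kGen c q γ') := by
  have h := RingQuot.mkAlgHom_rel K (Rel.k_comm (c := c) (q := q) γ γ')
  rw [map_mul, map_mul] at h
  exact Units.ext h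

theorem kGen_gen (γ : CartanIdx) (b : Bool) (i : Node) :
    (kGen c q γ : Uq c q) * gen c q (if b then Gen.ePos i else Gen.eNeg i) =
      q ^ γ.pair (sWt b i) • (gen c q (if b then Gen.ePos i else Gen.eNeg i) * kGen c q γ) := by
  have h := RingQuot.mkAlgHom_rel K (Rel.k_e (c := c) (q := q) γ b i)
  rw [map_mul, map_mul, map_smul] at h
  rw [← smul_mul_assoc, ← Units.mul_inv_eq_iff_eq_mul]
  exact h

theorem kGen_ePos (γ : CartanIdx) (i : Node) : (kGen c q γ : Uq c q) * gen c q (.ePos i) =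
    q ^ γ.pair i.wt • (gen c q (.ePos i) * kGen c q γ) := kGen_gen c q γ true i

theorem kGen_eNeg (γ : CartanIdx) (i : Node) : (kGen c q γ : Uq c q) * gen c q (.eNeg i) =
    q ^ γ.pair (-i.wt) • (gen c q (.eNeg i) * kGen c q γ) := kGen_gen c q γ false i

theorem kRoot_eq (β : Wt) : kRoot c q β =
    kGen c q (.node .al) ^ β.1 * (kGen c q (.node .al) * kGen c q (.node .de)) ^ β.2 := by
  rw [kRoot, (kGen_commute c q _ _).mul_zpow, zpow_add, mul_assoc]

theorem kRoot_plus (n : ℤ) : kRoot c q (1, n) =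
    kGen c q (.node .al) * (kGen c q (.node .al) * kGen c q (.node .de)) ^ n := by
  rw [kRoot_eq, zpow_one]

theorem kRoot_minus (n : ℤ) : kRoot c q (-1, n) =
    (kGen c q (.node .al))⁻¹ * (kGen c q (.node .al) * kGen c q (.node .de)) ^ n := by
  rw [kRoot_eq, zpow_neg_one]

theorem kRoot_delta : kRoot c q (0, 1) = kGen c q (.node .al) * kGen c q (.node .de) := by
  rw [kRoot_eq, zpow_zero, one_mul, zpow_one]

theorem qAl_eq : qAl c q = (-1) ^ c.theta * q ^ (2 : ℤ) := rfl

theorem sgn_eq (K : Type*) [Field K] (c : AffType) (n : ℤ) :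
    sgn K c n = ((-1) ^ c.theta) ^ n := by
  rw [sgn, mul_comm, zpow_mul, zpow_natCast]

theorem sign_or (K : Type*) [Field K] (c : AffType) :
    (-1 : K) ^ c.theta = 1 ∨ (-1 : K) ^ c.theta = -1 := neg_one_pow_eq_or K _

theorem sign_mul_self (K : Type*) [Field K] (c : AffType) :
    (-1 : K) ^ c.theta * (-1) ^ c.theta = 1 := by
  rw [← mul_pow]; simp

theorem qAl_inv : ((-1 : K) ^ c.theta * q ^ (2 : ℤ))⁻¹ = (-1) ^ c.theta * q ^ (-2 : ℤ) := by
  rw [mul_inv, zpow_neg, inv_eq_of_mul_eq_one_left (sign_mul_self K c)]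

theorem eDelta_eq : eDelta c q = gen c q (.ePos .al) * gen c q (.ePos .de) -
    ((-1 : K) ^ c.theta * q ^ (2 : ℤ))⁻¹ • (gen c q (.ePos .de) * gen c q (.ePos .al)) := by
  rw [eDelta, qComm_odd c rfl rfl rfl, qAl_inv]; rfl

theorem inv_zpow_neg_two : q⁻¹ ^ (-2 : ℤ) = q ^ (2 : ℤ) := by
  rw [inv_zpow, zpow_neg, inv_inv]

theorem eNegDelta_eq : eNegDelta c q = gen c q (.eNeg .de) * gen c q (.eNeg .al) -
    ((-1 : K) ^ c.theta * q ^ (2 : ℤ)) • (gen c q (.eNeg .al) * gen c q (.eNeg .de)) := by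
  rw [eNegDelta, qComm_odd c rfl rfl (f := -2) rfl, inv_zpow_neg_two]

theorem serre_al_pos :
    gen c q (.ePos .al) * (gen c q (.ePos .al) * eDelta c q - eDelta c q * gen c q (.ePos .al)) =
    ((-1 : K) ^ c.theta * q ^ (2 : ℤ)) •
      ((gen c q (.ePos .al) * eDelta c q - eDelta c q * gen c q (.ePos .al)) *
        gen c q (.ePos .al)) := by
  have h := RingQuot.mkAlgHom_rel K (Rel.serre_al (c := c) (q := q) true)
  rw [map_qComm, map_qComm, map_qComm, map_zero, qComm_odd c rfl rfl (f := 2) rfl,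
    qComm_zero_right c rfl, sub_eq_zero] at h
  exact h

theorem serre_de_pos :
    (eDelta c q * gen c q (.ePos .de) - gen c q (.ePos .de) * eDelta c q) * gen c q (.ePos .de) =
    ((-1 : K) ^ c.theta * q ^ (2 : ℤ)) • (gen c q (.ePos .de) *
      (eDelta c q * gen c q (.ePos .de) - gen c q (.ePos .de) * eDelta c q)) := by
  have h := RingQuot.mkAlgHom_rel K (Rel.serre_de (c := c) (q := q) true)
  rw [map_qComm, map_qComm, map_qComm, map_zero, qComm_odd c rfl rfl (f := 2) rfl,
    qComm_zero_left c rfl, sub_eq_zero] at h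
  exact h

variable {q}

/-- The negative Serre relations are stated with the bracket in this order, while `e_{-δ}` uses the
reverse order and `q⁻¹`. The two differ by a nonzero scalar, which cancels from the Serre relations.
-/
theorem qComm_neg (hq : q ≠ 0) :
    qComm c q (-1, 0) (1, -1) (gen c q (.eNeg .al)) (gen c q (.eNeg .de)) =
      (-((-1 : K) ^ c.theta * q ^ (2 : ℤ))⁻¹) • eNegDelta c q := by
  have hQ : (-1 : K) ^ c.theta * q ^ (2 : ℤ) ≠ 0 :=
    mul_ne_zero (by simp) (zpow_ne_zero _ hq)
  rw [qComm_odd c rfl rfl (f := -2) rfl, ← qAl_inv, eNegDelta_eq, smul_sub, smul_smul, neg_mul,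
    inv_mul_cancel₀ hQ]
  module

theorem serre_al_neg (hq : q ≠ 0) :
    gen c q (.eNeg .al) *
      (eNegDelta c q * gen c q (.eNeg .al) - gen c q (.eNeg .al) * eNegDelta c q) =
    ((-1 : K) ^ c.theta * q ^ (2 : ℤ)) •
      ((eNegDelta c q * gen c q (.eNeg .al) - gen c q (.eNeg .al) * eNegDelta c q) *
        gen c q (.eNeg .al)) := by
  have h := RingQuot.mkAlgHom_rel K (Rel.serre_al (c := c) (q := q) false)
  rw [map_qComm, map_qComm, map_qComm, map_zero, qComm_odd c rfl rfl (f := 2) rfl,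
    qComm_zero_right c rfl, sub_eq_zero] at h
  have hx : RingQuot.mkAlgHom K (Rel c q) (chev K false .al) = gen c q (.eNeg .al) := rfl
  have hy : RingQuot.mkAlgHom K (Rel c q) (chev K false .de) = gen c q (.eNeg .de) := rfl
  have e : qComm c q (sWt false .al) (sWt false .de) (gen c q (.eNeg .al)) (gen c q (.eNeg .de)) =
    _ := qComm_neg c hq
  have hQ : ((-1 : K) ^ c.theta * q ^ (2 : ℤ))⁻¹ ≠ 0 :=
    inv_ne_zero (mul_ne_zero (by simp) (zpow_ne_zero _ hq))
  rw [hx, hy, e] at h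
  apply smul_cancel hQ
  generalize (-1 : K) ^ c.theta * q ^ (2 : ℤ) = Q at *
  linear_combination (norm := skip) h
  simp only [mul_sub, sub_mul, mul_smul_comm, smul_mul_assoc, smul_sub, mul_assoc]
  module

theorem serre_de_neg (hq : q ≠ 0) :
    (gen c q (.eNeg .de) * eNegDelta c q - eNegDelta c q * gen c q (.eNeg .de)) *
      gen c q (.eNeg .de) =
    ((-1 : K) ^ c.theta * q ^ (2 : ℤ)) • (gen c q (.eNeg .de) *
      (gen c q (.eNeg .de) * eNegDelta c q - eNegDelta c q * gen c q (.eNeg .de))) := by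
  have h := RingQuot.mkAlgHom_rel K (Rel.serre_de (c := c) (q := q) false)
  rw [map_qComm, map_qComm, map_qComm, map_zero, qComm_odd c rfl rfl (f := 2) rfl,
    qComm_zero_left c rfl, sub_eq_zero] at h
  have hx : RingQuot.mkAlgHom K (Rel c q) (chev K false .al) = gen c q (.eNeg .al) := rfl
  have hy : RingQuot.mkAlgHom K (Rel c q) (chev K false .de) = gen c q (.eNeg .de) := rfl
  have e : qComm c q (sWt false .al) (sWt false .de) (gen c q (.eNeg .al)) (gen c q (.eNeg .de)) =
    _ := qComm_neg c hq
  have hQ : ((-1 : K) ^ c.theta * q ^ (2 : ℤ))⁻¹ ≠ 0 :=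
    inv_ne_zero (mul_ne_zero (by simp) (zpow_ne_zero _ hq))
  rw [hx, hy, e] at h
  apply smul_cancel hQ
  generalize (-1 : K) ^ c.theta * q ^ (2 : ℤ) = Q at *
  linear_combination (norm := skip) h
  simp only [mul_sub, sub_mul, mul_smul_comm, smul_mul_assoc, smul_sub, mul_assoc]
  module

theorem aCoef_ne_zero (hq0 : q ≠ 0) (hq : ∀ n : ℕ, 0 < n → q ^ n ≠ 1) : aCoef q ≠ 0 := by
  have e : aCoef q = (q ^ (2 : ℤ) - q ^ (-2 : ℤ)) / (q - q⁻¹) := rfl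
  rw [e]
  refine div_ne_zero (fun h ↦ hq 4 (by norm_num) ?_) (fun h ↦ hq 2 (by norm_num) ?_)
  · rw [zpow_neg] at h
    have : q ^ (2 : ℤ) = q ^ 2 := zpow_ofNat q 2
    rw [this] at h
    field_simp at h
    linear_combination h
  · field_simp at h
    linear_combination h

theorem aCoef_eq : aCoef q = (-1 : K) ^ c.theta * (q - q⁻¹)⁻¹ *
    ((-1) ^ c.theta * q ^ (2 : ℤ) - ((-1) ^ c.theta * q ^ (2 : ℤ))⁻¹) := by
  have e : aCoef q = (q ^ (2 : ℤ) - q ^ (-2 : ℤ)) / (q - q⁻¹) := rfl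
  rw [e, qAl_inv]
  linear_combination (-(q - q⁻¹)⁻¹ * (q ^ (2 : ℤ) - q ^ (-2 : ℤ))) * sign_mul_self K c

theorem qAl_pow_ne_one (hq : ∀ n : ℕ, 0 < n → q ^ n ≠ 1) (n : ℕ) (hn : 0 < n) :
    ((-1 : K) ^ c.theta * q ^ (2 : ℤ)) ^ n ≠ 1 := fun h ↦ by
  refine hq (4 * n) (by omega) ?_
  -- Squaring removes the sign, so `Q ^ n = 1` would give `q ^ (4 * n) = 1`.
  have h2 := congrArg (· ^ 2) h
  have : q ^ (2 : ℤ) = q ^ 2 := zpow_ofNat q 2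
  simp only [one_pow, ← pow_mul, mul_comm n 2, this] at h2
  rw [pow_mul, mul_pow, sq, sign_mul_self, one_mul, ← pow_mul, ← pow_mul] at h2
  rw [← h2]
  congr 1; ring

end Presentation
end AffineCW

namespace AffineCW
-- The root vectors of the quantum algebra
section RootVectors
variable {K : Type*} [Field K] (c : AffType) {q : K}

theorem e_plus_succ (n : ℕ) : e c q (.plus (n + 1)) = (aCoef q)⁻¹ •
    (e c q (.plus n) * eDelta c q - eDelta c q * e c q (.plus n)) := by
  rw [← sComm_even_right c (β := (1, (n : ℤ))) (β' := (0, 1)) rfl]; rfl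

theorem e_minus_succ (n : ℕ) : e c q (.minus (n + 1 + 1)) = (aCoef q)⁻¹ •
    (eDelta c q * e c q (.minus (n + 1)) - e c q (.minus (n + 1)) * eDelta c q) := by
  rw [← sComm_even_left c (β := (0, 1)) (β' := (-1, (n : ℤ) + 1)) rfl]; rfl

theorem e_plus_pred (n : ℕ) : e c q (.plus (-(n + 1) - 1)) = (aCoef q)⁻¹ •
    (e c q (.plus (-(n + 1))) * eNegDelta c q - eNegDelta c q * e c q (.plus (-(n + 1)))) := by
  rw [← sComm_even_right c (β := (1, -((n : ℤ) + 1))) (β' := (0, -1)) rfl]; rfl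

theorem e_minus_pred (n : ℕ) : e c q (.minus (-n - 1)) = (aCoef q)⁻¹ •
    (eNegDelta c q * e c q (.minus (-n)) - e c q (.minus (-n)) * eNegDelta c q) := by
  rw [← sComm_even_left c (β := (0, -1)) (β' := (-1, -(n : ℤ))) rfl]
  -- For `n = 0` the label `-n` falls under `.ofNat 0`, otherwise under `.negSucc`; the definition
  -- of `e` unfolds differently in the two cases.
  cases n <;> rfl

theorem e_imag_pos {n : ℤ} (hn : 0 < n) : e c q (.plus 0) * e c q (.minus n) -
    ((-1 : K) ^ c.theta * q ^ (2 : ℤ))⁻¹ • (e c q (.minus n) * e c q (.plus 0)) =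
      e c q (.imag n) := by
  obtain ⟨m, rfl⟩ : ∃ m : ℕ, n = m + 1 := ⟨(n - 1).toNat, by omega⟩
  rw [qAl_inv, ← qComm_odd c (β := (1, 0)) (β' := (-1, (m : ℤ) + 1)) (f := -2) rfl rfl rfl]; rfl

theorem e_imag_neg {n : ℤ} (hn : 0 < n) : e c q (.plus (-n)) * e c q (.minus 0) -
    ((-1 : K) ^ c.theta * q ^ (2 : ℤ)) • (e c q (.minus 0) * e c q (.plus (-n))) =
      e c q (.imag (-n)) := by
  obtain ⟨m, rfl⟩ : ∃ m : ℕ, n = m + 1 := ⟨(n - 1).toNat, by omega⟩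
  rw [← inv_zpow_neg_two,
    ← qComm_odd c (β := (1, -((m : ℤ) + 1))) (β' := (-1, 0)) (f := -2) rfl rfl rfl]; rfl

theorem rootVecs (hq0 : q ≠ 0) (ha : aCoef q ≠ 0) :
    RootVecs ((-1) ^ c.theta) (q ^ (2 : ℤ)) (q - q⁻¹)⁻¹ (aCoef q) (kGen c q (.node .al))
      (kGen c q (.node .al) * kGen c q (.node .de)) (fun n ↦ e c q (.plus n))
      (fun n ↦ e c q (.minus n)) (fun n ↦ e c q (.imag n)) (eDelta c q) (eNegDelta c q) := by
  have hkk : (kGen c q (.node .de) : Uq c q) * kGen c q (.node .al) =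
      kGen c q (.node .al) * kGen c q (.node .de) := congrArg Units.val (kGen_commute c q _ _).eq
  have x₁ : (kGen c q (.node .al) : Uq c q) * gen c q (.ePos .al) = _ := kGen_ePos c q _ _
  have x₂ : (kGen c q (.node .al) : Uq c q) * gen c q (.ePos .de) = _ := kGen_ePos c q _ _
  have x₃ : (kGen c q (.node .al) : Uq c q) * gen c q (.eNeg .al) = _ := kGen_eNeg c q _ _
  have x₄ : (kGen c q (.node .al) : Uq c q) * gen c q (.eNeg .de) = _ := kGen_eNeg c q _ _
  have y₁ : (kGen c q (.node .de) : Uq c q) * gen c q (.ePos .al) = _ := kGen_ePos c q _ _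
  have y₂ : (kGen c q (.node .de) : Uq c q) * gen c q (.ePos .de) = _ := kGen_ePos c q _ _
  have y₃ : (kGen c q (.node .de) : Uq c q) * gen c q (.eNeg .al) = _ := kGen_eNeg c q _ _
  have y₄ : (kGen c q (.node .de) : Uq c q) * gen c q (.eNeg .de) = _ := kGen_eNeg c q _ _
  simp only [CartanIdx.pair, form, Node.wt, Prod.fst_neg, mul_one, one_mul, mul_neg, neg_mul,
    neg_neg] at x₁ x₂ x₃ x₄ y₁ y₂ y₃ y₄
  have hqq : q ^ (2 : ℤ) * q ^ (-2 : ℤ) = 1 := by rw [← zpow_add₀ hq0]; norm_num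
  have hqq' : q ^ (-2 : ℤ) * q ^ (2 : ℤ) = 1 := by rw [← zpow_add₀ hq0]; norm_num
  have e_E : e c q (.plus 0) = gen c q (.ePos .al) := rfl
  have e_E' : e c q (.plus (-1)) = gen c q (.eNeg .de) := rfl
  have e_F : e c q (.minus 0) = gen c q (.eNeg .al) := rfl
  have e_F' : e c q (.minus 1) = gen c q (.ePos .de) := rfl
  constructor
  all_goals try rw [e_E]
  all_goals try rw [e_E']
  all_goals try rw [e_F]
  all_goals try rw [e_F']
  · rw [Units.val_mul, mul_assoc, hkk]
  · rw [Units.val_mul, mul_assoc, y₁, mul_smul_comm, ← mul_assoc, x₁, smul_mul_assoc, smul_smul,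
      hqq', one_smul, mul_assoc]
  · rw [Units.val_mul, mul_assoc, y₄, mul_smul_comm, ← mul_assoc, x₄, smul_mul_assoc, smul_smul,
      hqq', one_smul, mul_assoc]
  · rw [Units.val_mul, mul_assoc, y₃, mul_smul_comm, ← mul_assoc, x₃, smul_mul_assoc, smul_smul,
      hqq, one_smul, mul_assoc]
  · rw [Units.val_mul, mul_assoc, y₂, mul_smul_comm, ← mul_assoc, x₂, smul_mul_assoc, smul_smul,
      hqq, one_smul, mul_assoc]
  · exact x₁
  · exact x₄
  · rw [x₃, smul_smul, hqq, one_smul]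
  · rw [x₂, smul_smul, hqq, one_smul]
  · have h := RingQuot.mkAlgHom_rel K (Rel.al_negde (c := c) (q := q))
    rw [map_sComm, map_zero, sComm_odd K c rfl rfl, sub_eq_zero] at h
    exact h
  · have h := RingQuot.mkAlgHom_rel K (Rel.negal_de (c := c) (q := q))
    rw [map_sComm, map_zero, sComm_odd K c rfl rfl, sub_eq_zero] at h
    exact h
  · have h := RingQuot.mkAlgHom_rel K (Rel.e_neg (c := c) (q := q) .al)
    rw [map_sComm, map_smul, map_sub, sComm_odd K c rfl rfl] at h
    exact h
  · have h := RingQuot.mkAlgHom_rel K (Rel.e_neg (c := c) (q := q) .de)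
    rw [map_sComm, map_smul, map_sub, sComm_odd K c rfl rfl] at h
    -- With `d = k_δ`, the product `k⁻¹ * d` is `k_{δ-α}`, and `k * d⁻¹` is its inverse.
    rw [← Units.val_mul, ← Units.val_mul, inv_mul_cancel_left, mul_inv_rev,
      (kGen_commute c q (.node .de) (.node .al)).inv_inv.eq, mul_inv_cancel_left]
    exact h
  · exact (eDelta_eq c q).symm
  · exact (eNegDelta_eq c q).symm
  · exact serre_al_pos c q
  · exact serre_de_pos c q
  · exact serre_de_neg c hq0
  · exact serre_al_neg c hq0
  · intro n; rw [e_plus_succ, smul_inv_smul₀ ha]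
  · intro n; rw [e_minus_succ, smul_inv_smul₀ ha]
  · intro n; rw [e_plus_pred, smul_inv_smul₀ ha]
  · intro n; rw [e_minus_pred, smul_inv_smul₀ ha]
  · intro n hn; exact e_imag_pos c hn
  · intro n hn; exact e_imag_neg c hn

theorem genericRootVecs (hq0 : q ≠ 0) (hq : ∀ n : ℕ, 0 < n → q ^ n ≠ 1) :
    GenericRootVecs ((-1) ^ c.theta) (q ^ (2 : ℤ)) (q - q⁻¹)⁻¹ (aCoef q) (kGen c q (.node .al))
      (kGen c q (.node .al) * kGen c q (.node .de)) (fun n ↦ e c q (.plus n))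
      (fun n ↦ e c q (.minus n)) (fun n ↦ e c q (.imag n)) (eDelta c q) (eNegDelta c q) where
  root := rootVecs c hq0 (aCoef_ne_zero hq0 hq)
  hp := sign_or K c
  hg := zpow_ne_zero _ hq0
  hr := qAl_pow_ne_one c hq
  ha := aCoef_ne_zero hq0 hq
  has := aCoef_eq c

theorem kd_plus (hq0 : q ≠ 0) (ha : aCoef q ≠ 0) (n : ℤ) :
    (kGen c q .d : Uq c q) * e c q (.plus n) = q ^ n • (e c q (.plus n) * kGen c q .d) ∧
    (kGen c q .d : Uq c q) * e c q (.minus n) = q ^ n • (e c q (.minus n) * kGen c q .d) := by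
  have x₁ : (kGen c q .d : Uq c q) * gen c q (.ePos .al) = _ := kGen_ePos c q _ _
  have x₂ : (kGen c q .d : Uq c q) * gen c q (.ePos .de) = _ := kGen_ePos c q _ _
  have x₃ : (kGen c q .d : Uq c q) * gen c q (.eNeg .al) = _ := kGen_eNeg c q _ _
  have x₄ : (kGen c q .d : Uq c q) * gen c q (.eNeg .de) = _ := kGen_eNeg c q _ _
  simp only [CartanIdx.pair, form, Node.wt, Prod.snd_neg, neg_zero, zpow_zero, one_smul, zpow_one,
    zpow_neg_one] at x₁ x₂ x₃ x₄
  have h := rootVecs c hq0 ha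
  have hδ : (kGen c q .d : Uq c q) * eDelta c q = q • (eDelta c q * kGen c q .d) := by
    have := weight_bracket (((-1 : K) ^ c.theta * q ^ (2 : ℤ))⁻¹) (x₁.trans (one_smul K _).symm) x₂
    rwa [← eDelta_eq, one_mul] at this
  have hε : (kGen c q .d : Uq c q) * eNegDelta c q = q⁻¹ • (eNegDelta c q * kGen c q .d) := by
    have := weight_bracket ((-1 : K) ^ c.theta * q ^ (2 : ℤ)) x₄ (x₃.trans (one_smul K _).symm)
    rwa [← eNegDelta_eq, mul_one] at this
  exact ⟨h.degree_E ha hq0 x₁ x₄ hδ hε n, h.degree_F ha hq0 x₃ x₂ hδ hε n⟩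

theorem kd_imag (hq0 : q ≠ 0) (ha : aCoef q ≠ 0) {n : ℤ} (hn : n ≠ 0) :
    (kGen c q .d : Uq c q) * e c q (.imag n) = q ^ n • (e c q (.imag n) * kGen c q .d) :=
  (rootVecs c hq0 ha).weight_I (c := 1) one_ne_zero
    (fun n ↦ by rw [one_mul]; exact (kd_plus c hq0 ha n).1)
    (fun n ↦ by rw [inv_one, one_mul]; exact (kd_plus c hq0 ha n).2) hn

variable (q)

theorem br_plus_plus (n m : ℤ) : br c q (.plus n) (.plus m) =
    e c q (.plus n) * e c q (.plus m) -
      ((-1 : K) ^ c.theta) • (e c q (.plus m) * e c q (.plus n)) :=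
  sComm_odd K c rfl rfl _ _

theorem br_plus_minus (n m : ℤ) : br c q (.plus n) (.minus m) =
    e c q (.plus n) * e c q (.minus m) -
      ((-1 : K) ^ c.theta) • (e c q (.minus m) * e c q (.plus n)) :=
  sComm_odd K c rfl rfl _ _

theorem br_minus_plus (n m : ℤ) : br c q (.minus n) (.plus m) =
    e c q (.minus n) * e c q (.plus m) -
      ((-1 : K) ^ c.theta) • (e c q (.plus m) * e c q (.minus n)) :=
  sComm_odd K c rfl rfl _ _

theorem br_minus_minus (n m : ℤ) : br c q (.minus n) (.minus m) =
    e c q (.minus n) * e c q (.minus m) -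
      ((-1 : K) ^ c.theta) • (e c q (.minus m) * e c q (.minus n)) :=
  sComm_odd K c rfl rfl _ _

theorem br_imag_left (n : ℤ) (r : RootLabel) : br c q (.imag n) r =
    e c q (.imag n) * e c q r - e c q r * e c q (.imag n) :=
  sComm_even_left c rfl _ _

theorem br_imag_right (n : ℤ) (r : RootLabel) : br c q r (.imag n) =
    e c q r * e c q (.imag n) - e c q (.imag n) * e c q r :=
  sComm_even_right c rfl _ _

theorem brq_plus_plus (n m : ℤ) : brq c q (.plus n) (.plus m) =
    e c q (.plus n) * e c q (.plus m) -
      ((-1 : K) ^ c.theta * q ^ (2 : ℤ)) • (e c q (.plus m) * e c q (.plus n)) :=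
  qComm_odd c rfl rfl rfl _ _

theorem brq_minus_minus (n m : ℤ) : brq c q (.minus n) (.minus m) =
    e c q (.minus n) * e c q (.minus m) -
      ((-1 : K) ^ c.theta * q ^ (2 : ℤ)) • (e c q (.minus m) * e c q (.minus n)) :=
  qComm_odd c rfl rfl rfl _ _

theorem brq_plus_minus (n m : ℤ) : brq c q (.plus n) (.minus m) =
    e c q (.plus n) * e c q (.minus m) -
      ((-1 : K) ^ c.theta * q ^ (2 : ℤ))⁻¹ • (e c q (.minus m) * e c q (.plus n)) := by
  rw [qAl_inv]
  exact qComm_odd c rfl rfl rfl _ _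

end RootVectors
end AffineCW

/-! ### The relations for both algebras -/

open AffineCW Finset in
theorem proposition3p1 {K : Type*} [Field K] [CharZero K] (c : AffType) (q : K)
    (hq0 : q ≠ 0) (hq : ∀ n : ℕ, 0 < n → q ^ n ≠ 1) :
    -- weights under the Cartan elements
    (∀ n : ℤ,
      (kGen c q .d : Uq c q) * e c q (.plus n) * ↑(kGen c q .d)⁻¹ = q ^ n • e c q (.plus n) ∧
      (kGen c q .d : Uq c q) * e c q (.minus n) * ↑(kGen c q .d)⁻¹ = q ^ n • e c q (.minus n)) ∧
    (∀ n : ℤ, n ≠ 0 →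
      (kGen c q .d : Uq c q) * e c q (.imag n) * ↑(kGen c q .d)⁻¹ = q ^ n • e c q (.imag n)) ∧
    (∀ γ ∈ redPos, ∀ n : ℤ,
      (kRoot c q γ : Uq c q) * e c q (.plus n) * ↑(kRoot c q γ)⁻¹
        = q ^ form γ (1, 0) • e c q (.plus n) ∧
      (kRoot c q γ : Uq c q) * e c q (.minus n) * ↑(kRoot c q γ)⁻¹
        = q ^ (-form γ (1, 0)) • e c q (.minus n)) ∧
    (∀ γ ∈ redPos, ∀ n : ℤ, n ≠ 0 →
      (kRoot c q γ : Uq c q) * e c q (.imag n) * ↑(kRoot c q γ)⁻¹ = e c q (.imag n)) ∧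
    -- opposite real root vectors
    (∀ n : ℤ, 0 ≤ n →
      br c q (.plus n) (.minus (-n)) =
        (sgn K c n / (q - q⁻¹)) • ((kRoot c q (1, n) : Uq c q) - ↑(kRoot c q (1, n))⁻¹)) ∧
    (∀ n : ℤ, 0 < n →
      br c q (.minus n) (.plus (-n)) =
        (sgn K c (n - 1) / (q - q⁻¹)) •
          ((kRoot c q (-1, n) : Uq c q) - ↑(kRoot c q (-1, n))⁻¹)) ∧
    -- two root vectors `e_{nδ+α}` with nonnegative `n`
    (∀ n m : ℤ, 0 ≤ n → 0 < m →
      brq c q (.plus n) (.plus (n + 2 * m - 1)) =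
        (qAl c q ^ 2 - 1) • ∑ l ∈ Icc 1 (m - 1), qAl c q ^ (-l) •
          (e c q (.plus (n + l)) * e c q (.plus (n + 2 * m - 1 - l)))) ∧
    (∀ n m : ℤ, 0 ≤ n → 0 < m →
      brq c q (.plus n) (.plus (n + 2 * m)) =
        ((qAl c q - 1) * qAl c q ^ (-m + 1)) • e c q (.plus (n + m)) ^ 2 +
        (qAl c q ^ 2 - 1) • ∑ l ∈ Icc 1 (m - 1), qAl c q ^ (-l) •
          (e c q (.plus (n + l)) * e c q (.plus (n + 2 * m - l)))) ∧
    -- two root vectors `e_{nδ-α}` with positive `n`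
    (∀ n m : ℤ, 0 < n → 0 < m →
      brq c q (.minus (n + 2 * m - 1)) (.minus n) =
        (qAl c q ^ 2 - 1) • ∑ l ∈ Icc 1 (m - 1), qAl c q ^ (-l) •
          (e c q (.minus (n + 2 * m - 1 - l)) * e c q (.minus (n + l)))) ∧
    (∀ n m : ℤ, 0 < n → 0 < m →
      brq c q (.minus (n + 2 * m)) (.minus n) =
        ((qAl c q - 1) * qAl c q ^ (-m + 1)) • e c q (.minus (n + m)) ^ 2 +
        (qAl c q ^ 2 - 1) • ∑ l ∈ Icc 1 (m - 1), qAl c q ^ (-l) •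
          (e c q (.minus (n + 2 * m - l)) * e c q (.minus (n + l)))) ∧
    -- `e_{-nδ+α}` with `e_{(n+2m-1)δ+α}` and with `e_{(n+2m)δ+α}`
    (∀ n m : ℤ, 0 < n → 0 < m →
      br c q (.plus (-n)) (.plus (n + 2 * m - 1)) =
        -(sgn K c (n - 1) * (qAl c q ^ 2 - 1)) • ∑ l ∈ Icc n (n + m - 1), qAl c q ^ (-l) •
          ((kRoot c q (-1, n) : Uq c q) *
            e c q (.plus (l - n)) * e c q (.plus (n + 2 * m - 1 - l))) +
        (qAl c q ^ 2 - 1) • ∑ l ∈ Icc 1 (n - 1), (sgn K c l * qAl c q ^ (-l)) •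
          (((kRoot c q (0, 1) ^ l : (Uq c q)ˣ) : Uq c q) *
            e c q (.plus (-n + l)) * e c q (.plus (n + 2 * m - 1 - l)))) ∧
    (∀ n m : ℤ, 0 < n → 0 < m →
      br c q (.plus (-n)) (.plus (n + 2 * m)) =
        -(sgn K c (n - 1) * (qAl c q ^ 2 - 1)) • ∑ l ∈ Icc n (n + m - 1), qAl c q ^ (-l) •
          ((kRoot c q (-1, n) : Uq c q) *
            e c q (.plus (l - n)) * e c q (.plus (n + 2 * m - l))) +
        (qAl c q ^ 2 - 1) • ∑ l ∈ Icc 1 (n - 1), (sgn K c l * qAl c q ^ (-l)) •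
          (((kRoot c q (0, 1) ^ l : (Uq c q)ˣ) : Uq c q) *
            e c q (.plus (-n + l)) * e c q (.plus (n + 2 * m - l))) -
        (sgn K c (n - 1) * (qAl c q - 1) * qAl c q ^ (-m - n + 1)) •
          ((kRoot c q (-1, n) : Uq c q) * e c q (.plus m) ^ 2)) ∧
    -- `e_{(n+2m-1)δ-α}` and `e_{(n+2m)δ-α}` with `e_{-nδ-α}`
    (∀ n m : ℤ, 0 ≤ n → 0 < m →
      br c q (.minus (n + 2 * m - 1)) (.minus (-n)) =
        -(sgn K c (n + 1) * (qAl c q ^ 2 - 1)) • ∑ l ∈ Icc (n + 1) (n + m - 1), qAl c q ^ (-l) •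
          (e c q (.minus (n + 2 * m - 1 - l)) * e c q (.minus (l - n)) *
            (↑(kRoot c q (1, n))⁻¹ : Uq c q)) +
        (qAl c q ^ 2 - 1) • ∑ l ∈ Icc 1 n, (sgn K c l * qAl c q ^ (-l)) •
          (e c q (.minus (n + 2 * m - 1 - l)) * e c q (.minus (-n + l)) *
            ((kRoot c q (0, 1) ^ (-l) : (Uq c q)ˣ) : Uq c q))) ∧
    (∀ n m : ℤ, 0 ≤ n → 0 < m →
      br c q (.minus (n + 2 * m)) (.minus (-n)) =
        -(sgn K c (n + 1) * (qAl c q ^ 2 - 1)) • ∑ l ∈ Icc (n + 1) (n + m - 1), qAl c q ^ (-l) •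
          (e c q (.minus (n + 2 * m - l)) * e c q (.minus (l - n)) *
            (↑(kRoot c q (1, n))⁻¹ : Uq c q)) +
        (qAl c q ^ 2 - 1) • ∑ l ∈ Icc 1 n, (sgn K c l * qAl c q ^ (-l)) •
          (e c q (.minus (n + 2 * m - l)) * e c q (.minus (-n + l)) *
            ((kRoot c q (0, 1) ^ (-l) : (Uq c q)ˣ) : Uq c q)) -
        (sgn K c (n + 1) * (qAl c q - 1) * qAl c q ^ (-m - n + 1)) •
          (e c q (.minus m) ^ 2 * (↑(kRoot c q (1, n))⁻¹ : Uq c q))) ∧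
    -- brackets of real root vectors that give the vectors `e'`
    (∀ n m : ℤ, 0 ≤ n → 0 < m →
      brq c q (.plus n) (.minus m) = e c q (.imag (n + m))) ∧
    (∀ n m : ℤ, 0 ≤ m → m < n →
      br c q (.plus n) (.minus (-m)) =
        -sgn K c (m + 1) • (e c q (.imag (n - m)) * (↑(kRoot c q (1, m))⁻¹ : Uq c q))) ∧
    (∀ n m : ℤ, 0 < m → m < n →
      br c q (.plus (-m)) (.minus n) =
        -sgn K c (m - 1) • ((kRoot c q (-1, m) : Uq c q) * e c q (.imag (n - m)))) ∧
    -- commutativity of the vectors `e'`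
    (∀ n m : ℤ, 0 < n → 0 < m →
      br c q (.imag n) (.imag m) = 0 ∧ br c q (.imag (-n)) (.imag (-m)) = 0) ∧
    -- positive real root vectors with the vectors `e'`
    (∀ n m : ℤ, 0 ≤ n → 0 < m →
      br c q (.plus n) (.imag m) =
        (qAl c q ^ (-m + 1) * aCoef q) • e c q (.plus (n + m)) +
        (qAl c q ^ 2 - 1) • ∑ l ∈ Icc 1 (m - 1), qAl c q ^ (-l) •
          (e c q (.plus (n + l)) * e c q (.imag (m - l)))) ∧
    (∀ n m : ℤ, 0 < n → 0 < m →
      br c q (.imag m) (.minus n) =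
        (qAl c q ^ (-m + 1) * aCoef q) • e c q (.minus (n + m)) +
        (qAl c q ^ 2 - 1) • ∑ l ∈ Icc 1 (m - 1), qAl c q ^ (-l) •
          (e c q (.imag (m - l)) * e c q (.minus (n + l)))) ∧
    -- negative real root vectors with the vectors `e'`
    (∀ n m : ℤ, 0 < n → n ≤ m →
      br c q (.plus (-n)) (.imag m) =
        -(sgn K c (n - 1) * qAl c q ^ (-m + 1) * aCoef q) •
          ((kRoot c q (-1, n) : Uq c q) * e c q (.plus (m - n))) -
        (sgn K c (n - 1) * (qAl c q ^ 2 - 1)) •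
          ((kRoot c q (-1, n) : Uq c q) * ∑ l ∈ Icc n (m - 1), qAl c q ^ (-l) •
            (e c q (.plus (l - n)) * e c q (.imag (m - l)))) +
        (qAl c q ^ 2 - 1) • ∑ l ∈ Icc 1 (n - 1), (sgn K c l * qAl c q ^ (-l)) •
          (((kRoot c q (0, 1) ^ l : (Uq c q)ˣ) : Uq c q) *
            e c q (.plus (-n + l)) * e c q (.imag (m - l)))) ∧
    (∀ n m : ℤ, 0 < m → m < n →
      br c q (.plus (-n)) (.imag m) =
        (sgn K c m * qAl c q ^ (-m + 1) * aCoef q) •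
          (((kRoot c q (0, 1) ^ m : (Uq c q)ˣ) : Uq c q) * e c q (.plus (-n + m))) +
        (qAl c q ^ 2 - 1) • ∑ l ∈ Icc 1 (m - 1), (sgn K c l * qAl c q ^ (-l)) •
          (((kRoot c q (0, 1) ^ l : (Uq c q)ˣ) : Uq c q) *
            e c q (.plus (-n + l)) * e c q (.imag (m - l)))) ∧
    (∀ n m : ℤ, 0 ≤ n → n < m →
      br c q (.imag m) (.minus (-n)) =
        -(sgn K c (n + 1) * qAl c q ^ (-m + 1) * aCoef q) •
          (e c q (.minus (m - n)) * (↑(kRoot c q (1, n))⁻¹ : Uq c q)) -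
        (sgn K c (n + 1) * (qAl c q ^ 2 - 1)) •
          ∑ l ∈ Icc (n + 1) (m - 1), qAl c q ^ (-l) •
            (e c q (.imag (m - l)) * e c q (.minus (l - n)) *
              (↑(kRoot c q (1, n))⁻¹ : Uq c q)) +
        (qAl c q ^ 2 - 1) • ∑ l ∈ Icc 1 n, (sgn K c l * qAl c q ^ (-l)) •
          (e c q (.imag (m - l)) * e c q (.minus (-n + l)) *
            ((kRoot c q (0, 1) ^ (-l) : (Uq c q)ˣ) : Uq c q))) ∧
    (∀ n m : ℤ, 0 < m → m ≤ n →
      br c q (.imag m) (.minus (-n)) =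
        (sgn K c m * qAl c q ^ (-m + 1) * aCoef q) •
          (e c q (.minus (-n + m)) * ((kRoot c q (0, 1) ^ (-m) : (Uq c q)ˣ) : Uq c q)) +
        (qAl c q ^ 2 - 1) • ∑ l ∈ Icc 1 (m - 1), (sgn K c l * qAl c q ^ (-l)) •
          (e c q (.imag (m - l)) * e c q (.minus (-n + l)) *
            ((kRoot c q (0, 1) ^ (-l) : (Uq c q)ˣ) : Uq c q))) := by
  have h := genericRootVecs c hq0 hq
  have ha := h.ha
  have hform : ∀ γ : Wt, form γ (1, 0) = 2 * γ.1 := fun γ ↦ mul_one _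
  -- All signs, Cartan elements and brackets are written through `p = (-1)^θ`, `g = q²`, `k = k_α`
  -- and `d = k_δ`, so that each clause after the weight statements is literally a relation of
  -- `GenericRootVecs`.
  simp only [sgn_eq, qAl_eq, kRoot_plus, kRoot_minus, kRoot_delta, br_plus_plus, br_plus_minus,
    br_minus_plus, br_minus_minus, br_imag_left, br_imag_right, brq_plus_plus, brq_minus_minus,
    brq_plus_minus, div_eq_mul_inv]
  refine ⟨fun n ↦ ⟨conj_of_weight (kd_plus c hq0 ha n).1, conj_of_weight (kd_plus c hq0 ha n).2⟩,
    fun n hn ↦ conj_of_weight (kd_imag c hq0 ha hn), fun γ _ n ↦ ⟨?_, ?_⟩, fun γ _ n hn ↦ ?_,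
    fun n hn ↦ h.E_F_opp hn, fun n hn ↦ h.F_E_opp hn, fun n m hn hm ↦ h.E_E_odd hn hm,
    fun n m hn hm ↦ h.E_E_even hn hm, fun n m hn hm ↦ h.F_F_odd hn hm,
    fun n m hn hm ↦ h.F_F_even hn hm, fun n m hn hm ↦ h.E_neg_E_odd hn hm,
    fun n m hn hm ↦ h.E_neg_E_even hn hm, fun n m hn hm ↦ h.F_F_neg_odd hn hm,
    fun n m hn hm ↦ h.F_F_neg_even hn hm, fun n m hn hm ↦ h.E_F_pos hn hm,
    fun n m hm hmn ↦ h.E_F_imag hm hmn, fun n m hm hmn ↦ h.E_neg_F_imag hm hmn,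
    fun n m hn hm ↦ ⟨sub_eq_zero.2 (h.I_comm hn hm), sub_eq_zero.2 (h.I_neg_comm hn hm)⟩,
    fun n m hn hm ↦ h.E_I hn hm, fun n m hn hm ↦ h.I_F hn hm,
    fun n m hn hnm ↦ h.E_neg_I_high hn hnm, fun n m hm hmn ↦ h.E_neg_I_low hm hmn,
    fun n m hn hnm ↦ h.I_F_neg_high hn hnm, fun n m hm hmn ↦ h.I_F_neg_low hm hmn⟩
  · rw [kRoot_eq, hform, zpow_mul]
    exact conj_of_weight (h.root.weight_root_E ha h.hg _ _ n)
  · rw [kRoot_eq, hform, zpow_neg, zpow_mul]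
    exact conj_of_weight (h.root.weight_root_F ha h.hg _ _ n)
  · rw [kRoot_eq]
    exact (conj_of_weight ((h.root.weight_root_I ha h.hg _ _ hn).trans
      (one_smul K _).symm)).trans (one_smul K _)
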